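/- **Setting.** Let $n\ge 2$, $\hbar\in\mathbb R\setminus\{0\}$, $\lambda,\mu\in\mathbb C$, $\delta=\mu-\lambda$, and assume $\delta\neq 1+\frac{\ell}{n+1}$ for all $\ell=0,1,2,\dots$. Let $S^n$ be the sphere of rays of $\mathbb R^{n+1}$ with its action of $\mathrm{SL}(n+1,\mathbb R)$ and its atlas of affine charts, the chart of $g\in \mathrm{SL}(n+1,\mathbb R)$ being $x\mapsto$ the ray through $g(x,1)$. Let $\mathcal F_\lambda$ be the space of smooth complex-valued $\lambda$-densities on $S^n$, $\mathcal D_{\lambda,\mu}$ the space of linear differential operators $\mathcal F_\lambda\to\mathcal F_\mu$, and $\mathcal S_\delta=\bigoplus_k\mathcal S_{k,\delta}$ the space of smooth functions on $T^*S^n$, polynomial on the fibres, with values in $\delta$-densities, graded by the degree in the fibre coordinates $\xi$. A *projectively equivariant quantization map* is a linear map $\mathcal Q_{\lambda,\mu}:\mathcal S_\delta\to\mathcal D_{\lambda,\mu}$ that commutes with the action of the Lie algebra $\mathrm{sl}(n+1,\mathbb R)$ by Lie derivatives and is such that, for $P=P^{i_1\dots i_k}\xi_{i_1}\cdots\xi_{i_k}\in\mathcal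 S_{k,\delta}$, the operator $\mathcal Q_{\lambda,\mu}(P)$ equals $\mathcal I(P)=(-i\hbar)^kP^{i_1\dots i_k}\partial_{i_1}\cdots\partial_{i_k}$ up to terms of order at most $k-1$ in each affine chart. In affine coordinates it is given on $\mathcal S_{k,\delta}$ explicitly by $$P\mapsto \mathcal I\Big(\sum_{m=0}^k C^k_m(-i\hbar \mathrm D)^mP\Big),\qquad \mathrm D=\frac{\partial}{\partial x^i}\frac{\partial}{\partial\xi_i},\qquad C_0^k=1,\quad C^k_{m+1}=\frac{k-m-1+(n+1)\lambda}{(m+1)(2k-m-2+(n+1)(1-\delta))}\,C^k_m .$$ Let $\mathrm g$ be the round metric of the unit sphere, $H=\mathrm g^{ij}\xi_i\xi_j$, $g=\det(\mathrm g_{ij})$ and $H_\delta=H\sqrt{g^\delta}\in\mathcal S_{2,\delta}$. On $\lambda$-densities put $\nabla_i=\partial_i-\lambda\Gamma^j_{ij}$ and $\Delta=\mathrm g^{ij}\nabla_i\nabla_j$, where $\Gamma$ is the Levi-Civita connection (which also acts on the index of $\nabla_j\phi$). **Proposition.** Every projectively equivariant quantization map $\mathcal Q_{\lambda,\mu}$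 satisfies, for all $\phi\in\mathcal F_\lambda$, $$\mathcal Q_{\lambda,\mu}(H_\delta)\,\phi=-\hbar^2\,\sqrt{g^\delta}\,\bigl(\Delta+C_{\lambda,\mu}R\bigr)\phi ,\qquad C_{\lambda,\mu}=\frac{(n+1)^2\lambda(\mu-1)}{(n-1)\bigl((1-\delta)(n+1)+1\bigr)},$$ where $R$ is the scalar curvature of $\mathrm g$, which is the constant $R=n(n-1)$; and the explicit formula above, applied to $H_\delta$ in any affine chart, gives this same operator. -/

import Mathlib

open scoped ContDiff Matrix

noncomputable section

namespace ProjQuant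

/-! ### The sphere with its atlas of affine charts

The sphere `S^n ⊂ ℝ^{n+1}` is the space of rays of `ℝ^{n+1}`, and `SL(n+1,ℝ)` acts on it through
its linear action on rays. Every `g` in `SL(n+1,ℝ)` gives affine coordinates on an open
half-sphere: `x ∈ ℝ^n` stands for the ray through `g (x,1)`. These charts form an atlas of
`S^n`. Geometric objects on `S^n` are given, as usual, by their expressions in all the charts
of this atlas, related on the overlaps by the transformation law of the object. -/

/-- The group `SL(n+1,ℝ)`, which also indexes the affine charts. -/
abbrev SL (n : ℕ) := Matrix.SpecialLinearGroup (Fin (n + 1)) ℝ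

/-- `x ↦ (x,1)`. -/
def lift {n : ℕ} (x : Fin n → ℝ) : Fin (n + 1) → ℝ := Fin.snoc (α := fun _ => ℝ) x 1

/-- The vector `g (x,1)` of `ℝ^{n+1}`. -/
def ray {n : ℕ} (g : SL n) (x : Fin n → ℝ) : EuclideanSpace ℝ (Fin (n + 1)) :=
  WithLp.toLp 2 (g.1 *ᵥ lift x)

/-- The point of the unit sphere `S^n` with affine coordinates `x` in the chart `g`. -/
def param {n : ℕ} (g : SL n) (x : Fin n → ℝ) : EuclideanSpace ℝ (Fin (n + 1)) :=
  ‖ray g x‖⁻¹ • ray g x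

/-- The change of coordinates from the chart `g` to the chart `h`: where the two charts overlap,
`param g x = param h (transition g h x)`. -/
def transition {n : ℕ} (g h : SL n) (x : Fin n → ℝ) : Fin n → ℝ := fun i =>
  ((h⁻¹ * g).1 *ᵥ lift x) i.castSucc / ((h⁻¹ * g).1 *ᵥ lift x) (Fin.last n)

/-- The partial derivative `∂f/∂x^i`. -/
def pd {n : ℕ} {F : Type*} [NormedAddCommGroup F] [NormedSpace ℝ F] (i : Fin n)
    (f : (Fin n → ℝ) → F) (x : Fin n → ℝ) : F :=
  fderiv ℝ f x (Pi.single i 1)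

/-- The iterated partial derivative `∂^k f/∂x^{i_1}⋯∂x^{i_k}`. -/
def pdIter {n k : ℕ} (i : Fin k → Fin n) (f : (Fin n → ℝ) → ℂ) (x : Fin n → ℝ) : ℂ :=
  iteratedFDeriv ℝ k f x (fun l => Pi.single (i l) 1)

/-- The Jacobian matrix `∂y^i/∂x^j` of the change of coordinates `x ↦ y` from `g` to `h`. -/
def jac {n : ℕ} (g h : SL n) (x : Fin n → ℝ) : Matrix (Fin n) (Fin n) ℝ :=
  Matrix.of fun i j => pd j (transition g h) x i

/-- `|∂y/∂x|^s`, for a complex exponent `s`. -/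
def jacPow {n : ℕ} (s : ℂ) (g h : SL n) (x : Fin n → ℝ) : ℂ :=
  ((|(jac g h x).det| : ℝ) : ℂ) ^ s

/-! ### Densities, symbols and differential operators on the sphere -/

/-- The space `F_lam(S^n)` of smooth complex-valued densities of degree `lam`:
`φ g` is the expression of `φ` in the chart `g`. -/
def densities (n : ℕ) (lam : ℂ) : Submodule ℂ (SL n → (Fin n → ℝ) → ℂ) where
  carrier := {φ | (∀ g, ContDiff ℝ ∞ (φ g)) ∧
    ∀ g h x y, param g x = param h y → φ g x = jacPow lam g h x * φ h y}
  add_mem' := by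
    rintro φ ψ ⟨h1, h2⟩ ⟨h3, h4⟩
    refine ⟨fun g => (h1 g).add (h3 g), fun g h x y e => ?_⟩
    simp only [Pi.add_apply]
    rw [h2 g h x y e, h4 g h x y e]
    ring
  zero_mem' := ⟨fun _ => contDiff_const, fun _ _ _ _ _ => by simp⟩
  smul_mem' := by
    rintro c φ ⟨h1, h2⟩
    refine ⟨fun g => contDiff_const.mul (h1 g), fun g h x y e => ?_⟩
    simp only [Pi.smul_apply, smul_eq_mul]
    rw [h2 g h x y e]
    ring

/-- The space `S_δ(S^n)` of symbols: smooth functions on `T^*S^n`, polynomial (of bounded degree)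
on the fibres, with values in densities of degree `δ`. Here `P g x ξ` is the expression in the
chart `g`, with `ξ` the coordinates dual to `x`; under a change of coordinates `x ↦ y` the
covector with coordinates `η` has the coordinates `ξ_j = (∂y^i/∂x^j) η_i`. -/
def symbols (n : ℕ) (δ : ℂ) : Submodule ℂ (SL n → (Fin n → ℝ) → (Fin n → ℝ) → ℂ) where
  carrier := {P | (∀ g, ContDiff ℝ ∞ fun z : (Fin n → ℝ) × (Fin n → ℝ) => P g z.1 z.2) ∧
    (∃ N : ℕ, ∀ g x, ∃ p : MvPolynomial (Fin n) ℂ, p.totalDegree ≤ N ∧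
      ∀ ξ, P g x ξ = MvPolynomial.eval (fun i => ((ξ i : ℝ) : ℂ)) p) ∧
    ∀ g h x y, param g x = param h y →
      ∀ η, P g x ((jac g h x)ᵀ *ᵥ η) = jacPow δ g h x * P h y η}
  add_mem' := by
    rintro P P' ⟨h1, ⟨N, h2⟩, h3⟩ ⟨h1', ⟨N', h2'⟩, h3'⟩
    refine ⟨fun g => (h1 g).add (h1' g), ⟨max N N', fun g x => ?_⟩, fun g h x y e η => ?_⟩
    · obtain ⟨p, hp, hp'⟩ := h2 g x
      obtain ⟨q, hq, hq'⟩ := h2' g x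
      refine ⟨p + q, (MvPolynomial.totalDegree_add p q).trans (max_le_max hp hq), fun ξ => ?_⟩
      simp only [Pi.add_apply, map_add]
      rw [hp', hq']
    · simp only [Pi.add_apply]
      rw [h3 g h x y e, h3' g h x y e]
      ring
  zero_mem' := ⟨fun _ => contDiff_const, ⟨0, fun _ _ => ⟨0, by simp, by simp⟩⟩,
    fun _ _ _ _ _ _ => by simp⟩
  smul_mem' := by
    rintro c P ⟨h1, ⟨N, h2⟩, h3⟩
    refine ⟨fun g => contDiff_const.mul (h1 g), ⟨N, fun g x => ?_⟩, fun g h x y e η => ?_⟩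
    · obtain ⟨p, hp, hp'⟩ := h2 g x
      refine ⟨c • p, (MvPolynomial.totalDegree_smul_le c p).trans hp, fun ξ => ?_⟩
      simp only [Pi.smul_apply, smul_eq_mul, MvPolynomial.smul_eval]
      rw [hp']
    · simp only [Pi.smul_apply, smul_eq_mul]
      rw [h3 g h x y e]
      ring

/-- Symbols that are homogeneous of degree `k` on the fibres: the subspace `S_{k,δ}`. -/
def IsHomogeneous {n : ℕ} {δ : ℂ} (k : ℕ) (P : symbols n δ) : Prop :=
  ∀ g x (t : ℝ) ξ, P.1 g x (t • ξ) = (t : ℂ) ^ k * P.1 g x ξ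

/-- The operator `∑_{j<k} a_j^{i_1…i_j}(x) ∂_{i_1}⋯∂_{i_j}`, of order less than `k`. -/
def localOp {n : ℕ} (k : ℕ) (a : (j : ℕ) → (Fin j → Fin n) → (Fin n → ℝ) → ℂ)
    (f : (Fin n → ℝ) → ℂ) (x : Fin n → ℝ) : ℂ :=
  ∑ j ∈ Finset.range k, ∑ i : Fin j → Fin n, a j i x * pdIter i f x

/-- The space `D_{lam,mu}(S^n)` of linear differential operators from `F_lam(S^n)` to
`F_mu(S^n)`. -/
def diffOps (n : ℕ) (lam mu : ℂ) : Submodule ℂ (densities n lam →ₗ[ℂ] densities n mu) where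
  carrier := {A | ∃ k, ∀ g, ∃ a : (j : ℕ) → (Fin j → Fin n) → (Fin n → ℝ) → ℂ,
    (∀ j i, ContDiff ℝ ∞ (a j i)) ∧ ∀ φ x, (A φ).1 g x = localOp k a (φ.1 g) x}
  add_mem' := by
    rintro A B ⟨k, hA⟩ ⟨l, hB⟩
    refine ⟨max k l, fun g => ?_⟩
    obtain ⟨a, ha, ha'⟩ := hA g
    obtain ⟨b, hb, hb'⟩ := hB g
    have key : ∀ (k m : ℕ) (_ : k ≤ m) (a : (j : ℕ) → (Fin j → Fin n) → (Fin n → ℝ) → ℂ) f x,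
        localOp k a f x = localOp m (fun j i y => if j < k then a j i y else 0) f x := by
      intro k m hkm a f x
      unfold localOp
      rw [← Finset.sum_subset (Finset.range_mono hkm)]
      · exact Finset.sum_congr rfl fun j hj => by simp [Finset.mem_range.1 hj]
      · intro j _ hj
        simp [Finset.mem_range] at hj
        simp [Nat.not_lt.2 hj]
    refine ⟨fun j i y => (if j < k then a j i y else 0) + (if j < l then b j i y else 0),
      fun j i => ?_, fun φ x => ?_⟩
    · refine ContDiff.add ?_ ?_
      · by_cases h : j < k
        · simpa [h] using ha j i
        · simpa [h] using contDiff_const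
      · by_cases h : j < l
        · simpa [h] using hb j i
        · simpa [h] using contDiff_const
    · have : ((A + B) φ).1 g x = (A φ).1 g x + (B φ).1 g x := rfl
      rw [this, ha', hb', key k _ (le_max_left k l), key l _ (le_max_right k l)]
      simp only [localOp, add_mul, Finset.sum_add_distrib]
  zero_mem' := ⟨0, fun _ => ⟨fun _ _ _ => 0, fun _ _ => contDiff_const, fun _ _ => by
    simp [localOp]⟩⟩
  smul_mem' := by
    rintro c A ⟨k, hA⟩
    refine ⟨k, fun g => ?_⟩
    obtain ⟨a, ha, ha'⟩ := hA g
    refine ⟨fun j i y => c * a j i y, fun j i => contDiff_const.mul (ha j i), fun φ x => ?_⟩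
    have : ((c • A) φ).1 g x = c * (A φ).1 g x := rfl
    rw [this, ha']
    simp only [localOp, Finset.mul_sum, mul_assoc]

/-! ### Projectively equivariant quantization -/

/-- The operator `(-iħ)^k P^{i_1…i_k}(x) ∂_{i_1}⋯∂_{i_k}` attached by normal ordering, in one
chart, to `P = P^{i_1…i_k}(x) ξ_{i_1}⋯ξ_{i_k}`; the symmetric coefficients are
`P^{i_1…i_k} = (1/k!) ∂^k P/∂ξ_{i_1}⋯∂ξ_{i_k}`. -/
def normalOrder {n : ℕ} (hbar : ℝ) (k : ℕ) (P : (Fin n → ℝ) → (Fin n → ℝ) → ℂ)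
    (f : (Fin n → ℝ) → ℂ) (x : Fin n → ℝ) : ℂ :=
  (-Complex.I * hbar) ^ k *
    ∑ i : Fin k → Fin n, (1 / (k.factorial : ℂ)) * pdIter i (P x) 0 * pdIter i f x

/-- The expression, in affine coordinates, of the linear vector field `X ↦ Y X` of `ℝ^{n+1}`
as a vector field on rays. When `Y` runs over the traceless matrices these are the linear
combinations of `∂_i`, `x^i ∂_j` and `∑_j x^i x^j ∂_j`. -/
def chartField {n : ℕ} (Y : Matrix (Fin (n + 1)) (Fin (n + 1)) ℝ) (x : Fin n → ℝ) : Fin n → ℝ :=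
  fun i => (Y *ᵥ lift x) i.castSucc - x i * (Y *ᵥ lift x) (Fin.last n)

/-- The vector field on `S^n` generated by `Z` in `sl(n+1,ℝ)`, in the chart `g`. -/
def actionField {n : ℕ} (Z : Matrix (Fin (n + 1)) (Fin (n + 1)) ℝ) (g : SL n) :
    (Fin n → ℝ) → Fin n → ℝ :=
  chartField ((g⁻¹).1 * Z * g.1)

/-- The divergence `∂_i V^i` in a chart. -/
def divField {n : ℕ} (V : (Fin n → ℝ) → Fin n → ℝ) (x : Fin n → ℝ) : ℝ :=
  ∑ i, pd i (fun y => V y i) x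

/-- The Lie derivative `V^i ∂_i f + lam (∂_i V^i) f` of a density of degree `lam` in a chart. -/
def lieDensity {n : ℕ} (lam : ℂ) (V : (Fin n → ℝ) → Fin n → ℝ) (f : (Fin n → ℝ) → ℂ)
    (x : Fin n → ℝ) : ℂ :=
  (∑ i, (V x i : ℂ) * pd i f x) + lam * (divField V x : ℂ) * f x

/-- The Lie derivative
`V^i ∂P/∂x^i - ξ_j (∂V^j/∂x^i) ∂P/∂ξ_i + δ (∂_i V^i) P` of a symbol of weight `δ` in a chart. -/
def lieSymbol {n : ℕ} (δ : ℂ) (V : (Fin n → ℝ) → Fin n → ℝ)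
    (P : (Fin n → ℝ) → (Fin n → ℝ) → ℂ) (x ξ : Fin n → ℝ) : ℂ :=
  (∑ i, (V x i : ℂ) * pd i (fun y => P y ξ) x)
    - (∑ i, ∑ j, ((ξ j * pd i (fun y => V y j) x : ℝ) : ℂ) * pd i (P x) ξ)
    + δ * (divField V x : ℂ) * P x ξ

/-- `φ'` is the Lie derivative of the density `φ` along the action of `Z`. -/
def IsLieDensity {n : ℕ} {lam : ℂ} (Z : Matrix (Fin (n + 1)) (Fin (n + 1)) ℝ)
    (φ φ' : densities n lam) : Prop :=
  ∀ g x, φ'.1 g x = lieDensity lam (actionField Z g) (φ.1 g) x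

/-- `P'` is the Lie derivative of the symbol `P` along the action of `Z`. -/
def IsLieSymbol {n : ℕ} {δ : ℂ} (Z : Matrix (Fin (n + 1)) (Fin (n + 1)) ℝ)
    (P P' : symbols n δ) : Prop :=
  ∀ g x ξ, P'.1 g x ξ = lieSymbol δ (actionField Z g) (P.1 g) x ξ

/-- A projectively equivariant quantization map `Q : S_δ(S^n) → D_{lam,mu}(S^n)`,
`δ = mu - lam`. -/
structure IsProjectiveQuantization {n : ℕ} (hbar : ℝ) (lam mu : ℂ)
    (Q : symbols n (mu - lam) →ₗ[ℂ] diffOps n lam mu) : Prop where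
  /-- The principal symbol of `Q P` is `P`: for `P` homogeneous of degree `k`, the operator `Q P`
  agrees with the normal ordering of `P` up to an operator of order at most `k - 1`. -/
  principal : ∀ k (P : symbols n (mu - lam)), IsHomogeneous k P → ∀ g,
    ∃ a : (j : ℕ) → (Fin j → Fin n) → (Fin n → ℝ) → ℂ, (∀ j i, ContDiff ℝ ∞ (a j i)) ∧
      ∀ φ x, ((Q P).1 φ).1 g x =
        normalOrder hbar k (P.1 g) (φ.1 g) x + localOp k a (φ.1 g) x
  /-- Equivariance, `Q (L_Z P) = L_Z ∘ Q P - Q P ∘ L_Z` for all `Z` in `sl(n+1,ℝ)`. -/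
  equivariant : ∀ Z : Matrix (Fin (n + 1)) (Fin (n + 1)) ℝ, Z.trace = 0 →
    ∀ P P' : symbols n (mu - lam), IsLieSymbol Z P P' →
    ∀ φ φ' : densities n lam, IsLieDensity Z φ φ' →
    ∀ g x, ((Q P').1 φ).1 g x =
      lieDensity mu (actionField Z g) (((Q P).1 φ).1 g) x - ((Q P).1 φ').1 g x

/-- The divergence operator `D = ∂²/∂x^i∂ξ_i` on symbols, in a chart. -/
def divOp {n : ℕ} (P : (Fin n → ℝ) → (Fin n → ℝ) → ℂ) (x ξ : Fin n → ℝ) : ℂ :=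
  ∑ i, pd i (fun y => pd i (P y) ξ) x

/-- The coefficients `C_m^k` of the projectively equivariant quantization map. -/
def quantCoeff (n : ℕ) (lam mu : ℂ) (k : ℕ) : ℕ → ℂ
  | 0 => 1
  | m + 1 => ((k : ℂ) - m - 1 + (n + 1) * lam) /
      ((m + 1) * (2 * (k : ℂ) - m - 2 + (n + 1) * (1 - (mu - lam)))) * quantCoeff n lam mu k m

/-- The explicit quantization map in an affine chart, on symbols of degree `k`: the normal
ordering of `∑_{m ≤ k} C_m^k (-iħ D)^m P`. -/
def affineQuantization {n : ℕ} (hbar : ℝ) (lam mu : ℂ) (k : ℕ)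
    (P : (Fin n → ℝ) → (Fin n → ℝ) → ℂ) (f : (Fin n → ℝ) → ℂ) (x : Fin n → ℝ) : ℂ :=
  ∑ m ∈ Finset.range (k + 1), quantCoeff n lam mu k m *
    normalOrder hbar (k - m) (fun y ξ => (-Complex.I * hbar) ^ m * (divOp^[m] P) y ξ) f x

/-! ### The round metric -/

/-- The round metric `g_{ij}` in the chart `g`, induced by `ℝ^{n+1}` on the unit sphere. -/
def metric {n : ℕ} (g : SL n) (x : Fin n → ℝ) : Matrix (Fin n) (Fin n) ℝ :=
  Matrix.of fun i j => inner ℝ (pd i (param g) x) (pd j (param g) x)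

/-- `√(det g_{ij})^s = (det g_{ij})^{s/2}`, the expression of the density of degree `s` attached
to the metric. -/
def volPow {n : ℕ} (s : ℂ) (g : SL n) (x : Fin n → ℝ) : ℂ :=
  (((metric g x).det : ℝ) : ℂ) ^ (s / 2)

/-- The Christoffel symbols `Γ^k_{ij}` of the Levi-Civita connection. -/
def christoffel {n : ℕ} (g : SL n) (k i j : Fin n) (x : Fin n → ℝ) : ℝ :=
  (1 / 2) * ∑ l, (metric g x)⁻¹ k l *
    (pd i (fun y => metric g y j l) x + pd j (fun y => metric g y i l) x
      - pd l (fun y => metric g y i j) x)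

/-- The covariant derivative `∇_i f = ∂_i f - lam Γ^j_{ij} f` of a density of degree `lam`. -/
def covDeriv {n : ℕ} (lam : ℂ) (g : SL n) (i : Fin n) (f : (Fin n → ℝ) → ℂ) (x : Fin n → ℝ) : ℂ :=
  pd i f x - lam * (∑ j, (christoffel g j i j x : ℂ)) * f x

/-- The Laplace operator `g^{ij} ∇_i ∇_j` on densities of degree `lam`; the outer covariant
derivative acts on the covector-valued density `∇_j f`. -/
def laplacian {n : ℕ} (lam : ℂ) (g : SL n) (f : (Fin n → ℝ) → ℂ) (x : Fin n → ℝ) : ℂ :=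
  ∑ i, ∑ j, ((metric g x)⁻¹ i j : ℂ) *
    (covDeriv lam g i (covDeriv lam g j f) x
      - ∑ k, (christoffel g k i j x : ℂ) * covDeriv lam g k f x)

/-- The Ricci tensor
`R_{ij} = ∂_k Γ^k_{ij} - ∂_j Γ^k_{ik} + Γ^k_{kl} Γ^l_{ij} - Γ^k_{jl} Γ^l_{ik}`. -/
def ricci {n : ℕ} (g : SL n) (i j : Fin n) (x : Fin n → ℝ) : ℝ :=
  ∑ k, (pd k (christoffel g k i j) x - pd j (christoffel g k i k) x
    + ∑ l, (christoffel g k k l x * christoffel g l i j x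
      - christoffel g k j l x * christoffel g l i k x))

/-- The scalar curvature `R = g^{ij} R_{ij}`. -/
def scalarCurvature {n : ℕ} (g : SL n) (x : Fin n → ℝ) : ℝ :=
  ∑ i, ∑ j, (metric g x)⁻¹ i j * ricci g i j x

/-- The expression `H_δ = g^{ij} ξ_i ξ_j √(g^δ)` in the chart `g`. -/
def hamiltonianFun (n : ℕ) (δ : ℂ) (g : SL n) (x ξ : Fin n → ℝ) : ℂ :=
  ((∑ i, ∑ j, (metric g x)⁻¹ i j * ξ i * ξ j : ℝ) : ℂ) * volPow δ g x

theorem lift_castSucc {n : ℕ} (x : Fin n → ℝ) (i : Fin n) : lift x i.castSucc = x i := by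
  simp [lift]

theorem lift_last {n : ℕ} (x : Fin n → ℝ) : lift x (Fin.last n) = 1 := by
  simp [lift]

theorem contDiff_mulVec_lift {n : ℕ} (A : Matrix (Fin (n + 1)) (Fin (n + 1)) ℝ)
    (i : Fin (n + 1)) : ContDiff ℝ ∞ fun x : Fin n → ℝ => (A *ᵥ lift x) i := by
  simp only [Matrix.mulVec, dotProduct, Fin.sum_univ_castSucc, lift_castSucc, lift_last]
  fun_prop

theorem contDiff_ray {n : ℕ} (g : SL n) : ContDiff ℝ ∞ (ray g) :=
  contDiff_euclidean.2 fun i => contDiff_mulVec_lift g.1 i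

theorem inv_mulVec_mulVec {n : ℕ} (g : SL n) (v : Fin (n + 1) → ℝ) :
    (g⁻¹).1 *ᵥ (g.1 *ᵥ v) = v := by
  have h : (g⁻¹).1 * g.1 = 1 := by
    rw [← Matrix.SpecialLinearGroup.coe_mul]
    simp
  rw [Matrix.mulVec_mulVec, h, Matrix.one_mulVec]

theorem ray_ne_zero {n : ℕ} (g : SL n) (x : Fin n → ℝ) : ray g x ≠ 0 := by
  intro h
  have h1 : g.1 *ᵥ lift x = 0 := by
    simpa [ray] using h
  have h2 := inv_mulVec_mulVec g (lift x)
  rw [h1, Matrix.mulVec_zero] at h2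
  have h3 := congrFun h2 (Fin.last n)
  rw [lift_last] at h3
  simp at h3

theorem contDiff_param {n : ℕ} (g : SL n) : ContDiff ℝ ∞ (param g) :=
  (((contDiff_ray g).norm ℝ (ray_ne_zero g)).inv fun x => norm_ne_zero_iff.2 (ray_ne_zero g x)).smul
    (contDiff_ray g)

theorem fderiv_ray {n : ℕ} (g : SL n) (x u : Fin n → ℝ) :
    fderiv ℝ (ray g) x u
      = WithLp.toLp 2 (g.1 *ᵥ (Fin.snoc (α := fun _ => ℝ) u 0 : Fin (n + 1) → ℝ)) := by
  have h : HasFDerivAt (ray g) (fderiv ℝ (ray g) x) x :=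
    ((contDiff_ray g).differentiable (by simp) x).hasFDerivAt
  have h1 := (h.comp_hasDerivAt_of_eq (f := fun t : ℝ => x + t • u) 0
    (((hasDerivAt_id (0 : ℝ)).smul_const u).const_add x) (by simp))
  have h2 : HasDerivAt (fun t : ℝ => ray g x + t •
      WithLp.toLp 2 (g.1 *ᵥ (Fin.snoc (α := fun _ => ℝ) u 0 : Fin (n + 1) → ℝ)))
      ((1 : ℝ) • WithLp.toLp 2 (g.1 *ᵥ (Fin.snoc (α := fun _ => ℝ) u 0 : Fin (n + 1) → ℝ))) 0 :=
    ((hasDerivAt_id (0 : ℝ)).smul_const _).const_add _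
  have h3 : (ray g ∘ fun t : ℝ => x + t • u) = fun t : ℝ => ray g x + t •
      WithLp.toLp 2 (g.1 *ᵥ (Fin.snoc (α := fun _ => ℝ) u 0 : Fin (n + 1) → ℝ)) := by
    funext t
    have : lift (x + t • u) = lift x + t • (Fin.snoc (α := fun _ => ℝ) u 0 : Fin (n + 1) → ℝ) := by
      funext i
      refine Fin.lastCases ?_ (fun i => ?_) i
      · simp [lift]
      · simp [lift]
    simp only [Function.comp, ray, this, Matrix.mulVec_add, Matrix.mulVec_smul]
    rfl
  rw [h3] at h1
  simpa using h1.unique h2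

/-- Affine charts are immersions. -/
theorem fderiv_param_injective {n : ℕ} (g : SL n) (x u : Fin n → ℝ)
    (hu : fderiv ℝ (param g) x u = 0) : u = 0 := by
  have hN : DifferentiableAt ℝ (fun y => ‖ray g y‖) x :=
    ((contDiff_ray g).norm ℝ (ray_ne_zero g)).differentiable (by simp) x
  have hp : DifferentiableAt ℝ (param g) x := (contDiff_param g).differentiable (by simp) x
  have hne : ‖ray g x‖ ≠ 0 := norm_ne_zero_iff.2 (ray_ne_zero g x)
  have e : ray g = fun y => ‖ray g y‖ • param g y := by
    funext y
    rw [param, smul_smul, mul_inv_cancel₀ (norm_ne_zero_iff.2 (ray_ne_zero g y)), one_smul]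
  have h1 := fderiv_ray g x u
  rw [e, fderiv_fun_smul hN hp] at h1
  simp only [add_apply, smul_apply, hu, smul_zero, zero_add,
    ContinuousLinearMap.smulRight_apply, param, smul_smul] at h1
  set c := (fderiv ℝ (fun y => ‖ray g y‖) x) u * ‖ray g x‖⁻¹
  have h2 : g.1 *ᵥ (c • lift x) = g.1 *ᵥ (Fin.snoc (α := fun _ => ℝ) u 0 : Fin (n + 1) → ℝ) := by
    have := congrArg WithLp.ofLp h1
    simpa [ray, Matrix.mulVec_smul] using this
  have h3 : c • lift x = (Fin.snoc (α := fun _ => ℝ) u 0 : Fin (n + 1) → ℝ) := by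
    rw [← inv_mulVec_mulVec g (c • lift x), h2, inv_mulVec_mulVec]
  have hc : c = 0 := by simpa [lift] using congrFun h3 (Fin.last n)
  funext i
  have := congrFun h3 i.castSucc
  simpa [hc] using this.symm

theorem fderiv_eq_sum {n : ℕ} {F : Type*} [NormedAddCommGroup F] [NormedSpace ℝ F]
    (f : (Fin n → ℝ) → F) (x u : Fin n → ℝ) : fderiv ℝ f x u = ∑ i, u i • pd i f x := by
  conv_lhs => rw [show u = ∑ i, u i • (Pi.single i 1 : Fin n → ℝ) from by
    funext j; simp [Finset.sum_apply, Pi.single_apply]]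
  simp [pd]

theorem metric_posDef {n : ℕ} (g : SL n) (x : Fin n → ℝ) : (metric g x).PosDef := by
  refine Matrix.PosDef.of_dotProduct_mulVec_pos ?_ fun u hu => ?_
  · ext i j
    simp [metric, real_inner_comm]
  · have h : star u ⬝ᵥ metric g x *ᵥ u
        = inner ℝ (fderiv ℝ (param g) x u) (fderiv ℝ (param g) x u) := by
      rw [fderiv_eq_sum]
      simp only [dotProduct, Matrix.mulVec, metric, Matrix.of_apply, sum_inner, inner_sum,
        real_inner_smul_left, real_inner_smul_right, Finset.mul_sum]
      refine Finset.sum_congr rfl fun i _ => Finset.sum_congr rfl fun j _ => ?_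
      rw [real_inner_comm (pd i (param g) x)]
      simp only [star_trivial]
      ring
    rw [h]
    exact real_inner_self_pos.2 fun h0 => hu (fderiv_param_injective g x u h0)

theorem contDiff_metric {n : ℕ} (g : SL n) (i j : Fin n) :
    ContDiff ℝ ∞ fun x => metric g x i j := by
  have h : ∀ i, ContDiff ℝ ∞ (pd i (param g)) := fun i =>
    ((contDiff_param g).fderiv_right (m := ∞) (by simp)).clm_apply contDiff_const
  exact (h i).inner ℝ (h j)

theorem contDiff_det {n : ℕ} {M : (Fin n → ℝ) → Matrix (Fin n) (Fin n) ℝ}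
    (h : ∀ i j, ContDiff ℝ ∞ fun x => M x i j) : ContDiff ℝ ∞ fun x => (M x).det := by
  simp only [Matrix.det_apply]
  exact ContDiff.sum fun s _ => (contDiff_prod fun i _ => h _ _).const_smul _

theorem contDiff_metric_inv {n : ℕ} (g : SL n) (i j : Fin n) :
    ContDiff ℝ ∞ fun x => (metric g x)⁻¹ i j := by
  simp only [Matrix.inv_def, Matrix.smul_apply, smul_eq_mul, Ring.inverse_eq_inv',
    Matrix.adjugate_apply]
  refine ((contDiff_det fun i j => contDiff_metric g i j).inv
    fun x => (metric_posDef g x).det_pos.ne').mul (contDiff_det fun k l => ?_)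
  by_cases h : k = j
  · subst h
    simpa using contDiff_const
  · simpa [Matrix.updateRow_ne h] using contDiff_metric g k l

theorem contDiff_volPow {n : ℕ} (s : ℂ) (g : SL n) : ContDiff ℝ ∞ (volPow s g) := by
  have h : volPow s g = fun x => Complex.exp ((Real.log (metric g x).det : ℂ) * (s / 2)) := by
    funext x
    have hp := (metric_posDef g x).det_pos
    rw [volPow, Complex.cpow_def_of_ne_zero (by exact_mod_cast hp.ne'), Complex.ofReal_log hp.le]
  rw [h]
  have h1 : ContDiff ℝ ∞ fun x => Real.log (metric g x).det :=
    (contDiff_det fun i j => contDiff_metric g i j).log fun x => (metric_posDef g x).det_pos.ne'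
  exact ((Complex.ofRealCLM.contDiff.comp h1).mul contDiff_const).cexp

/-- On the overlap of two charts, `transition` is the change of coordinates. -/
theorem param_eq_transition {n : ℕ} {g h : SL n} {x y : Fin n → ℝ} (e : param g x = param h y) :
    transition g h x = y ∧ ∀ᶠ z in nhds x, param g z = param h (transition g h z) := by
  have hx : 0 < ‖ray g x‖ := norm_pos_iff.2 (ray_ne_zero g x)
  have hy : 0 < ‖ray h y‖ := norm_pos_iff.2 (ray_ne_zero h y)
  set c := ‖ray g x‖ * ‖ray h y‖⁻¹ with hc
  have hc0 : 0 < c := by positivity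
  have e1 : ray g x = c • ray h y := by
    have := congrArg (fun v => ‖ray g x‖ • v) e
    simpa only [param, smul_smul, mul_inv_cancel₀ hx.ne', one_smul] using this
  have e2 : g.1 *ᵥ lift x = h.1 *ᵥ (c • lift y) := by
    have := congrArg WithLp.ofLp e1
    simpa [ray, Matrix.mulVec_smul] using this
  have e3 : (h⁻¹ * g).1 *ᵥ lift x = c • lift y := by
    rw [Matrix.SpecialLinearGroup.coe_mul, ← Matrix.mulVec_mulVec, e2, inv_mulVec_mulVec]
  refine ⟨?_, ?_⟩
  · funext i
    simp only [transition, e3, Pi.smul_apply, lift_castSucc, lift_last, smul_eq_mul]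
    field_simp
  · have hl : 0 < ((h⁻¹ * g).1 *ᵥ lift x) (Fin.last n) := by
      rw [e3]; simpa [lift_last] using hc0
    have hev : ∀ᶠ z in nhds x, 0 < ((h⁻¹ * g).1 *ᵥ lift z) (Fin.last n) :=
      (contDiff_mulVec_lift (h⁻¹ * g).1 (Fin.last n)).continuous.continuousAt.eventually
        (lt_mem_nhds hl)
    filter_upwards [hev] with z hz
    set d := ((h⁻¹ * g).1 *ᵥ lift z) (Fin.last n) with hd
    have h1 : (h⁻¹ * g).1 *ᵥ lift z = d • lift (transition g h z) := by
      funext i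
      refine Fin.lastCases ?_ (fun i => ?_) i
      · simp [lift_last, hd]
      · simp only [Pi.smul_apply, lift_castSucc, transition, smul_eq_mul, ← hd]
        field_simp
    have h2 : ray g z = d • ray h (transition g h z) := by
      have : g.1 = h.1 * (h⁻¹ * g).1 := by
        rw [← Matrix.SpecialLinearGroup.coe_mul, mul_inv_cancel_left]
      rw [ray, this, ← Matrix.mulVec_mulVec, h1, Matrix.mulVec_smul]
      rfl
    rw [param, param, h2, norm_smul, Real.norm_of_nonneg hz.le, smul_smul, mul_inv, mul_right_comm,
      inv_mul_cancel₀ hz.ne', one_mul]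

theorem differentiableAt_transition {n : ℕ} {g h : SL n} {x y : Fin n → ℝ}
    (e : param g x = param h y) : DifferentiableAt ℝ (transition g h) x := by
  have hl : ((h⁻¹ * g).1 *ᵥ lift x) (Fin.last n) ≠ 0 := by
    intro h0
    have hx : 0 < ‖ray g x‖ := norm_pos_iff.2 (ray_ne_zero g x)
    have hy : 0 < ‖ray h y‖ := norm_pos_iff.2 (ray_ne_zero h y)
    have e1 : ray g x = (‖ray g x‖ * ‖ray h y‖⁻¹) • ray h y := by
      have := congrArg (fun v => ‖ray g x‖ • v) e
      simpa only [param, smul_smul, mul_inv_cancel₀ hx.ne', one_smul] using this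
    have e2 : g.1 *ᵥ lift x = h.1 *ᵥ ((‖ray g x‖ * ‖ray h y‖⁻¹) • lift y) := by
      have := congrArg WithLp.ofLp e1
      simpa [ray, Matrix.mulVec_smul] using this
    rw [Matrix.SpecialLinearGroup.coe_mul, ← Matrix.mulVec_mulVec, e2, inv_mulVec_mulVec] at h0
    simp [lift_last, hx.ne', hy.ne'] at h0
  refine differentiableAt_pi.2 fun i => ?_
  have h1 : DifferentiableAt ℝ (fun z : Fin n → ℝ => ((h⁻¹ * g).1 *ᵥ lift z) i.castSucc) x :=
    (contDiff_mulVec_lift _ _).differentiable (by simp) x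
  have h2 : DifferentiableAt ℝ (fun z : Fin n → ℝ => ((h⁻¹ * g).1 *ᵥ lift z) (Fin.last n)) x :=
    (contDiff_mulVec_lift _ _).differentiable (by simp) x
  simp only [transition, div_eq_mul_inv]
  exact h1.mul (h2.inv hl)

/-- The transformation law of the metric under a change of affine coordinates. -/
theorem metric_transition {n : ℕ} {g h : SL n} {x y : Fin n → ℝ} (e : param g x = param h y) :
    metric g x = (jac g h x)ᵀ * metric h y * jac g h x := by
  obtain ⟨h1, h2⟩ := param_eq_transition e
  have hd : fderiv ℝ (param g) x = (fderiv ℝ (param h) y).comp (fderiv ℝ (transition g h) x) := by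
    rw [Filter.EventuallyEq.fderiv_eq (f := fun z => param h (transition g h z)) h2, ← h1]
    exact fderiv_comp x ((contDiff_param h).differentiable (by simp) _)
      (differentiableAt_transition e)
  have hp : ∀ i, pd i (param g) x = ∑ k, jac g h x k i • pd k (param h) y := by
    intro i
    have : pd i (param g) x = fderiv ℝ (param h) y (pd i (transition g h) x) := by
      simp only [pd, hd, ContinuousLinearMap.comp_apply]
    rw [this, fderiv_eq_sum]
    rfl
  ext i j
  simp only [metric, Matrix.mul_apply, Matrix.of_apply, Matrix.transpose_apply, hp, sum_inner,
    inner_sum, real_inner_smul_left, real_inner_smul_right, Finset.sum_mul]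
  refine Finset.sum_congr rfl fun k _ => Finset.sum_congr rfl fun l _ => ?_
  ring

theorem hamiltonianFun_mem (n : ℕ) (δ : ℂ) : hamiltonianFun n δ ∈ symbols n δ := by
  refine ⟨fun g => ?_, ⟨2, fun g x => ?_⟩, fun g h x y e η => ?_⟩
  · unfold hamiltonianFun
    have hq : ContDiff ℝ ∞ fun z : (Fin n → ℝ) × (Fin n → ℝ) =>
        ∑ i, ∑ j, (metric g z.1)⁻¹ i j * z.2 i * z.2 j := ?_
    · exact (Complex.ofRealCLM.contDiff.comp hq).mul ((contDiff_volPow δ g).comp contDiff_fst)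
    refine ContDiff.sum fun i _ => ContDiff.sum fun j _ => ?_
    refine (((contDiff_metric_inv g i j).comp contDiff_fst).mul ?_).mul ?_
    · exact (contDiff_apply ℝ ℝ i).comp contDiff_snd
    · exact (contDiff_apply ℝ ℝ j).comp contDiff_snd
  · refine ⟨∑ i, ∑ j, MvPolynomial.C ((((metric g x)⁻¹ i j : ℝ) : ℂ) * volPow δ g x) *
      MvPolynomial.X i * MvPolynomial.X j, ?_, fun ξ => ?_⟩
    · refine MvPolynomial.totalDegree_finsetSum_le fun i _ =>
        MvPolynomial.totalDegree_finsetSum_le fun j _ => ?_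
      refine (MvPolynomial.totalDegree_mul _ _).trans ?_
      refine (Nat.add_le_add_right (MvPolynomial.totalDegree_mul _ _) _).trans ?_
      rw [MvPolynomial.totalDegree_C, MvPolynomial.totalDegree_X, MvPolynomial.totalDegree_X]
    · simp only [hamiltonianFun, map_sum, map_mul, MvPolynomial.eval_C, MvPolynomial.eval_X]
      push_cast
      rw [Finset.sum_mul]
      refine Finset.sum_congr rfl fun i _ => ?_
      rw [Finset.sum_mul]
      exact Finset.sum_congr rfl fun j _ => by ring
  · have hm := metric_transition e
    have hdet : (metric g x).det = |(jac g h x).det| ^ 2 * (metric h y).det := by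
      rw [hm, Matrix.det_mul, Matrix.det_mul, Matrix.det_transpose, sq_abs]
      ring
    have hg := (metric_posDef g x).det_pos
    have hh := (metric_posDef h y).det_pos
    have hJ : (jac g h x).det ≠ 0 := by
      intro h0
      rw [hdet, h0] at hg
      simp at hg
    have hvol : volPow δ g x = jacPow δ g h x * volPow δ h y := by
      have ha : 0 < |(jac g h x).det| := abs_pos.2 hJ
      rw [volPow, volPow, jacPow, hdet, Complex.ofReal_mul,
        Complex.mul_cpow_ofReal_nonneg (by positivity) hh.le]
      congr 1
      rw [Complex.ofReal_pow, ← Complex.cpow_nat_mul' ]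
      · congr 1
        push_cast
        ring
      · rw [Complex.arg_ofReal_of_nonneg ha.le]
        simp [Real.pi_pos]
      · rw [Complex.arg_ofReal_of_nonneg ha.le]
        simp [Real.pi_pos.le]
    have hquad : ∀ (M : Matrix (Fin n) (Fin n) ℝ) (ξ : Fin n → ℝ),
        ∑ i, ∑ j, M i j * ξ i * ξ j = ξ ⬝ᵥ (M *ᵥ ξ) := by
      intro M ξ
      simp only [dotProduct, Matrix.mulVec, Finset.mul_sum]
      exact Finset.sum_congr rfl fun i _ => Finset.sum_congr rfl fun j _ => by ring
    have hinv : jac g h x * (metric g x)⁻¹ * (jac g h x)ᵀ = (metric h y)⁻¹ := by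
      have hu : IsUnit (jac g h x).det := isUnit_iff_ne_zero.2 hJ
      have hu' : IsUnit ((jac g h x)ᵀ).det := by rwa [Matrix.det_transpose]
      rw [hm, Matrix.mul_inv_rev, Matrix.mul_inv_rev, ← Matrix.mul_assoc,
        Matrix.mul_nonsing_inv _ hu, Matrix.one_mul, Matrix.mul_assoc, Matrix.nonsing_inv_mul _ hu',
        Matrix.mul_one]
    simp only [hamiltonianFun]
    rw [hvol, hquad, hquad, ← hinv, Matrix.mulVec_transpose, ← Matrix.mulVec_mulVec,
      ← Matrix.mulVec_mulVec, Matrix.dotProduct_mulVec η, Matrix.mulVec_transpose]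
    ring

/-- The Hamiltonian `H_δ = H √(g^δ)` of the geodesic flow of the round metric, as an element of
`S_δ(S^n)`. -/
def hamiltonian (n : ℕ) (δ : ℂ) : symbols n δ := ⟨hamiltonianFun n δ, hamiltonianFun_mem n δ⟩

/-- The constant `C_{lam,mu}`, with `δ = mu - lam`. -/
def curvCoeff (n : ℕ) (lam mu : ℂ) : ℂ :=
  ((n + 1) ^ 2 * lam * (mu - 1)) / ((n - 1) * ((1 - (mu - lam)) * (n + 1) + 1))

end ProjQuant
end

noncomputable section

namespace ProjQuant

/-! ### Calculus of partial derivatives -/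

section PartialDerivatives

variable {n : ℕ} {F : Type*} [NormedAddCommGroup F] [NormedSpace ℝ F]

/-! The proof compares Casimir operators. For the action of gl(n+1,ℝ) by Lie derivatives, the
element `∑ E_{ab} ⊗ E_{ba}` is invariant under conjugation, so the operator `∑ L_{E_{ab}}
L_{E_{ba}}` may be computed at any point in affine coordinates centred there (`casimir_conj`,
`casimir_centred`). In such coordinates the matrix units are translations, linear fields, minus the
Euler field and quadratic fields, and only finitely many algebraic terms survive at the centre.

On symbols of degree two this operator is the scalar `casimirEig n δ 2`. On the coefficients `(a, b,
c)` of a second-order operator it is triangular: the eigenvalues of degrees 2, 1, 0 stand on the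
diagonal, and the second derivatives of the quadratic fields send the divergence of `a` into `b` and
that of `b` into `c` (`commutator_opOfCoeffs`, `casimir_rhoOp_nuOp`). An equivariant `Q` intertwines
the two actions, so `Q P` is an eigenvector for the eigenvalue of degree two. The differences of
eigenvalues are `2((1-δ)(n+1)+2)` and `4((1-δ)(n+1)+1)`, nonzero by the assumption on `δ`. Hence `b`
and `c` are determined by `a`, and the resulting recursion is that of `C^2_m`
(`IsProjectiveQuantization.eq_affineQuantization`).

Iterating Lie derivatives requires them to be global densities and symbols again. This holds because
they are derivatives along `t ↦ exp(tZ) g`, and left translation by `exp(tZ)` leaves the changes of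
coordinates untouched.

It remains to evaluate the explicit formula on `H_δ`. Great circles are straight lines in affine
charts, so the Levi-Civita connection is given by a single one-form: `Γ^k_{ij} = δ^k_j ψ_i + δ^k_i
ψ_j` with `∂_k ψ_i = ψ_i ψ_k - g_{ik}`. Both the quantized Hamiltonian and the Laplacian become
expressions in the inverse metric, the dual vector of `ψ` and `|ψ|²`. All terms containing `ψ`
agree, and the constant left over is `C_{λ,μ} R` (`affineQuantization_hamiltonian`). -/

theorem contDiff_pd {f : (Fin n → ℝ) → F} (hf : ContDiff ℝ ∞ f) (i : Fin n) :
    ContDiff ℝ ∞ (pd i f) :=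
  (hf.fderiv_right (m := ∞) (by simp)).clm_apply contDiff_const

theorem _root_.ContDiff.differentiableAt_of_smooth {E : Type*} [NormedAddCommGroup E]
    [NormedSpace ℝ E] {f : E → F} (hf : ContDiff ℝ ∞ f) (x : E) : DifferentiableAt ℝ f x :=
  hf.differentiable (by simp) x

/-- Partial derivatives are derivatives along coordinate lines. -/
theorem hasDerivAt_pd {f : (Fin n → ℝ) → F} {x : Fin n → ℝ} (hf : DifferentiableAt ℝ f x)
    (i : Fin n) : HasDerivAt (fun t : ℝ => f (x + t • Pi.single i 1)) (pd i f x) 0 := by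
  have h := hf.hasFDerivAt.comp_hasDerivAt_of_eq (f := fun t : ℝ => x + t • Pi.single i 1) 0
    (((hasDerivAt_id (0 : ℝ)).smul_const (Pi.single i (1 : ℝ))).const_add x) (by simp)
  simpa [pd, Function.comp_def] using h

theorem pd_eq_of_hasFDerivAt {f : (Fin n → ℝ) → F} {x : Fin n → ℝ}
    {f' : (Fin n → ℝ) →L[ℝ] F} (h : HasFDerivAt f f' x) (i : Fin n) :
    pd i f x = f' (Pi.single i 1) := by
  rw [pd, h.fderiv]

@[simp] theorem pd_const (i : Fin n) (c : F) (x : Fin n → ℝ) : pd i (fun _ => c) x = 0 := by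
  simp [pd]

theorem pd_coord (i j : Fin n) (x : Fin n → ℝ) :
    pd i (fun y : Fin n → ℝ => y j) x = if j = i then 1 else 0 := by
  rw [pd_eq_of_hasFDerivAt (hasFDerivAt_apply j x)]
  simp [Pi.single_apply]

theorem pd_add {f g : (Fin n → ℝ) → F} {x : Fin n → ℝ} (hf : DifferentiableAt ℝ f x)
    (hg : DifferentiableAt ℝ g x) (i : Fin n) :
    pd i (fun y => f y + g y) x = pd i f x + pd i g x := by
  simp [pd, fderiv_fun_add hf hg]

theorem pd_sub {f g : (Fin n → ℝ) → F} {x : Fin n → ℝ} (hf : DifferentiableAt ℝ f x)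
    (hg : DifferentiableAt ℝ g x) (i : Fin n) :
    pd i (fun y => f y - g y) x = pd i f x - pd i g x := by
  simp [pd, fderiv_fun_sub hf hg]

theorem pd_neg {f : (Fin n → ℝ) → F} {x : Fin n → ℝ} (i : Fin n) :
    pd i (fun y => - f y) x = - pd i f x := by
  simp [pd, fderiv_fun_neg]

theorem pd_sum {ι : Type*} (s : Finset ι) {f : ι → (Fin n → ℝ) → F} {x : Fin n → ℝ}
    (hf : ∀ k, DifferentiableAt ℝ (f k) x) (i : Fin n) :
    pd i (fun y => ∑ k ∈ s, f k y) x = ∑ k ∈ s, pd i (f k) x := by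
  simp [pd, fderiv_fun_sum (fun k _ => hf k)]

theorem pd_smul {f : (Fin n → ℝ) → ℝ} {g : (Fin n → ℝ) → F} {x : Fin n → ℝ}
    (hf : DifferentiableAt ℝ f x) (hg : DifferentiableAt ℝ g x) (i : Fin n) :
    pd i (fun y => f y • g y) x = f x • pd i g x + pd i f x • g x := by
  simp [pd, fderiv_fun_smul hf hg]

theorem pd_mul {𝕜 : Type*} [NormedCommRing 𝕜] [NormedAlgebra ℝ 𝕜] {f g : (Fin n → ℝ) → 𝕜}
    {x : Fin n → ℝ}
    (hf : DifferentiableAt ℝ f x) (hg : DifferentiableAt ℝ g x) (i : Fin n) :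
    pd i (fun y => f y * g y) x = f x * pd i g x + pd i f x * g x := by
  simp [pd, fderiv_fun_mul hf hg, mul_comm]

theorem pd_const_mul {𝕜 : Type*} [NormedCommRing 𝕜] [NormedAlgebra ℝ 𝕜] {g : (Fin n → ℝ) → 𝕜}
    {x : Fin n → ℝ} (c : 𝕜) (hg : DifferentiableAt ℝ g x) (i : Fin n) :
    pd i (fun y => c * g y) x = c * pd i g x := by
  simp [pd_mul (differentiableAt_const c) hg]

theorem pd_clm {G : Type*} [NormedAddCommGroup G] [NormedSpace ℝ G] (L : F →L[ℝ] G)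
    {f : (Fin n → ℝ) → F} {x : Fin n → ℝ} (hf : DifferentiableAt ℝ f x) (i : Fin n) :
    pd i (fun y => L (f y)) x = L (pd i f x) :=
  pd_eq_of_hasFDerivAt (f := fun y => L (f y)) (L.hasFDerivAt.comp x hf.hasFDerivAt) i

theorem pd_ofReal {f : (Fin n → ℝ) → ℝ} {x : Fin n → ℝ} (hf : DifferentiableAt ℝ f x)
    (i : Fin n) : pd i (fun y => (f y : ℂ)) x = ((pd i f x : ℝ) : ℂ) :=
  pd_clm Complex.ofRealCLM hf i

theorem pd_pi {ι : Type*} [Fintype ι] {G : ι → Type*} [∀ k, NormedAddCommGroup (G k)]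
    [∀ k, NormedSpace ℝ (G k)] {f : (Fin n → ℝ) → ∀ k, G k} {x : Fin n → ℝ}
    (hf : DifferentiableAt ℝ f x) (i : Fin n) (k : ι) :
    pd i f x k = pd i (fun y => f y k) x :=
  (pd_clm (ContinuousLinearMap.proj (R := ℝ) (φ := G) k) hf i).symm

theorem pd_comm {f : (Fin n → ℝ) → F} (hf : ContDiff ℝ ∞ f) (i j : Fin n) (x : Fin n → ℝ) :
    pd i (pd j f) x = pd j (pd i f) x := by
  have h2 : ∀ i j : Fin n, pd i (pd j f) x
      = fderiv ℝ (fderiv ℝ f) x (Pi.single i 1) (Pi.single j 1) := by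
    intro i j
    have hd : DifferentiableAt ℝ (fderiv ℝ f) x :=
      (hf.fderiv_right (m := ∞) (by simp)).differentiableAt_of_smooth x
    rw [pd_eq_of_hasFDerivAt (f := pd j f)
      (hd.hasFDerivAt.clm_apply (hasFDerivAt_const (Pi.single j (1 : ℝ) : Fin n → ℝ) x))]
    simp
  rw [h2, h2]
  exact (hf.contDiffAt.isSymmSndFDerivAt
    (by simpa using WithTop.coe_le_coe.2 (le_top (a := (2 : ℕ∞))))).eq _ _

theorem pdIter_zero (i : Fin 0 → Fin n) (f : (Fin n → ℝ) → ℂ) (x : Fin n → ℝ) :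
    pdIter i f x = f x := by
  simp [pdIter]

theorem pdIter_one (i : Fin 1 → Fin n) (f : (Fin n → ℝ) → ℂ) (x : Fin n → ℝ) :
    pdIter i f x = pd (i 0) f x := by
  rw [pdIter, iteratedFDeriv_one_apply, pd]

theorem pdIter_two (i : Fin 2 → Fin n) {f : (Fin n → ℝ) → ℂ} (hf : ContDiff ℝ ∞ f)
    (x : Fin n → ℝ) : pdIter i f x = pd (i 0) (pd (i 1) f) x := by
  have hd : DifferentiableAt ℝ (fderiv ℝ f) x :=
    (hf.fderiv_right (m := ∞) (by simp)).differentiableAt_of_smooth x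
  rw [pdIter, iteratedFDeriv_two_apply, pd_eq_of_hasFDerivAt (f := pd (i 1) f)
      (hd.hasFDerivAt.clm_apply (hasFDerivAt_const (Pi.single (i 1) (1 : ℝ) : Fin n → ℝ) x))]
  simp

/-- Jacobi's formula. -/
theorem hasDerivAt_det {m : Type*} [Fintype m] [DecidableEq m] {M : ℝ → Matrix m m ℝ}
    {M' : Matrix m m ℝ} {t : ℝ} (h : ∀ i j, HasDerivAt (fun s => M s i j) (M' i j) t) :
    HasDerivAt (fun s => (M s).det) (∑ i, ((M t).updateRow i (M' i)).det) t := by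
  have h1 : HasDerivAt (fun s => (M s : m → m → ℝ)) (M' : m → m → ℝ) t :=
    hasDerivAt_pi.2 fun i => hasDerivAt_pi.2 fun j => h i j
  let D : ContinuousMultilinearMap ℝ (fun _ : m => m → ℝ) ℝ :=
    ⟨(Matrix.detRowAlternating (R := ℝ) (n := m)).toMultilinearMap, by
      change Continuous fun A : Matrix m m ℝ => A.det
      exact continuous_id.matrix_det⟩
  have h2 := (D.hasFDerivAt (M t : m → m → ℝ)).comp_hasDerivAt t h1
  have h3 : D.linearDeriv (M t) M' = ∑ i, ((M t).updateRow i (M' i)).det :=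
    ContinuousMultilinearMap.linearDeriv_apply ..
  rw [← h3]
  exact h2

/-- Jacobi's formula for partial derivatives. -/
theorem pd_det {M : (Fin n → ℝ) → Matrix (Fin n) (Fin n) ℝ}
    (h : ∀ i j, ContDiff ℝ ∞ fun x => M x i j) (k : Fin n) (x : Fin n → ℝ) :
    pd k (fun y => (M y).det) x
      = ∑ i, ((M x).updateRow i (fun j => pd k (fun y => M y i j) x)).det := by
  have h1 := hasDerivAt_pd ((contDiff_det h).differentiableAt_of_smooth x) k
  have h2 := hasDerivAt_det (M := fun t : ℝ => M (x + t • Pi.single k 1))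
    (M' := fun i j => pd k (fun y => M y i j) x) (t := 0)
    (fun i j => hasDerivAt_pd ((h i j).differentiableAt_of_smooth x) k)
  simpa using h1.unique h2

end PartialDerivatives

/-! ### Projective vector fields -/

section Fields

variable {n : ℕ}

/-- The Jacobian matrix `∂_q V^p` of `V = chartField Y`. -/
def fieldJac (Y : Matrix (Fin (n + 1)) (Fin (n + 1)) ℝ) (x : Fin n → ℝ) : Fin n → Fin n → ℝ :=
  fun p q => Y p.castSucc q.castSucc
    - (if p = q then (Y *ᵥ lift x) (Fin.last n) else 0) - x p * Y (Fin.last n) q.castSucc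

theorem mulVec_lift (Y : Matrix (Fin (n + 1)) (Fin (n + 1)) ℝ) (x : Fin n → ℝ) (i) :
    (Y *ᵥ lift x) i = ∑ q : Fin n, Y i q.castSucc * x q + Y i (Fin.last n) := by
  simp [Matrix.mulVec, dotProduct, Fin.sum_univ_castSucc, lift_castSucc, lift_last]

theorem pd_mulVec_lift (Y : Matrix (Fin (n + 1)) (Fin (n + 1)) ℝ) (i) (x : Fin n → ℝ)
    (q : Fin n) : pd q (fun y => (Y *ᵥ lift y) i) x = Y i q.castSucc := by
  simp only [mulVec_lift]
  rw [pd_add (by fun_prop) (by fun_prop), pd_sum _ (fun _ => by fun_prop)]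
  simp only [pd_const, add_zero]
  rw [Finset.sum_eq_single q]
  · rw [pd_const_mul _ (by fun_prop), pd_coord]; simp
  · intro b _ hb
    rw [pd_const_mul _ (by fun_prop), pd_coord]; simp [hb]
  · simp

theorem contDiff_chartField (Y : Matrix (Fin (n + 1)) (Fin (n + 1)) ℝ) (i : Fin n) :
    ContDiff ℝ ∞ fun y => chartField Y y i :=
  (contDiff_mulVec_lift Y _).sub ((contDiff_apply ℝ ℝ i).mul (contDiff_mulVec_lift Y _))

theorem contDiff_fieldJac (Y : Matrix (Fin (n + 1)) (Fin (n + 1)) ℝ) (i j : Fin n) :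
    ContDiff ℝ ∞ fun y => fieldJac Y y i j := by
  unfold fieldJac
  refine (contDiff_const.sub ?_).sub ((contDiff_apply ℝ ℝ i).mul contDiff_const)
  split_ifs
  · exact contDiff_mulVec_lift Y _
  · exact contDiff_const

theorem pd_chartField (Y : Matrix (Fin (n + 1)) (Fin (n + 1)) ℝ) (x : Fin n → ℝ)
    (p q : Fin n) : pd q (fun y => chartField Y y p) x = fieldJac Y x p q := by
  have h := fun i => (contDiff_mulVec_lift Y i).differentiableAt_of_smooth x
  unfold chartField fieldJac
  rw [pd_sub (h _) ((differentiableAt_apply p x).fun_mul (h _)),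
    pd_mul (differentiableAt_apply p x) (h _), pd_mulVec_lift, pd_mulVec_lift, pd_coord]
  split_ifs <;> ring

/-- The quadratic part of a projective field is radial, `-(w·x) x^p` with `w` read off the last row
of `Y`. Its second derivatives are therefore constant and depend on the covector `w` alone, which is
what lets one linear map `ν` describe the whole second-order action. -/
theorem pd_fieldJac (Y : Matrix (Fin (n + 1)) (Fin (n + 1)) ℝ) (x : Fin n → ℝ)
    (p q r : Fin n) : pd r (fun y => fieldJac Y y p q) x
      = -(if p = q then Y (Fin.last n) r.castSucc else 0)
        - (if p = r then Y (Fin.last n) q.castSucc else 0) := by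
  have h := fun i => (contDiff_mulVec_lift Y i).differentiableAt_of_smooth x
  unfold fieldJac
  have h1 : DifferentiableAt ℝ (fun y => if p = q then (Y *ᵥ lift y) (Fin.last n) else 0) x := by
    split_ifs
    · exact h _
    · fun_prop
  have h2 : pd r (fun y => if p = q then (Y *ᵥ lift y) (Fin.last n) else 0) x
      = if p = q then Y (Fin.last n) r.castSucc else 0 := by
    split_ifs
    · exact pd_mulVec_lift _ _ _ _
    · simp
  rw [pd_sub ((differentiableAt_const _).fun_sub h1) (by fun_prop),
    pd_sub (differentiableAt_const _) h1, h2,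
    pd_mul (by fun_prop) (by fun_prop), pd_coord]
  simp

theorem divField_chartField (Y : Matrix (Fin (n + 1)) (Fin (n + 1)) ℝ) (x : Fin n → ℝ) :
    divField (chartField Y) x = ∑ p, fieldJac Y x p p := by
  simp only [divField, pd_chartField]

theorem contDiff_divField (Y : Matrix (Fin (n + 1)) (Fin (n + 1)) ℝ) :
    ContDiff ℝ ∞ (divField (chartField Y)) := by
  rw [funext (divField_chartField Y)]
  exact ContDiff.sum fun p _ => contDiff_fieldJac Y p p

/-- Trace of `pd_fieldJac`: one Kronecker delta contributes `n` and the other contributes 1. -/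
theorem pd_divField (Y : Matrix (Fin (n + 1)) (Fin (n + 1)) ℝ) (x : Fin n → ℝ) (r : Fin n) :
    pd r (divField (chartField Y)) x = -((n + 1) * Y (Fin.last n) r.castSucc) := by
  rw [funext (divField_chartField Y),
    pd_sum _ (fun p => (contDiff_fieldJac Y p p).differentiableAt_of_smooth x)]
  simp only [pd_fieldJac, if_true]
  rw [Finset.sum_sub_distrib]
  simp
  ring

theorem chartField_add (Y Y' : Matrix (Fin (n + 1)) (Fin (n + 1)) ℝ) (x : Fin n → ℝ) :
    chartField (Y + Y') x = chartField Y x + chartField Y' x := by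
  funext i; simp [chartField, Matrix.add_mulVec]; ring

theorem chartField_smul (c : ℝ) (Y : Matrix (Fin (n + 1)) (Fin (n + 1)) ℝ) (x : Fin n → ℝ) :
    chartField (c • Y) x = c • chartField Y x := by
  funext i; simp [chartField, Matrix.smul_mulVec]; ring

theorem fieldJac_add (Y Y' : Matrix (Fin (n + 1)) (Fin (n + 1)) ℝ) (x : Fin n → ℝ) :
    fieldJac (Y + Y') x = fieldJac Y x + fieldJac Y' x := by
  funext i j; simp only [fieldJac, Matrix.add_mulVec, Pi.add_apply, Matrix.add_apply]
  split_ifs <;> ring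

theorem fieldJac_smul (c : ℝ) (Y : Matrix (Fin (n + 1)) (Fin (n + 1)) ℝ) (x : Fin n → ℝ) :
    fieldJac (c • Y) x = c • fieldJac Y x := by
  funext i j
  simp only [fieldJac, Matrix.smul_mulVec, Pi.smul_apply, Matrix.smul_apply, smul_eq_mul]
  split_ifs <;> ring

/-- The identity matrix acts trivially on rays. -/
theorem chartField_one (x : Fin n → ℝ) : chartField (1 : Matrix (Fin (n + 1)) (Fin (n + 1)) ℝ) x
    = 0 := by
  funext i; simp [chartField, lift_castSucc, lift_last]

end Fields

/-! ### Lie derivatives of sections and the Casimir operator of `gl(n+1,ℝ)` -/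

section Casimir

variable {n : ℕ} {W : Type*} [NormedAddCommGroup W] [NormedSpace ℝ W]
  (ρ : (Fin n → Fin n → ℝ) →ₗ[ℝ] W →ₗ[ℝ] W) (ν : (Fin n → ℝ) →ₗ[ℝ] W →ₗ[ℝ] W)

/-- The covector `w` such that `∂_i ∂_j V^k = -(δ^k_i w_j + δ^k_j w_i)` for `V = chartField Y`. -/
def fieldHess (Y : Matrix (Fin (n + 1)) (Fin (n + 1)) ℝ) : Fin n → ℝ :=
  fun q => Y (Fin.last n) q.castSucc

/-- The Lie derivative along `V = chartField Y` of a section `T` of a natural bundle of order two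
with fibre `W`: the Jacobian matrix of `V` acts through `ρ`, its second derivatives through `ν`. -/
def lieSection (Y : Matrix (Fin (n + 1)) (Fin (n + 1)) ℝ) (T : (Fin n → ℝ) → W)
    (x : Fin n → ℝ) : W :=
  ∑ k, chartField Y x k • pd k T x - ρ (fieldJac Y x) (T x) + ν (fieldHess Y) (T x)

/-- This and the next three lemmas make the iterated Lie derivative at a point bilinear in the pair
of matrices, as needed to apply `sum_conj_single`. -/
theorem lieSection_add_left (Y Y' : Matrix (Fin (n + 1)) (Fin (n + 1)) ℝ) (T : (Fin n → ℝ) → W)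
    (x : Fin n → ℝ) :
    lieSection ρ ν (Y + Y') T x = lieSection ρ ν Y T x + lieSection ρ ν Y' T x := by
  have h : fieldHess (Y + Y') = fieldHess Y + fieldHess Y' := rfl
  simp only [lieSection, chartField_add, fieldJac_add, h, map_add, Pi.add_apply, add_smul,
    Finset.sum_add_distrib, LinearMap.add_apply]
  abel

theorem lieSection_smul_left (c : ℝ) (Y : Matrix (Fin (n + 1)) (Fin (n + 1)) ℝ)
    (T : (Fin n → ℝ) → W) (x : Fin n → ℝ) :
    lieSection ρ ν (c • Y) T x = c • lieSection ρ ν Y T x := by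
  have h : fieldHess (c • Y) = c • fieldHess Y := rfl
  simp only [lieSection, chartField_smul, fieldJac_smul, h, map_smul, Pi.smul_apply, smul_eq_mul,
    mul_smul, LinearMap.smul_apply, smul_sub, smul_add, Finset.smul_sum]

theorem lieSection_add_right (Y : Matrix (Fin (n + 1)) (Fin (n + 1)) ℝ) {T T' : (Fin n → ℝ) → W}
    {x : Fin n → ℝ} (hT : DifferentiableAt ℝ T x) (hT' : DifferentiableAt ℝ T' x) :
    lieSection ρ ν Y (fun y => T y + T' y) x
      = lieSection ρ ν Y T x + lieSection ρ ν Y T' x := by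
  simp only [lieSection, pd_add hT hT', map_add, smul_add, Finset.sum_add_distrib]
  abel

theorem lieSection_smul_right (c : ℝ) (Y : Matrix (Fin (n + 1)) (Fin (n + 1)) ℝ)
    {T : (Fin n → ℝ) → W} {x : Fin n → ℝ} (hT : DifferentiableAt ℝ T x) :
    lieSection ρ ν Y (fun y => c • T y) x = c • lieSection ρ ν Y T x := by
  have h : ∀ k, pd k (fun y => c • T y) x = c • pd k T x := fun k =>
    pd_clm (c • ContinuousLinearMap.id ℝ W) hT k
  simp only [lieSection, h, map_smul, smul_sub, smul_add, Finset.smul_sum]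
  simp only [smul_comm c]

theorem mul_single_mul_apply (S S' : Matrix (Fin (n + 1)) (Fin (n + 1)) ℝ)
    (a b p q : Fin (n + 1)) :
    (S * Matrix.single a b (1 : ℝ) * S') p q = S p a * S' b q := by
  rw [Matrix.mul_apply, Finset.sum_eq_single b]
  · simp
  · intro c _ hc
    simp [hc]
  · simp

theorem mul_single_mul_mulVec (S S' : Matrix (Fin (n + 1)) (Fin (n + 1)) ℝ)
    (a b p : Fin (n + 1)) (v : Fin (n + 1) → ℝ) :
    ((S * Matrix.single a b (1 : ℝ) * S') *ᵥ v) p = S p a * (S' *ᵥ v) b := by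
  simp only [Matrix.mulVec, dotProduct, mul_single_mul_apply, Finset.mul_sum]
  exact Finset.sum_congr rfl fun i _ => mul_assoc _ _ _

/-- The tensor `∑ E_{ab} ⊗ E_{ba}` is invariant under conjugation. -/
theorem sum_conj_single {W : Type*} [AddCommGroup W] [Module ℝ W]
    (B : Matrix (Fin (n + 1)) (Fin (n + 1)) ℝ →ₗ[ℝ]
      Matrix (Fin (n + 1)) (Fin (n + 1)) ℝ →ₗ[ℝ] W)
    {S S' : Matrix (Fin (n + 1)) (Fin (n + 1)) ℝ} (h : S * S' = 1) :
    ∑ a, ∑ b, B (S * Matrix.single a b 1 * S') (S * Matrix.single b a 1 * S')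
      = ∑ a, ∑ b, B (Matrix.single a b 1) (Matrix.single b a 1) := by
  have hexp : ∀ a b, S * Matrix.single a b 1 * S'
      = ∑ c, ∑ d, (S c a * S' b d) • Matrix.single c d (1 : ℝ) := by
    intro a b
    rw [Matrix.matrix_eq_sum_single (S * Matrix.single a b 1 * S')]
    simp [mul_single_mul_apply, Matrix.smul_single]
  have hS : ∀ c f, ∑ a, S c a * S' a f = if c = f then 1 else 0 := by
    intro c f
    rw [← Matrix.mul_apply, h, Matrix.one_apply]
  simp only [hexp, map_sum, map_smul, LinearMap.sum_apply, LinearMap.smul_apply, Finset.smul_sum,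
    smul_smul]
  have h1 : ∀ a b, (∑ e, ∑ f, ∑ c, ∑ d, (S e b * S' a f * (S c a * S' b d)) •
        B (Matrix.single c d 1) (Matrix.single e f 1))
      = ∑ e, ∑ f, ∑ c, ∑ d, ((S c a * S' a f) * (S e b * S' b d)) •
        B (Matrix.single c d 1) (Matrix.single e f 1) := by
    intro a b
    refine Finset.sum_congr rfl fun e _ => Finset.sum_congr rfl fun f _ =>
      Finset.sum_congr rfl fun c _ => Finset.sum_congr rfl fun d _ => ?_
    congr 1; ring
  simp only [h1]
  -- After the summations over `a` and `b` are moved inside, `S * S' = 1` turns them into Kronecker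
  -- deltas for `c = f` and `e = d`, leaving `B (E_{fe}) (E_{ef})`.
  calc _ = ∑ e, ∑ f, ∑ c, ∑ d, ((∑ a, S c a * S' a f) * (∑ b, S e b * S' b d)) •
        B (Matrix.single c d 1) (Matrix.single e f 1) := by
        simp only [Finset.sum_mul_sum, Finset.sum_smul]
        rw [Finset.sum_congr rfl fun a _ => Finset.sum_comm]
        rw [Finset.sum_comm]
        refine Finset.sum_congr rfl fun e _ => ?_
        rw [Finset.sum_congr rfl fun a _ => Finset.sum_comm]
        rw [Finset.sum_comm]
        refine Finset.sum_congr rfl fun f _ => ?_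
        rw [Finset.sum_congr rfl fun a _ => Finset.sum_comm]
        rw [Finset.sum_comm]
        refine Finset.sum_congr rfl fun c _ => ?_
        rw [Finset.sum_congr rfl fun a _ => Finset.sum_comm]
        rw [Finset.sum_comm]
    _ = _ := by
        simp only [hS, ite_mul, one_mul, zero_mul, ite_smul, zero_smul, one_smul,
          Finset.sum_ite_eq, Finset.mem_univ, if_true, Finset.sum_ite_irrel,
          Finset.sum_const_zero]
        rw [Finset.sum_comm]
        refine Finset.sum_congr rfl fun f _ => Finset.sum_congr rfl fun e _ => ?_
        rw [Finset.sum_eq_single f] <;> simp +contextual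

/-- The matrix of the translation `y ↦ y + x` in affine coordinates. -/
def shift (x : Fin n → ℝ) : Matrix (Fin (n + 1)) (Fin (n + 1)) ℝ :=
  1 + Matrix.vecMulVec (Fin.snoc (α := fun _ => ℝ) x 0) (Pi.single (Fin.last n) 1)

theorem shift_mulVec_lift (x y : Fin n → ℝ) : shift x *ᵥ lift y = lift (y + x) := by
  funext i
  rw [shift, Matrix.add_mulVec, Matrix.one_mulVec, Matrix.vecMulVec_mulVec]
  refine Fin.lastCases ?_ (fun i => ?_) i <;> simp [lift]

theorem shift_mul_shift_neg (x : Fin n → ℝ) : shift x * shift (-x) = 1 := by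
  have h : Matrix.vecMulVec (Fin.snoc (α := fun _ => ℝ) (-x) 0) (Pi.single (Fin.last n) 1)
      = - Matrix.vecMulVec (Fin.snoc (α := fun _ => ℝ) x 0) (Pi.single (Fin.last n) (1 : ℝ)) := by
    ext i j
    refine Fin.lastCases ?_ (fun i => ?_) i <;> simp [Matrix.vecMulVec_apply]
  have h2 : Matrix.vecMulVec (Fin.snoc (α := fun _ => ℝ) x 0) (Pi.single (Fin.last n) 1) *
      Matrix.vecMulVec (Fin.snoc (α := fun _ => ℝ) x 0) (Pi.single (Fin.last n) (1 : ℝ)) = 0 := by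
    rw [Matrix.vecMulVec_mul_vecMulVec]
    simp
  rw [shift, shift, h]
  simp only [mul_add, add_mul, mul_one, one_mul, mul_neg, h2]
  abel

/-- The matrix unit `E_{ab}`, for affine coordinates centred at `x`. -/
def centredUnit (x : Fin n → ℝ) (a b : Fin (n + 1)) : Matrix (Fin (n + 1)) (Fin (n + 1)) ℝ :=
  shift x * Matrix.single a b 1 * shift (-x)

theorem shift_apply_castSucc (x : Fin n → ℝ) (a : Fin (n + 1)) (j : Fin n) :
    shift x a j.castSucc = if a = j.castSucc then 1 else 0 := by
  simp [shift, Matrix.vecMulVec_apply, Matrix.one_apply]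

theorem shift_last (x : Fin n → ℝ) (a : Fin (n + 1)) :
    shift x a (Fin.last n) = lift x a := by
  refine Fin.lastCases ?_ (fun i => ?_) a <;>
    simp [shift, Matrix.vecMulVec_apply, lift]

/-- Since `lift (y - x)` has last entry 1, the case `b = Fin.last n` is the translation `∂_j`; the
other values of `b` give linear fields vanishing at `x`. -/
theorem chartField_centredUnit_castSucc (x y : Fin n → ℝ) (j : Fin n) (b : Fin (n + 1)) :
    chartField (centredUnit x j.castSucc b) y = lift (y - x) b • Pi.single j 1 := by
  funext i
  simp only [chartField, centredUnit, mul_single_mul_mulVec, shift_mulVec_lift, ← sub_eq_add_neg,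
    shift_apply_castSucc, Pi.smul_apply, Pi.single_apply, smul_eq_mul, Fin.castSucc_inj]
  simp [(Fin.castSucc_lt_last j).ne']

/-- For `b = Fin.last n` this is minus the Euler field centred at `x`; otherwise it is quadratic and
vanishes to second order at `x`. -/
theorem chartField_centredUnit_last (x y : Fin n → ℝ) (b : Fin (n + 1)) :
    chartField (centredUnit x (Fin.last n) b) y = -lift (y - x) b • (y - x) := by
  funext i
  simp only [chartField, centredUnit, mul_single_mul_mulVec, shift_mulVec_lift, ← sub_eq_add_neg,
    shift_last, Pi.smul_apply, smul_eq_mul, lift_castSucc, lift_last, Pi.sub_apply]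
  ring

theorem fieldJac_centredUnit_castSucc (x y : Fin n → ℝ) (j : Fin n) (b : Fin (n + 1)) :
    fieldJac (centredUnit x j.castSucc b) y
      = fun p q => if p = j ∧ q.castSucc = b then 1 else 0 := by
  funext p q
  simp only [fieldJac, centredUnit, mul_single_mul_mulVec, mul_single_mul_apply,
    shift_apply_castSucc, Fin.castSucc_inj]
  simp only [(Fin.castSucc_lt_last j).ne', if_false, zero_mul, mul_zero, sub_zero, ite_self]
  by_cases h1 : p = j <;> by_cases h2 : q.castSucc = b <;> simp [h1, h2, Ne.symm]

theorem fieldJac_centredUnit_last (x y : Fin n → ℝ) (b : Fin (n + 1)) :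
    fieldJac (centredUnit x (Fin.last n) b) y
      = fun p q => -(if p = q then lift (y - x) b else 0)
        - (y p - x p) * if q.castSucc = b then 1 else 0 := by
  funext p q
  simp only [fieldJac, centredUnit, mul_single_mul_mulVec, mul_single_mul_apply,
    shift_apply_castSucc, shift_last, shift_mulVec_lift, ← sub_eq_add_neg, lift_castSucc,
    lift_last, one_mul, eq_comm (a := b)]
  ring

theorem fieldHess_centredUnit_castSucc (x : Fin n → ℝ) (j : Fin n) (b : Fin (n + 1)) :
    fieldHess (centredUnit x j.castSucc b) = 0 := by
  funext q
  simp only [fieldHess, centredUnit, mul_single_mul_apply, shift_apply_castSucc]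
  simp [(Fin.castSucc_lt_last j).ne']

theorem fieldHess_centredUnit_last (x : Fin n → ℝ) (b : Fin (n + 1)) :
    fieldHess (centredUnit x (Fin.last n) b)
      = fun q => if q.castSucc = b then 1 else 0 := by
  funext q
  simp only [fieldHess, centredUnit, mul_single_mul_apply, shift_apply_castSucc, shift_last,
    lift_last, one_mul, eq_comm (a := b)]

/-! ### The Casimir operator on smooth sections. -/

section Smooth

variable [FiniteDimensional ℝ W]

theorem contDiff_bilin {E : Type*} [NormedAddCommGroup E] [NormedSpace ℝ E]
    [FiniteDimensional ℝ E] (β : E →ₗ[ℝ] W →ₗ[ℝ] W) {M : (Fin n → ℝ) → E} {T : (Fin n → ℝ) → W}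
    (hM : ContDiff ℝ ∞ M) (hT : ContDiff ℝ ∞ T) : ContDiff ℝ ∞ fun y => β (M y) (T y) :=
  (β.toContinuousBilinearMap.contDiff.comp hM).clm_apply hT

theorem contDiff_lieSection (Y : Matrix (Fin (n + 1)) (Fin (n + 1)) ℝ) {T : (Fin n → ℝ) → W}
    (hT : ContDiff ℝ ∞ T) : ContDiff ℝ ∞ (lieSection ρ ν Y T) := by
  refine ((ContDiff.sum fun k _ => (contDiff_chartField Y k).smul (contDiff_pd hT k)).sub
    (contDiff_bilin ρ ?_ hT)).add (contDiff_bilin ν contDiff_const hT)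
  exact contDiff_pi.2 fun i => contDiff_pi.2 fun j => contDiff_fieldJac Y i j

/-- The Casimir operator does not depend on the basis of `ℝ^{n+1}` used to define it. -/
theorem casimir_conj {S S' R R' : Matrix (Fin (n + 1)) (Fin (n + 1)) ℝ} (hS : S * S' = 1)
    (hR : R * R' = 1) {T : (Fin n → ℝ) → W} (hT : ContDiff ℝ ∞ T) (x : Fin n → ℝ) :
    ∑ a, ∑ b, lieSection ρ ν (S * Matrix.single a b 1 * S')
        (lieSection ρ ν (S * Matrix.single b a 1 * S') T) x
      = ∑ a, ∑ b, lieSection ρ ν (R * Matrix.single a b 1 * R')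
        (lieSection ρ ν (R * Matrix.single b a 1 * R') T) x := by
  have hd : ∀ Y, DifferentiableAt ℝ (lieSection ρ ν Y T) x := fun Y =>
    (contDiff_lieSection ρ ν Y hT).differentiableAt_of_smooth x
  let B : Matrix (Fin (n + 1)) (Fin (n + 1)) ℝ →ₗ[ℝ]
      Matrix (Fin (n + 1)) (Fin (n + 1)) ℝ →ₗ[ℝ] W :=
    LinearMap.mk₂ ℝ (fun Y Y' => lieSection ρ ν Y (lieSection ρ ν Y' T) x)
      (fun _ _ _ => lieSection_add_left ..) (fun _ _ _ => lieSection_smul_left ..)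
      (fun Y Y' Y'' => by
        rw [funext (lieSection_add_left ρ ν Y' Y'' T), lieSection_add_right ρ ν Y (hd _) (hd _)])
      (fun c Y Y' => by
        rw [funext (lieSection_smul_left ρ ν c Y' T), lieSection_smul_right ρ ν c Y (hd _)])
  exact (sum_conj_single B hS).trans (sum_conj_single B hR).symm

/-- The value at the centre of the Casimir operator in centred affine coordinates. -/
theorem casimir_centred {T : (Fin n → ℝ) → W} (hT : ContDiff ℝ ∞ T) (x : Fin n → ℝ) :
    ∑ a, ∑ b, lieSection ρ ν (centredUnit x a b) (lieSection ρ ν (centredUnit x b a) T) x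
      = (n + 1 : ℝ) • ρ (fun p q => if p = q then 1 else 0) (T x)
        + ρ (fun p q => if p = q then 1 else 0) (ρ (fun p q => if p = q then 1 else 0) (T x))
        + ∑ i, ∑ j, ρ (fun p q => if p = i ∧ q = j then 1 else 0)
            (ρ (fun p q => if p = j ∧ q = i then 1 else 0) (T x))
        + (2 : ℝ) • ∑ k, ν (Pi.single k 1) (pd k T x) := by
  set e : Fin n → Fin n → ℝ := fun p q => if p = q then 1 else 0 with he
  have hlast : fieldJac (centredUnit x (Fin.last n) (Fin.last n)) x = -e := by
    rw [fieldJac_centredUnit_last]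
    funext p q
    simp [lift_last, he]
  have hn0 : ∀ b, chartField (centredUnit x (Fin.last n) b) x = 0 := fun b => by
    rw [chartField_centredUnit_last]; simp
  have hlin0 : ∀ i j : Fin n, chartField (centredUnit x i.castSucc j.castSucc) x = 0 :=
    fun i j => by rw [chartField_centredUnit_castSucc]; simp [lift_castSucc]
  have htrans0 : ∀ (k : Fin n) y, chartField (centredUnit x k.castSucc (Fin.last n)) y
      = Pi.single k 1 :=
    fun i y => by rw [chartField_centredUnit_castSucc]; simp [lift_last]
  have htransJ : ∀ (k : Fin n) y, fieldJac (centredUnit x k.castSucc (Fin.last n)) y = 0 := by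
    intro k y
    rw [fieldJac_centredUnit_castSucc]
    funext p q
    simp [(Fin.castSucc_lt_last q).ne]
  have hinvJ : ∀ k : Fin n, fieldJac (centredUnit x (Fin.last n) k.castSucc) x = 0 := by
    intro k
    rw [fieldJac_centredUnit_last]
    funext p q
    simp [lift_castSucc]
  have hlinJ : ∀ i j : Fin n, fieldJac (centredUnit x i.castSucc j.castSucc) x
      = fun p q => if p = i ∧ q = j then 1 else 0 := by
    intro i j
    rw [fieldJac_centredUnit_castSucc]
    simp
  have hHlast : fieldHess (centredUnit x (Fin.last n) (Fin.last n)) = 0 := by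
    rw [fieldHess_centredUnit_last]
    funext q
    simp [(Fin.castSucc_lt_last q).ne]
  have hHinv : ∀ k : Fin n, fieldHess (centredUnit x (Fin.last n) k.castSucc)
      = Pi.single k 1 := by
    intro k
    rw [fieldHess_centredUnit_last]
    funext q
    simp [Pi.single_apply]
  have htrans : ∀ (k : Fin n) (T : (Fin n → ℝ) → W) y,
      lieSection ρ ν (centredUnit x k.castSucc (Fin.last n)) T y = pd k T y := by
    intro k T y
    rw [lieSection, htransJ, htrans0, fieldHess_centredUnit_castSucc]
    simp [Pi.single_apply]
  have hinv : ∀ (k : Fin n) (T : (Fin n → ℝ) → W),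
      lieSection ρ ν (centredUnit x (Fin.last n) k.castSucc) T x = ν (Pi.single k 1) (T x) := by
    intro k T
    rw [lieSection, hinvJ, hn0, hHinv]
    simp
  have hlin : ∀ (i j : Fin n) (T : (Fin n → ℝ) → W),
      lieSection ρ ν (centredUnit x i.castSucc j.castSucc) T x
        = -ρ (fun p q => if p = i ∧ q = j then 1 else 0) (T x) := by
    intro i j T
    rw [lieSection, hlinJ, hlin0, fieldHess_centredUnit_castSucc]
    simp
  have heuler : ∀ T : (Fin n → ℝ) → W,
      lieSection ρ ν (centredUnit x (Fin.last n) (Fin.last n)) T x = ρ e (T x) := by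
    intro T
    rw [lieSection, hlast, hn0, hHlast]
    simp
  -- This is the only product whose left factor differentiates: a translation applied to the Lie
  -- derivative along a quadratic field. The opposite order is covered by `hinv` and `htrans`.
  have hmixed : ∀ k : Fin n, pd k (lieSection ρ ν (centredUnit x (Fin.last n) k.castSucc) T) x
      = ρ (e + fun p q => if p = k ∧ q = k then 1 else 0) (T x)
        + ν (Pi.single k 1) (pd k T x) := by
    intro k
    have h1 := hasDerivAt_pd ((contDiff_lieSection ρ ν (centredUnit x (Fin.last n) k.castSucc)
      hT).differentiableAt_of_smooth x) k
    have hT1 := hasDerivAt_pd (hT.differentiableAt_of_smooth x) k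
    have hT2 := hasDerivAt_pd ((contDiff_pd hT k).differentiableAt_of_smooth x) k
    -- On the line `x + t e_k` the quadratic field is `-t² ∂_k` and its Jacobian matrix is `-t (1 +
    -- E_{kk})`. At `t = 0` the transport term therefore has zero derivative, the `ρ` term keeps
    -- only the derivative of the factor `t`, and the constant `ν` term differentiates `T`.
    have e1 : (fun t : ℝ => lieSection ρ ν (centredUnit x (Fin.last n) k.castSucc) T
          (x + t • Pi.single k 1))
        = fun t : ℝ => (-(t * t)) • pd k T (x + t • Pi.single k 1)
          + t • ρ (e + fun p q => if p = k ∧ q = k then 1 else 0) (T (x + t • Pi.single k 1))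
          + ν (Pi.single k 1) (T (x + t • Pi.single k 1)) := by
      funext t
      have hJ : fieldJac (centredUnit x (Fin.last n) k.castSucc) (x + t • Pi.single k 1)
          = -(t • (e + fun p q => if p = k ∧ q = k then 1 else 0)) := by
        rw [fieldJac_centredUnit_last]
        funext p q
        by_cases h1 : p = q <;> by_cases h2 : p = k <;> by_cases h3 : q = k <;>
          simp [lift_castSucc, he, h1, h2, h3] <;> grind
      rw [lieSection, hJ, hHinv, chartField_centredUnit_last]
      simp [lift_castSucc, Pi.single_apply]
      abel
    rw [e1] at h1
    have h2 := ((((hasDerivAt_id (0 : ℝ)).mul (hasDerivAt_id (0 : ℝ))).neg.smul hT2).add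
      ((hasDerivAt_id (0 : ℝ)).smul
        (((ρ (e + fun p q => if p = k ∧ q = k then 1 else 0)).toContinuousLinearMap.hasFDerivAt
          ).comp_hasDerivAt (0 : ℝ) hT1))).add
      ((ν (Pi.single k 1)).toContinuousLinearMap.hasFDerivAt.comp_hasDerivAt (0 : ℝ) hT1)
    have h3 := h1.unique h2
    simpa using h3
  -- Summing `1 + E_{kk}` over `k` gives `n + 1` times the identity.
  have hsum : ∑ k : Fin n, ρ (e + fun p q => if p = k ∧ q = k then 1 else 0) (T x)
      = (n + 1 : ℝ) • ρ e (T x) := by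
    rw [← LinearMap.sum_apply, ← map_sum, ← LinearMap.smul_apply, ← map_smul]
    congr 2
    funext p q
    simp only [Finset.sum_apply, Pi.add_apply, Finset.sum_add_distrib, Pi.smul_apply, he,
      Finset.sum_const, Finset.card_univ, Fintype.card_fin, nsmul_eq_mul, smul_eq_mul]
    by_cases h : p = q
    · subst h; simp
    · have : ∀ k, ¬ (p = k ∧ q = k) := fun k hk => h (hk.1.trans hk.2.symm)
      simp [h, this]
  -- The four blocks of index pairs are assembled. The term `ν(e_k) ∂_k T` occurs in both mixed
  -- blocks, once for each order of the factors, which gives the factor 2.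
  rw [Fin.sum_univ_castSucc]
  simp only [Fin.sum_univ_castSucc, htrans, hinv, hlin, heuler, hmixed, Finset.sum_add_distrib,
    hsum, map_neg, neg_neg, two_smul]
  abel

end Smooth

end Casimir

/-! ### Differential operators of order two and their coefficients -/

section Operators

variable {n : ℕ}

theorem ofReal_ite_one_zero (p : Prop) [Decidable p] :
    (((if p then 1 else 0 : ℝ)) : ℂ) = if p then 1 else 0 := by
  split_ifs <;> simp

/-- The coefficients `(a^{ij}, b^j, c)` of a differential operator of order two. -/
abbrev Coeffs (n : ℕ) := (Fin n → Fin n → ℂ) × (Fin n → ℂ) × ℂ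

/-- The action of a matrix on contravariant tensors of degree two and weight `δ`. -/
def rhoTwo (δ : ℂ) : (Fin n → Fin n → ℝ) →ₗ[ℝ] (Fin n → Fin n → ℂ) →ₗ[ℝ] Fin n → Fin n → ℂ :=
  LinearMap.mk₂ ℝ
    (fun M a i j => ∑ k, (M i k : ℂ) * a k j + ∑ k, (M j k : ℂ) * a i k
      - δ * (∑ k, (M k k : ℂ)) * a i j)
    (fun M M' a => by
      funext i j
      simp only [Pi.add_apply, Complex.ofReal_add, add_mul, Finset.sum_add_distrib]; ring)
    (fun c M a => by
      funext i j
      simp only [Pi.smul_apply, smul_eq_mul, Complex.ofReal_mul, mul_assoc, ← Finset.mul_sum,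
        Complex.real_smul]; ring)
    (fun M a a' => by
      funext i j
      simp only [Pi.add_apply, mul_add, Finset.sum_add_distrib]; ring)
    (fun c M a => by
      funext i j
      simp only [Pi.smul_apply, Complex.real_smul, mul_left_comm _ (c : ℂ), ← Finset.mul_sum]
      ring)

/-- The action of a matrix on vectors of weight `δ`. -/
def rhoOne (δ : ℂ) : (Fin n → Fin n → ℝ) →ₗ[ℝ] (Fin n → ℂ) →ₗ[ℝ] Fin n → ℂ :=
  LinearMap.mk₂ ℝ
    (fun M b i => ∑ k, (M i k : ℂ) * b k - δ * (∑ k, (M k k : ℂ)) * b i)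
    (fun M M' a => by
      funext i
      simp only [Pi.add_apply, Complex.ofReal_add, add_mul, Finset.sum_add_distrib]; ring)
    (fun c M a => by
      funext i
      simp only [Pi.smul_apply, smul_eq_mul, Complex.ofReal_mul, mul_assoc, ← Finset.mul_sum,
        Complex.real_smul]; ring)
    (fun M a a' => by
      funext i
      simp only [Pi.add_apply, mul_add, Finset.sum_add_distrib]; ring)
    (fun c M a => by
      funext i
      simp only [Pi.smul_apply, Complex.real_smul, mul_left_comm _ (c : ℂ), ← Finset.mul_sum]
      ring)

/-- The action of a matrix on scalars of weight `δ`. -/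
def rhoZero (δ : ℂ) : (Fin n → Fin n → ℝ) →ₗ[ℝ] ℂ →ₗ[ℝ] ℂ :=
  LinearMap.mk₂ ℝ (fun M c => -(δ * (∑ k, (M k k : ℂ)) * c))
    (fun M M' a => by
      simp only [Pi.add_apply, Complex.ofReal_add, Finset.sum_add_distrib]; ring)
    (fun c M a => by
      simp only [Pi.smul_apply, smul_eq_mul, Complex.ofReal_mul, ← Finset.mul_sum,
        Complex.real_smul]; ring)
    (fun M a a' => by ring)
    (fun c M a => by simp only [Complex.real_smul]; ring)

/-- The action of the Jacobian matrix of a vector field on coefficients of operators. -/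
def rhoOp (δ : ℂ) : (Fin n → Fin n → ℝ) →ₗ[ℝ] Coeffs n →ₗ[ℝ] Coeffs n :=
  LinearMap.mk₂ ℝ (fun M T => (rhoTwo δ M T.1, rhoOne δ M T.2.1, rhoZero δ M T.2.2))
    (fun _ _ _ => by simp) (fun _ _ _ => by simp) (fun _ _ _ => by simp)
    (fun c M T => by
      change (rhoTwo δ M (c • T.1), rhoOne δ M (c • T.2.1), rhoZero δ M (c • T.2.2)) = _
      simp only [map_smul]
      rfl)

/-- The action of the second derivatives of a projective vector field on coefficients of operators
on densities of degree `lam`. -/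
def nuOp (lam : ℂ) : (Fin n → ℝ) →ₗ[ℝ] Coeffs n →ₗ[ℝ] Coeffs n :=
  LinearMap.mk₂ ℝ
    (fun w T => (0, fun j => (1 + (n + 1) * lam) * ∑ k, (w k : ℂ) * (T.1 j k + T.1 k j),
      lam * (n + 1) * ∑ k, (w k : ℂ) * T.2.1 k))
    (fun M M' a => by
      ext <;> simp [add_mul, mul_add, Finset.sum_add_distrib]; ring)
    (fun c M a => by
      ext <;> simp [mul_assoc, ← Finset.mul_sum, mul_left_comm _ (c : ℂ)])
    (fun M a a' => by
      ext <;> simp [mul_add, Finset.sum_add_distrib]; ring)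
    (fun c M a => by
      ext <;> simp [mul_left_comm _ (c : ℂ), ← Finset.mul_sum, ← mul_add])

theorem rhoTwo_apply (δ : ℂ) (M : Fin n → Fin n → ℝ) (a : Fin n → Fin n → ℂ) (i j : Fin n) :
    rhoTwo δ M a i j = ∑ k, (M i k : ℂ) * a k j + ∑ k, (M j k : ℂ) * a i k
      - δ * (∑ k, (M k k : ℂ)) * a i j := rfl

theorem rhoOne_apply (δ : ℂ) (M : Fin n → Fin n → ℝ) (b : Fin n → ℂ) (i : Fin n) :
    rhoOne δ M b i = ∑ k, (M i k : ℂ) * b k - δ * (∑ k, (M k k : ℂ)) * b i := rfl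

theorem rhoZero_apply (δ : ℂ) (M : Fin n → Fin n → ℝ) (c : ℂ) :
    rhoZero δ M c = -(δ * (∑ k, (M k k : ℂ)) * c) := rfl

theorem rhoOp_apply (δ : ℂ) (M : Fin n → Fin n → ℝ) (T : Coeffs n) :
    rhoOp δ M T = (rhoTwo δ M T.1, rhoOne δ M T.2.1, rhoZero δ M T.2.2) := rfl

theorem nuOp_apply (lam : ℂ) (w : Fin n → ℝ) (T : Coeffs n) :
    nuOp lam w T = (0, fun j => (1 + (n + 1) * lam) * ∑ k, (w k : ℂ) * (T.1 j k + T.1 k j),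
      lam * (n + 1) * ∑ k, (w k : ℂ) * T.2.1 k) := rfl

/-- The eigenvalue of the Casimir operator on symbols of degree `k` and weight `δ`. -/
def casimirEig (n : ℕ) (δ k : ℂ) : ℂ :=
  2 * k ^ 2 + 2 * n * k - 2 * δ * k * (n + 1) + n * (n + 1) * (δ ^ 2 - δ)

/-- The identity matrix acts by `2 - nδ`. In the sum over `E_{ij}`, `E_{ji}`, each index contributes
`n`, the two cross terms transpose `a` and so contribute 2 in all by symmetry, and the density
weight contributes `-4δ + nδ²`. Symmetry of `a` is what makes the result a scalar. -/
theorem casimir_rhoTwo (δ : ℂ) {a : Fin n → Fin n → ℂ} (ha : ∀ i j, a i j = a j i) :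
    (n + 1 : ℝ) • rhoTwo δ (fun p q => if p = q then 1 else 0) a
        + rhoTwo δ (fun p q => if p = q then 1 else 0)
            (rhoTwo δ (fun p q => if p = q then 1 else 0) a)
        + ∑ i, ∑ j, rhoTwo δ (fun p q => if p = i ∧ q = j then 1 else 0)
            (rhoTwo δ (fun p q => if p = j ∧ q = i then 1 else 0) a)
      = casimirEig n δ 2 • a := by
  have h1 : ∀ a : Fin n → Fin n → ℂ, rhoTwo δ (fun p q => if p = q then 1 else 0) a
      = (2 - n * δ) • a := by
    intro a; funext p q
    simp [rhoTwo_apply, ofReal_ite_one_zero]; ring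
  have h2 : ∀ (i j : Fin n) (a : Fin n → Fin n → ℂ) (p q : Fin n),
      rhoTwo δ (fun p q => if p = i ∧ q = j then 1 else 0) a p q
        = (if p = i then a j q else 0) + (if q = i then a p j else 0)
          - δ * (if i = j then a p q else 0) := by
    intro i j a p q
    have : ∑ k : Fin n, (((if k = i ∧ k = j then 1 else 0 : ℝ)) : ℂ) = if i = j then 1 else 0 := by
      rw [Finset.sum_eq_single i] <;> simp +contextual [ofReal_ite_one_zero]
    rw [rhoTwo_apply, this]
    congr 1
    · congr 1
      · by_cases h : p = i <;> simp [h, ofReal_ite_one_zero]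
      · by_cases h : q = i <;> simp [h, ofReal_ite_one_zero]
    · split_ifs <;> simp
  funext p q
  have h3 : ∑ i, ∑ j, rhoTwo δ (fun p q => if p = i ∧ q = j then 1 else 0)
            (rhoTwo δ (fun p q => if p = j ∧ q = i then 1 else 0) a) p q
      = (2 * n + 2 - 4 * δ + n * δ ^ 2) * a p q := by
    have h4 : ∀ i j : Fin n, rhoTwo δ (fun p q => if p = i ∧ q = j then 1 else 0)
            (rhoTwo δ (fun p q => if p = j ∧ q = i then 1 else 0) a) p q
        = (if p = i then a i q else 0) + (if q = i then a p i else 0)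
          + (if p = i then if q = j then a j i else 0 else 0)
          + (if q = i then if p = j then a i j else 0 else 0)
          - 2 * δ * (if i = j then (if p = i then a i q else 0) + (if q = i then a p i else 0)
              else 0)
          + δ ^ 2 * (if i = j then a p q else 0) := by
      intro i j
      simp only [h2]
      by_cases h1 : p = i <;> by_cases h2 : q = i <;> by_cases h3 : i = j <;>
        by_cases h4 : p = j <;> by_cases h5 : q = j <;> simp [h1, h2, h3, h4, h5] <;> grind
    simp only [h4, Finset.sum_add_distrib, Finset.sum_sub_distrib, ← Finset.mul_sum]
    simp [ha q p, Finset.sum_add_distrib]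
    ring
  simp only [h1, Pi.add_apply, Finset.sum_apply, h3, Pi.smul_apply, smul_eq_mul,
    Complex.real_smul, casimirEig]
  push_cast
  ring

/-- With a single index there is no transposition term, so no symmetry is needed; the identity now
acts by `1 - nδ`. -/
theorem casimir_rhoOne (δ : ℂ) (b : Fin n → ℂ) :
    (n + 1 : ℝ) • rhoOne δ (fun p q => if p = q then 1 else 0) b
        + rhoOne δ (fun p q => if p = q then 1 else 0)
            (rhoOne δ (fun p q => if p = q then 1 else 0) b)
        + ∑ i, ∑ j, rhoOne δ (fun p q => if p = i ∧ q = j then 1 else 0)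
            (rhoOne δ (fun p q => if p = j ∧ q = i then 1 else 0) b)
      = casimirEig n δ 1 • b := by
  have h1 : ∀ b : Fin n → ℂ, rhoOne δ (fun p q => if p = q then 1 else 0) b
      = (1 - n * δ) • b := by
    intro b; funext p
    simp [rhoOne_apply, ofReal_ite_one_zero]; ring
  have h2 : ∀ (i j : Fin n) (b : Fin n → ℂ) (p : Fin n),
      rhoOne δ (fun p q => if p = i ∧ q = j then 1 else 0) b p
        = (if p = i then b j else 0) - δ * (if i = j then b p else 0) := by
    intro i j b p
    have : ∑ k : Fin n, (((if k = i ∧ k = j then 1 else 0 : ℝ)) : ℂ) = if i = j then 1 else 0 := by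
      rw [Finset.sum_eq_single i] <;> simp +contextual [ofReal_ite_one_zero]
    rw [rhoOne_apply, this]
    congr 1
    · by_cases h : p = i <;> simp [h, ofReal_ite_one_zero]
    · split_ifs <;> simp
  funext p
  have h3 : ∑ i, ∑ j, rhoOne δ (fun p q => if p = i ∧ q = j then 1 else 0)
            (rhoOne δ (fun p q => if p = j ∧ q = i then 1 else 0) b) p
      = (n - 2 * δ + n * δ ^ 2) * b p := by
    have h4 : ∀ i j : Fin n, rhoOne δ (fun p q => if p = i ∧ q = j then 1 else 0)
            (rhoOne δ (fun p q => if p = j ∧ q = i then 1 else 0) b) p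
        = (if p = i then b i else 0) - 2 * δ * (if i = j then (if p = i then b i else 0) else 0)
          + δ ^ 2 * (if i = j then b p else 0) := by
      intro i j
      simp only [h2]
      by_cases h1 : p = i <;> by_cases h3 : i = j <;>
        by_cases h4 : p = j <;> simp [h1, h3, h4] <;> grind
    simp only [h4, Finset.sum_add_distrib, Finset.sum_sub_distrib, ← Finset.mul_sum]
    simp
    ring
  simp only [h1, Pi.add_apply, Finset.sum_apply, h3, Pi.smul_apply, smul_eq_mul,
    Complex.real_smul, casimirEig]
  push_cast
  ring

theorem casimir_rhoZero (δ : ℂ) (c : ℂ) :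
    (n + 1 : ℝ) • rhoZero (n := n) δ (fun p q => if p = q then 1 else 0) c
        + rhoZero (n := n) δ (fun p q => if p = q then 1 else 0)
            (rhoZero (n := n) δ (fun p q => if p = q then 1 else 0) c)
        + ∑ i : Fin n, ∑ j : Fin n, rhoZero δ (fun p q => if p = i ∧ q = j then 1 else 0)
            (rhoZero δ (fun p q => if p = j ∧ q = i then 1 else 0) c)
      = casimirEig n δ 0 * c := by
  have h2 : ∀ (i j : Fin n) (c : ℂ),
      rhoZero δ (fun p q => if p = i ∧ q = j then 1 else 0) c
        = - (δ * (if i = j then c else 0)) := by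
    intro i j c
    have : ∑ k : Fin n, (((if k = i ∧ k = j then 1 else 0 : ℝ)) : ℂ) = if i = j then 1 else 0 := by
      rw [Finset.sum_eq_single i] <;> simp +contextual [ofReal_ite_one_zero]
    rw [rhoZero_apply, this]
    split_ifs <;> simp
  have h3 : ∑ i : Fin n, ∑ j : Fin n, rhoZero δ (fun p q => if p = i ∧ q = j then 1 else 0)
            (rhoZero δ (fun p q => if p = j ∧ q = i then 1 else 0) c)
      = (n * δ ^ 2) * c := by
    have h4 : ∀ i j : Fin n, rhoZero δ (fun p q => if p = i ∧ q = j then 1 else 0)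
            (rhoZero δ (fun p q => if p = j ∧ q = i then 1 else 0) c)
        = δ ^ 2 * (if i = j then c else 0) := by
      intro i j
      simp only [h2]
      by_cases h3 : i = j <;> simp [h3, sq, mul_assoc]
    simp only [h4, ← Finset.mul_sum]
    simp
    ring
  rw [h3]
  simp [rhoZero_apply, casimirEig]
  ring

/-- The operator `a^{ij} ∂_i ∂_j + b^j ∂_j + c`. -/
def opOfCoeffs (T : (Fin n → ℝ) → Coeffs n) (f : (Fin n → ℝ) → ℂ) (x : Fin n → ℝ) : ℂ :=
  ∑ i, ∑ j, (T x).1 i j * pd i (pd j f) x + ∑ j, (T x).2.1 j * pd j f x + (T x).2.2 * f x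

end Operators

/-! ### Commutators of second-order operators with Lie derivatives of densities. -/

section Commutator

variable {n : ℕ}

theorem contDiff_coeffs_two {T : (Fin n → ℝ) → Coeffs n} (hT : ContDiff ℝ ∞ T) (i j : Fin n) :
    ContDiff ℝ ∞ fun y => (T y).1 i j :=
  contDiff_pi.1 (contDiff_pi.1 hT.fst i) j

theorem contDiff_coeffs_one {T : (Fin n → ℝ) → Coeffs n} (hT : ContDiff ℝ ∞ T) (j : Fin n) :
    ContDiff ℝ ∞ fun y => (T y).2.1 j :=
  contDiff_pi.1 hT.snd.fst j

theorem pd_coeffs_two {T : (Fin n → ℝ) → Coeffs n} (hT : ContDiff ℝ ∞ T) (k i j : Fin n)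
    (x : Fin n → ℝ) : (pd k T x).1 i j = pd k (fun y => (T y).1 i j) x := by
  have h := hT.differentiableAt_of_smooth x
  have h1 : (pd k T x).1 = pd k (fun y => (T y).1) x :=
    (pd_clm (ContinuousLinearMap.fst ℝ _ _) h k).symm
  rw [h1, pd_pi h.fst, pd_pi (differentiableAt_pi.1 h.fst i)]

theorem pd_coeffs_one {T : (Fin n → ℝ) → Coeffs n} (hT : ContDiff ℝ ∞ T) (k j : Fin n)
    (x : Fin n → ℝ) : (pd k T x).2.1 j = pd k (fun y => (T y).2.1 j) x := by
  have h := hT.differentiableAt_of_smooth x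
  have h1 : (pd k T x).2.1 = pd k (fun y => (T y).2.1) x :=
    (pd_clm ((ContinuousLinearMap.fst ℝ (Fin n → ℂ) ℂ).comp
      (ContinuousLinearMap.snd ℝ (Fin n → Fin n → ℂ) ((Fin n → ℂ) × ℂ))) h k).symm
  rw [h1, pd_pi h.snd.fst]

theorem pd_coeffs_zero {T : (Fin n → ℝ) → Coeffs n} (hT : ContDiff ℝ ∞ T) (k : Fin n)
    (x : Fin n → ℝ) : (pd k T x).2.2 = pd k (fun y => (T y).2.2) x := by
  have h := hT.differentiableAt_of_smooth x
  exact (pd_clm ((ContinuousLinearMap.snd ℝ (Fin n → ℂ) ℂ).comp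
    (ContinuousLinearMap.snd ℝ _ _)) h k).symm

theorem contDiff_ofReal {f : (Fin n → ℝ) → ℝ} (hf : ContDiff ℝ ∞ f) :
    ContDiff ℝ ∞ fun y => (f y : ℂ) :=
  Complex.ofRealCLM.contDiff.comp hf

theorem contDiff_lieDensity (s : ℂ) (Y : Matrix (Fin (n + 1)) (Fin (n + 1)) ℝ)
    {f : (Fin n → ℝ) → ℂ} (hf : ContDiff ℝ ∞ f) :
    ContDiff ℝ ∞ (lieDensity s (chartField Y) f) :=
  (ContDiff.sum fun i _ => (contDiff_ofReal (contDiff_chartField Y i)).mul (contDiff_pd hf i)).add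
    ((contDiff_const.mul (contDiff_ofReal (contDiff_divField Y))).mul hf)

theorem pd_lieDensity (s : ℂ) (Y : Matrix (Fin (n + 1)) (Fin (n + 1)) ℝ)
    {f : (Fin n → ℝ) → ℂ} (hf : ContDiff ℝ ∞ f) (j : Fin n) (x : Fin n → ℝ) :
    pd j (lieDensity s (chartField Y) f) x
      = ∑ k, ((chartField Y x k : ℂ) * pd k (pd j f) x + (fieldJac Y x k j : ℂ) * pd k f x)
        + (s * (divField (chartField Y) x : ℂ) * pd j f x
          - s * (n + 1) * (fieldHess Y j : ℂ) * f x) := by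
  have hV := fun k => (contDiff_chartField Y k).differentiableAt_of_smooth x
  have hVc := fun k => (contDiff_ofReal (contDiff_chartField Y k)).differentiableAt_of_smooth x
  have hD := (contDiff_divField Y).differentiableAt_of_smooth x
  have hDc := (contDiff_ofReal (contDiff_divField Y)).differentiableAt_of_smooth x
  have hf0 := hf.differentiableAt_of_smooth x
  have hf1 := fun k => (contDiff_pd hf k).differentiableAt_of_smooth x
  have hp := fun k => (hVc k).fun_mul (hf1 k)
  have hs : DifferentiableAt ℝ (fun y => s * (divField (chartField Y) y : ℂ)) x :=
    (differentiableAt_const s).fun_mul hDc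
  unfold lieDensity
  rw [pd_add (DifferentiableAt.fun_sum fun k _ => hp k) (hs.fun_mul hf0), pd_sum _ hp,
    pd_mul hs hf0, pd_const_mul s hDc, pd_ofReal hD, pd_divField]
  congr 1
  · refine Finset.sum_congr rfl fun k _ => ?_
    rw [pd_mul (hVc k) (hf1 k), pd_ofReal (hV k), pd_chartField, pd_comm hf]
  · rw [fieldHess]
    push_cast
    ring

/-- The covector `w = fieldHess Y` enters twice, through the second derivatives of the field, with
coefficient 1, and through the gradient of its divergence, with coefficient `s(n+1)`. Together they
give the factor `1 + s(n+1)`, the origin of `1 + (n+1)λ` in `nuOp` and in `C^2_1`. There is no term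
in `f` itself because the divergence is affine in `x`. -/
theorem pd_pd_lieDensity (s : ℂ) (Y : Matrix (Fin (n + 1)) (Fin (n + 1)) ℝ)
    {f : (Fin n → ℝ) → ℂ} (hf : ContDiff ℝ ∞ f) (i j : Fin n) (x : Fin n → ℝ) :
    pd i (pd j (lieDensity s (chartField Y) f)) x
      = ∑ k, ((chartField Y x k : ℂ) * pd k (pd i (pd j f)) x
          + (fieldJac Y x k i : ℂ) * pd k (pd j f) x
          + (fieldJac Y x k j : ℂ) * pd i (pd k f) x)
        + (s * (divField (chartField Y) x : ℂ) * pd i (pd j f) x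
          - (1 + s * (n + 1)) * ((fieldHess Y j : ℂ) * pd i f x + (fieldHess Y i : ℂ) * pd j f x))
            := by
  have hV := fun k => (contDiff_chartField Y k).differentiableAt_of_smooth x
  have hVc := fun k => (contDiff_ofReal (contDiff_chartField Y k)).differentiableAt_of_smooth x
  have hJ := fun k j => (contDiff_fieldJac Y k j).differentiableAt_of_smooth x
  have hJc := fun k j => (contDiff_ofReal (contDiff_fieldJac Y k j)).differentiableAt_of_smooth x
  have hD := (contDiff_divField Y).differentiableAt_of_smooth x
  have hDc := (contDiff_ofReal (contDiff_divField Y)).differentiableAt_of_smooth x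
  have hf0 := hf.differentiableAt_of_smooth x
  have hf1 := fun k => (contDiff_pd hf k).differentiableAt_of_smooth x
  have hf2 := fun k l => (contDiff_pd (contDiff_pd hf l) k).differentiableAt_of_smooth x
  have hp := fun k => ((hVc k).fun_mul (hf2 k j)).fun_add ((hJc k j).fun_mul (hf1 k))
  have hs : DifferentiableAt ℝ (fun y => s * (divField (chartField Y) y : ℂ)) x :=
    (differentiableAt_const s).fun_mul hDc
  have hw : DifferentiableAt ℝ (fun y => s * (n + 1) * (fieldHess Y j : ℂ) * f y) x :=
    (differentiableAt_const _).fun_mul hf0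
  rw [funext (pd_lieDensity s Y hf j),
    pd_add (DifferentiableAt.fun_sum fun k _ => hp k) ((hs.fun_mul (hf1 j)).fun_sub hw),
    pd_sum _ hp, pd_sub (hs.fun_mul (hf1 j)) hw, pd_mul hs (hf1 j), pd_const_mul s hDc,
    pd_ofReal hD, pd_divField, pd_const_mul _ hf0]
  have h1 : ∀ k, pd i (fun y => (chartField Y y k : ℂ) * pd k (pd j f) y
        + (fieldJac Y y k j : ℂ) * pd k f y) x
      = ((chartField Y x k : ℂ) * pd k (pd i (pd j f)) x
          + (fieldJac Y x k i : ℂ) * pd k (pd j f) x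
          + (fieldJac Y x k j : ℂ) * pd i (pd k f) x)
        - ((if k = j then (fieldHess Y i : ℂ) * pd k f x else 0)
          + if k = i then (fieldHess Y j : ℂ) * pd k f x else 0) := by
    intro k
    rw [pd_add ((hVc k).fun_mul (hf2 k j)) ((hJc k j).fun_mul (hf1 k)),
      pd_mul (hVc k) (hf2 k j), pd_mul (hJc k j) (hf1 k), pd_ofReal (hV k), pd_ofReal (hJ k j),
      pd_chartField, pd_fieldJac, pd_comm (contDiff_pd hf j) i k]
    simp only [fieldHess]
    split_ifs <;> push_cast <;> ring
  rw [Finset.sum_congr rfl fun k _ => h1 k, Finset.sum_sub_distrib, Finset.sum_add_distrib]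
  simp only [Finset.sum_add_distrib, Finset.sum_ite_eq', Finset.mem_univ, if_true]
  rw [show Y (Fin.last n) i.castSucc = fieldHess Y i from rfl]
  push_cast
  ring

theorem pd_opOfCoeffs {T : (Fin n → ℝ) → Coeffs n} (hT : ContDiff ℝ ∞ T)
    {f : (Fin n → ℝ) → ℂ} (hf : ContDiff ℝ ∞ f) (k : Fin n) (x : Fin n → ℝ) :
    pd k (opOfCoeffs T f) x
      = ∑ i, ∑ j, ((T x).1 i j * pd k (pd i (pd j f)) x + (pd k T x).1 i j * pd i (pd j f) x)
        + ∑ j, ((T x).2.1 j * pd k (pd j f) x + (pd k T x).2.1 j * pd j f x)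
        + ((T x).2.2 * pd k f x + (pd k T x).2.2 * f x) := by
  have hf0 := hf.differentiableAt_of_smooth x
  have hf1 := fun k => (contDiff_pd hf k).differentiableAt_of_smooth x
  have hf2 := fun k l => (contDiff_pd (contDiff_pd hf l) k).differentiableAt_of_smooth x
  have ha := fun i j => (contDiff_coeffs_two hT i j).differentiableAt_of_smooth x
  have hb := fun j => (contDiff_coeffs_one hT j).differentiableAt_of_smooth x
  have hc := hT.snd.snd.differentiableAt_of_smooth x
  have h2 := fun i j => (ha i j).fun_mul (hf2 i j)
  have h1 := fun j => (hb j).fun_mul (hf1 j)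
  have h2s := fun i => DifferentiableAt.fun_sum (u := Finset.univ) fun j _ => h2 i j
  have h2ss := DifferentiableAt.fun_sum (u := Finset.univ) fun i _ => h2s i
  have h1s := DifferentiableAt.fun_sum (u := Finset.univ) fun j _ => h1 j
  unfold opOfCoeffs
  rw [pd_add (h2ss.fun_add h1s) (hc.fun_mul hf0), pd_add h2ss h1s, pd_sum _ h2s, pd_sum _ h1,
    pd_mul hc hf0, pd_coeffs_zero hT]
  simp only [pd_sum _ (h2 _), pd_mul (ha _ _) (hf2 _ _), pd_mul (hb _) (hf1 _), pd_coeffs_two hT,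
    pd_coeffs_one hT]

/-- The commutator with Lie derivatives of densities, on coefficients of operators. -/
theorem commutator_opOfCoeffs (lam mu : ℂ) (Y : Matrix (Fin (n + 1)) (Fin (n + 1)) ℝ)
    {T : (Fin n → ℝ) → Coeffs n} (hT : ContDiff ℝ ∞ T) {f : (Fin n → ℝ) → ℂ}
    (hf : ContDiff ℝ ∞ f) (x : Fin n → ℝ) :
    lieDensity mu (chartField Y) (opOfCoeffs T f) x
        - opOfCoeffs T (lieDensity lam (chartField Y) f) x
      = opOfCoeffs (lieSection (rhoOp (mu - lam)) (nuOp lam) Y T) f x := by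
  have hdiv : (divField (chartField Y) x : ℂ) = ∑ p, (fieldJac Y x p p : ℂ) := by
    rw [divField_chartField]; push_cast; rfl
  have hs2 : ∀ i j, (lieSection (rhoOp (mu - lam)) (nuOp lam) Y T x).1 i j
      = ∑ k, (chartField Y x k : ℂ) * (pd k T x).1 i j
        - (∑ k, (fieldJac Y x i k : ℂ) * (T x).1 k j + ∑ k, (fieldJac Y x j k : ℂ) * (T x).1 i k
          - (mu - lam) * (divField (chartField Y) x : ℂ) * (T x).1 i j) := by
    intro i j
    rw [hdiv, lieSection, rhoOp_apply, nuOp_apply]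
    simp [Prod.fst_sum, Finset.sum_apply, rhoTwo_apply]
  have hs1 : ∀ j, (lieSection (rhoOp (mu - lam)) (nuOp lam) Y T x).2.1 j
      = ∑ k, (chartField Y x k : ℂ) * (pd k T x).2.1 j
        - (∑ k, (fieldJac Y x j k : ℂ) * (T x).2.1 k
          - (mu - lam) * (divField (chartField Y) x : ℂ) * (T x).2.1 j)
        + (1 + (n + 1) * lam) * ∑ k, (fieldHess Y k : ℂ) * ((T x).1 j k + (T x).1 k j) := by
    intro j
    rw [hdiv, lieSection, rhoOp_apply, nuOp_apply]
    simp [Prod.fst_sum, Prod.snd_sum, Finset.sum_apply, rhoOne_apply]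
  have hs0 : (lieSection (rhoOp (mu - lam)) (nuOp lam) Y T x).2.2
      = ∑ k, (chartField Y x k : ℂ) * (pd k T x).2.2
        + (mu - lam) * (divField (chartField Y) x : ℂ) * (T x).2.2
        + lam * (n + 1) * ∑ k, (fieldHess Y k : ℂ) * (T x).2.1 k := by
    rw [hdiv, lieSection, rhoOp_apply, nuOp_apply]
    simp [Prod.snd_sum, rhoZero_apply]
  unfold opOfCoeffs
  simp only [hs2, hs1, hs0, pd_pd_lieDensity lam Y hf, pd_lieDensity lam Y hf]
  rw [lieDensity]
  change ∑ k, (chartField Y x k : ℂ) * pd k (opOfCoeffs T f) x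
    + mu * (divField (chartField Y) x : ℂ) * opOfCoeffs T f x - _ = _
  simp only [pd_opOfCoeffs hT hf]
  unfold opOfCoeffs lieDensity
  -- All derivatives of the field have been computed, so the claim is now an algebraic identity
  -- between finite sums at the point `x`. The equations below rename indices and extract scalars;
  -- `e5` cancels the third derivatives of `f`.
  generalize (divField (chartField Y) x : ℂ) = d
  generalize fieldHess Y = w
  generalize chartField Y x = V
  generalize fieldJac Y x = J
  have e1 : ∑ i, ∑ j, (∑ k, (J i k : ℂ) * (T x).1 k j) * pd i (pd j f) x
      = ∑ i, ∑ j, (T x).1 i j * ∑ k, (J k i : ℂ) * pd k (pd j f) x := by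
    simp only [Finset.sum_mul, Finset.mul_sum]
    rw [Finset.sum_congr rfl fun i _ => Finset.sum_comm, Finset.sum_comm]
    refine Finset.sum_congr rfl fun i _ => ?_
    rw [Finset.sum_comm]
    exact Finset.sum_congr rfl fun j _ => Finset.sum_congr rfl fun k _ => by ring
  have e2 : ∑ i, ∑ j, (∑ k, (J j k : ℂ) * (T x).1 i k) * pd i (pd j f) x
      = ∑ i, ∑ j, (T x).1 i j * ∑ k, (J k j : ℂ) * pd i (pd k f) x := by
    simp only [Finset.sum_mul, Finset.mul_sum]
    refine Finset.sum_congr rfl fun i _ => ?_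
    rw [Finset.sum_comm]
    exact Finset.sum_congr rfl fun j _ => Finset.sum_congr rfl fun k _ => by ring
  have e3 : ∑ j, (∑ k, (J j k : ℂ) * (T x).2.1 k) * pd j f x
      = ∑ j, (T x).2.1 j * ∑ k, (J k j : ℂ) * pd k f x := by
    simp only [Finset.sum_mul, Finset.mul_sum]
    rw [Finset.sum_comm]
    exact Finset.sum_congr rfl fun j _ => Finset.sum_congr rfl fun k _ => by ring
  have e4 : ∑ j, (∑ k, (w k : ℂ) * ((T x).1 j k + (T x).1 k j)) * pd j f x
      = ∑ i, ∑ j, (T x).1 i j * ((w j : ℂ) * pd i f x + (w i : ℂ) * pd j f x) := by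
    simp only [Finset.sum_mul, mul_add, add_mul, Finset.sum_add_distrib]
    congr 1
    · exact Finset.sum_congr rfl fun j _ => Finset.sum_congr rfl fun k _ => by ring
    · rw [Finset.sum_comm]
      exact Finset.sum_congr rfl fun j _ => Finset.sum_congr rfl fun k _ => by ring
  have e5 : ∑ k, (V k : ℂ) * ∑ i, ∑ j, (T x).1 i j * pd k (pd i (pd j f)) x
      = ∑ i, ∑ j, (T x).1 i j * ∑ k, (V k : ℂ) * pd k (pd i (pd j f)) x := by
    simp only [Finset.mul_sum]
    rw [Finset.sum_comm]
    refine Finset.sum_congr rfl fun i _ => ?_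
    rw [Finset.sum_comm]
    exact Finset.sum_congr rfl fun j _ => Finset.sum_congr rfl fun k _ => by ring
  have e6 : ∑ k, (V k : ℂ) * ∑ i, ∑ j, (pd k T x).1 i j * pd i (pd j f) x
      = ∑ i, ∑ j, (∑ k, (V k : ℂ) * (pd k T x).1 i j) * pd i (pd j f) x := by
    simp only [Finset.mul_sum, Finset.sum_mul]
    rw [Finset.sum_comm]
    refine Finset.sum_congr rfl fun i _ => ?_
    rw [Finset.sum_comm]
    exact Finset.sum_congr rfl fun j _ => Finset.sum_congr rfl fun k _ => by ring
  have e7 : ∑ k, (V k : ℂ) * ∑ j, (T x).2.1 j * pd k (pd j f) x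
      = ∑ j, (T x).2.1 j * ∑ k, (V k : ℂ) * pd k (pd j f) x := by
    simp only [Finset.mul_sum]
    rw [Finset.sum_comm]
    exact Finset.sum_congr rfl fun j _ => Finset.sum_congr rfl fun k _ => by ring
  have e8 : ∑ k, (V k : ℂ) * ∑ j, (pd k T x).2.1 j * pd j f x
      = ∑ j, (∑ k, (V k : ℂ) * (pd k T x).2.1 j) * pd j f x := by
    simp only [Finset.mul_sum, Finset.sum_mul]
    rw [Finset.sum_comm]
    exact Finset.sum_congr rfl fun j _ => Finset.sum_congr rfl fun k _ => by ring
  have e9 : ∑ k, (V k : ℂ) * ((T x).2.2 * pd k f x) = (T x).2.2 * ∑ k, (V k : ℂ) * pd k f x := by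
    simp only [Finset.mul_sum]
    exact Finset.sum_congr rfl fun k _ => by ring
  have e10 : ∑ k, (V k : ℂ) * ((pd k T x).2.2 * f x)
      = (∑ k, (V k : ℂ) * (pd k T x).2.2) * f x := by
    simp only [Finset.sum_mul, mul_assoc]
  have e11 : ∑ i, ∑ j, (T x).1 i j * (lam * d * pd i (pd j f) x)
      = lam * d * ∑ i, ∑ j, (T x).1 i j * pd i (pd j f) x := by
    simp only [Finset.mul_sum]
    exact Finset.sum_congr rfl fun j _ => Finset.sum_congr rfl fun k _ => by ring
  have e12 : ∑ i, ∑ j, (mu - lam) * d * (T x).1 i j * pd i (pd j f) x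
      = (mu - lam) * d * ∑ i, ∑ j, (T x).1 i j * pd i (pd j f) x := by
    simp only [Finset.mul_sum, mul_assoc]
  have e13 : ∑ i, ∑ j, (T x).1 i j * ((1 + lam * (n + 1))
        * ((w j : ℂ) * pd i f x + (w i : ℂ) * pd j f x))
      = (1 + lam * (n + 1)) * ∑ i, ∑ j, (T x).1 i j
        * ((w j : ℂ) * pd i f x + (w i : ℂ) * pd j f x) := by
    simp only [Finset.mul_sum]
    exact Finset.sum_congr rfl fun j _ => Finset.sum_congr rfl fun k _ => by ring
  have e14 : ∑ j, (T x).2.1 j * (lam * d * pd j f x) = lam * d * ∑ j, (T x).2.1 j * pd j f x := by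
    simp only [Finset.mul_sum]
    exact Finset.sum_congr rfl fun j _ => by ring
  have e15 : ∑ j, (T x).2.1 j * (lam * (n + 1) * (w j : ℂ) * f x)
      = lam * (n + 1) * (∑ k, (w k : ℂ) * (T x).2.1 k) * f x := by
    simp only [Finset.mul_sum, Finset.sum_mul]
    exact Finset.sum_congr rfl fun j _ => by ring
  have e16 : ∑ j, (mu - lam) * d * (T x).2.1 j * pd j f x
      = (mu - lam) * d * ∑ j, (T x).2.1 j * pd j f x := by
    simp only [Finset.mul_sum, mul_assoc]
  have e17 : ∑ j, (1 + (n + 1) * lam) * (∑ k, (w k : ℂ) * ((T x).1 j k + (T x).1 k j)) * pd j f x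
      = (1 + (n + 1) * lam) * ∑ j, (∑ k, (w k : ℂ) * ((T x).1 j k + (T x).1 k j)) * pd j f x := by
    rw [Finset.mul_sum]
    exact Finset.sum_congr rfl fun j _ => by ring
  simp only [Finset.sum_add_distrib, mul_add (V _ : ℂ), mul_add ((T x).1 _ _), mul_sub,
    mul_add ((T x).2.1 _), add_mul, sub_mul, Finset.sum_sub_distrib]
    at e4 e12 e13 e16 e17 ⊢
  linear_combination e5 + e6 + e7 + e8 + e9 + e10 + e1 + e2 + e3 - e11 + e13 - e14 + e15 - e12
    - e16 - e17 - (1 + (n + 1) * lam) * e4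

end Commutator

/-! ### Lie derivatives as derivatives along one-parameter groups -/

section Flow

variable {n : ℕ}

/-! ### Derivatives of the matrix exponential. -/

section MatrixExp

attribute [local instance] Matrix.linftyOpNormedRing Matrix.linftyOpNormedAlgebra

theorem hasDerivAt_matrix_exp (Z : Matrix (Fin (n + 1)) (Fin (n + 1)) ℝ) (t : ℝ) (i j) :
    HasDerivAt (fun s : ℝ => NormedSpace.exp (s • Z) i j)
      ((Z * NormedSpace.exp (t • Z)) i j) t := by
  have h := hasDerivAt_exp_smul_const' (𝕂 := ℝ) Z t
  let L : Matrix (Fin (n + 1)) (Fin (n + 1)) ℝ →ₗ[ℝ] ℝ :=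
    Matrix.entryLinearMap ℝ ℝ i j
  exact L.toContinuousLinearMap.hasFDerivAt.comp_hasDerivAt t h

theorem matrix_exp_mul_exp_neg (Z : Matrix (Fin (n + 1)) (Fin (n + 1)) ℝ) (t : ℝ) :
    NormedSpace.exp (t • Z) * NormedSpace.exp (-t • Z) = 1 := by
  rw [← Matrix.exp_add_of_commute]
  · simp
  · exact ((Commute.refl Z).smul_left t).smul_right (-t)

end MatrixExp

/-- The exponential of a traceless matrix has determinant one. -/
theorem det_exp_smul {Z : Matrix (Fin (n + 1)) (Fin (n + 1)) ℝ} (hZ : Z.trace = 0) (t : ℝ) :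
    (NormedSpace.exp (t • Z)).det = 1 := by
  have h : ∀ t, HasDerivAt (fun s : ℝ => (NormedSpace.exp (s • Z)).det) 0 t := by
    intro t
    have h1 := hasDerivAt_det (M := fun s : ℝ => NormedSpace.exp (s • Z))
      (M' := Z * NormedSpace.exp (t • Z)) (t := t) (hasDerivAt_matrix_exp Z t)
    -- Row `i` of `Z M` is `∑_j Z_{ij} M_j`, of which the determinant retains only `j = i`. Jacobi's
    -- formula thus gives `tr(Z) det M`, which is zero.
    have h2 : ∑ i, ((NormedSpace.exp (t • Z)).updateRow i
        ((Z * NormedSpace.exp (t • Z)) i)).det = 0 := by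
      set M := NormedSpace.exp (t • Z)
      have h3 : ∀ i, (M.updateRow i ((Z * M) i)).det = Z i i * M.det := by
        intro i
        have : (Z * M) i = ∑ j, Z i j • M j := by
          funext k; simp [Matrix.mul_apply, Finset.sum_apply]
        rw [this, Matrix.det_updateRow_sum, smul_eq_mul]
      simp only [h3, ← Finset.sum_mul]
      have : ∑ i, Z i i = 0 := hZ
      rw [this, zero_mul]
    rwa [h2] at h1
  have h0 := is_const_of_deriv_eq_zero (fun t => (h t).differentiableAt) (fun t => (h t).deriv) t 0
  simpa using h0

/-- The one-parameter group generated by a traceless matrix. -/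
def expSL (Z : Matrix (Fin (n + 1)) (Fin (n + 1)) ℝ) (hZ : Z.trace = 0) (t : ℝ) : SL n :=
  ⟨NormedSpace.exp (t • Z), det_exp_smul hZ t⟩

theorem expSL_inv {Z : Matrix (Fin (n + 1)) (Fin (n + 1)) ℝ} (hZ : Z.trace = 0) (t : ℝ) :
    (expSL Z hZ t)⁻¹ = expSL Z hZ (-t) :=
  inv_eq_of_mul_eq_one_right (Subtype.ext (matrix_exp_mul_exp_neg Z t))

/-- A linear map preserves positive proportionality of vectors. For `k = exp(tZ)` this carries an
overlap of two charts along the one-parameter group with the coordinates `x` and `y` held fixed. -/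
theorem param_mul {k g h : SL n} {x y : Fin n → ℝ} (e : param g x = param h y) :
    param (k * g) x = param (k * h) y := by
  have hx : 0 < ‖ray g x‖ := norm_pos_iff.2 (ray_ne_zero g x)
  have hy : 0 < ‖ray h y‖ := norm_pos_iff.2 (ray_ne_zero h y)
  have hc : 0 < ‖ray g x‖ * ‖ray h y‖⁻¹ := by positivity
  have e1 : ray g x = (‖ray g x‖ * ‖ray h y‖⁻¹) • ray h y := by
    have := congrArg (fun v => ‖ray g x‖ • v) e
    simpa only [param, smul_smul, mul_inv_cancel₀ hx.ne', one_smul] using this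
  set c := ‖ray g x‖ * ‖ray h y‖⁻¹
  have e2 : ray (k * g) x = c • ray (k * h) y := by
    have := congrArg WithLp.ofLp e1
    have h1 : g.1 *ᵥ lift x = c • h.1 *ᵥ lift y := this
    unfold ray
    rw [Matrix.SpecialLinearGroup.coe_mul, Matrix.SpecialLinearGroup.coe_mul,
      ← Matrix.mulVec_mulVec, h1, Matrix.mulVec_smul, Matrix.mulVec_mulVec]
    rfl
  rw [param, param, e2, norm_smul, Real.norm_of_nonneg hc.le, smul_smul, mul_inv, mul_right_comm,
      inv_mul_cancel₀ hc.ne', one_mul]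

/-- The change of coordinates involves only `h⁻¹ g`. The Jacobian factor in a transformation law is
therefore constant along `t ↦ (exp(tZ) g, exp(tZ) h)`, so the law can be differentiated in `t`. -/
theorem jac_mul (k g h : SL n) : jac (k * g) (k * h) = jac g h := by
  have : transition (k * g) (k * h) = transition g h := by
    unfold transition
    rw [mul_inv_rev, mul_assoc, inv_mul_cancel_left]
  unfold jac
  rw [this]

theorem jacPow_mul (s : ℂ) (k g h : SL n) : jacPow s (k * g) (k * h) = jacPow s g h := by
  unfold jacPow
  rw [jac_mul]

/-- Two points whose rays are positively proportional are equal. -/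
theorem param_eq_of_mulVec {g h : SL n} {x y : Fin n → ℝ} {c : ℝ} (hc : 0 < c)
    (e : (h⁻¹ * g).1 *ᵥ lift x = c • lift y) : param g x = param h y := by
  have e2 : ray g x = c • ray h y := by
    have : g.1 = h.1 * (h⁻¹ * g).1 := by
      rw [← Matrix.SpecialLinearGroup.coe_mul, mul_inv_cancel_left]
    rw [ray, this, ← Matrix.mulVec_mulVec, e, Matrix.mulVec_smul]
    rfl
  rw [param, param, e2, norm_smul, Real.norm_of_nonneg hc.le, smul_smul, mul_inv, mul_right_comm,
    inv_mul_cancel₀ hc.ne', one_mul]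

/-- A degenerate Jacobian matrix would make the pulled-back metric degenerate, contradicting
positive definiteness. -/
theorem det_jac_ne_zero {g h : SL n} {x y : Fin n → ℝ} (e : param g x = param h y) :
    (jac g h x).det ≠ 0 := by
  intro h0
  have h1 := (metric_posDef g x).det_pos
  rw [metric_transition e, Matrix.det_mul, h0, mul_zero] at h1
  exact h1.false

theorem jacPow_ne_zero (s : ℂ) {g h : SL n} {x y : Fin n → ℝ} (e : param g x = param h y) :
    jacPow s g h x ≠ 0 := by
  rw [jacPow, Complex.cpow_ne_zero_iff]
  left
  exact_mod_cast abs_ne_zero.2 (det_jac_ne_zero e)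

theorem jac_apply {g h : SL n} {x : Fin n → ℝ}
    (hx : ((h⁻¹ * g).1 *ᵥ lift x) (Fin.last n) ≠ 0) (i j : Fin n) :
    jac g h x i j = ((h⁻¹ * g).1 i.castSucc j.castSucc
      - transition g h x i * (h⁻¹ * g).1 (Fin.last n) j.castSucc)
        / ((h⁻¹ * g).1 *ᵥ lift x) (Fin.last n) := by
  set M := (h⁻¹ * g).1 with hM
  have hd := fun a => (contDiff_mulVec_lift M a).differentiableAt_of_smooth x
  have hdi : DifferentiableAt ℝ (fun y => ((M *ᵥ lift y) (Fin.last n))⁻¹) x := (hd _).inv hx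
  have ht : ∀ i, DifferentiableAt ℝ (fun y => transition g h y i) x := fun i =>
    (hd _).fun_mul hdi
  rw [jac, Matrix.of_apply, pd_pi (differentiableAt_pi.2 ht)]
  have h1 : pd j (fun y => ((M *ᵥ lift y) (Fin.last n))⁻¹) x
      = -(M (Fin.last n) j.castSucc) / ((M *ᵥ lift x) (Fin.last n)) ^ 2 := by
    refine (pd_eq_of_hasFDerivAt (f := fun y => ((M *ᵥ lift y) (Fin.last n))⁻¹)
      ((hasDerivAt_inv hx).comp_hasFDerivAt x (hd _).hasFDerivAt) j).trans ?_
    change (-(((M *ᵥ lift x) (Fin.last n)) ^ 2)⁻¹) •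
      pd j (fun y => (M *ᵥ lift y) (Fin.last n)) x = _
    rw [pd_mulVec_lift, smul_eq_mul]
    ring
  have h2 : pd j (fun y => transition g h y i) x = _ := pd_mul (hd i.castSucc) hdi j
  rw [h2, h1, pd_mulVec_lift]
  simp only [transition, ← hM]
  field_simp
  ring

/-! ### The flow of a linear field read in one affine chart. -/

section Curve

variable {Z : Matrix (Fin (n + 1)) (Fin (n + 1)) ℝ} (hZ : Z.trace = 0) (g : SL n) (x : Fin n → ℝ)

/-- The matrix of `exp (t Z)` in the basis attached to the chart `g`. -/
def flowMatrix (Z : Matrix (Fin (n + 1)) (Fin (n + 1)) ℝ) (g : SL n) (t : ℝ) :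
    Matrix (Fin (n + 1)) (Fin (n + 1)) ℝ :=
  (g⁻¹).1 * NormedSpace.exp (t • Z) * g.1

theorem hasDerivAt_flowMatrix (i j) :
    HasDerivAt (fun t => flowMatrix Z g t i j) (((g⁻¹).1 * Z * g.1) i j) 0 := by
  have h : (fun t => flowMatrix Z g t i j)
      = fun t => ∑ k, (∑ l, (g⁻¹).1 i l * NormedSpace.exp (t • Z) l k) * g.1 k j := by
    funext t; simp only [flowMatrix, Matrix.mul_apply]
  rw [h, Matrix.mul_apply]
  simp only [Matrix.mul_apply]
  refine HasDerivAt.fun_sum fun k _ => HasDerivAt.mul_const ?_ _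
  refine HasDerivAt.fun_sum fun l _ => HasDerivAt.const_mul _ ?_
  simpa using hasDerivAt_matrix_exp Z 0 l k

theorem flowMatrix_zero : flowMatrix Z g 0 = 1 := by
  rw [flowMatrix, zero_smul, NormedSpace.exp_zero, mul_one, ← Matrix.SpecialLinearGroup.coe_mul]
  simp

theorem flowMatrix_neg_mul (t : ℝ) : flowMatrix Z g (-t) * flowMatrix Z g t = 1 := by
  have h1 : g.1 * (g⁻¹).1 = 1 := by rw [← Matrix.SpecialLinearGroup.coe_mul]; simp
  have h2 : (g⁻¹).1 * g.1 = 1 := by rw [← Matrix.SpecialLinearGroup.coe_mul]; simp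
  have h3 := matrix_exp_mul_exp_neg Z (-t)
  rw [neg_neg] at h3
  simp only [flowMatrix]
  calc _ = (g⁻¹).1 * (NormedSpace.exp (-t • Z) * ((g.1 * (g⁻¹).1) * NormedSpace.exp (t • Z)))
        * g.1 := by simp only [mul_assoc]
    _ = 1 := by rw [h1, one_mul, h3, mul_one, h2]

/-- The last coordinate of the vector `exp (t Y) (x,1)`. -/
def flowScale (Z : Matrix (Fin (n + 1)) (Fin (n + 1)) ℝ) (g : SL n) (x : Fin n → ℝ) (t : ℝ) : ℝ :=
  (flowMatrix Z g t *ᵥ lift x) (Fin.last n)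

/-- The flow of the vector field on rays generated by `Z`, in the chart `g`. -/
def flowPoint (Z : Matrix (Fin (n + 1)) (Fin (n + 1)) ℝ) (g : SL n) (x : Fin n → ℝ) (t : ℝ) :
    Fin n → ℝ :=
  fun i => (flowMatrix Z g t *ᵥ lift x) i.castSucc / flowScale Z g x t

/-- The inverse of the Jacobian matrix of the flow. -/
def flowJacInv (Z : Matrix (Fin (n + 1)) (Fin (n + 1)) ℝ) (g : SL n) (x : Fin n → ℝ) (t : ℝ) :
    Matrix (Fin n) (Fin n) ℝ :=
  Matrix.of fun i j => flowScale Z g x t * (flowMatrix Z g (-t) i.castSucc j.castSucc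
    - x i * flowMatrix Z g (-t) (Fin.last n) j.castSucc)

theorem hasDerivAt_flowMatrix_mulVec (i) :
    HasDerivAt (fun t => (flowMatrix Z g t *ᵥ lift x) i) ((((g⁻¹).1 * Z * g.1) *ᵥ lift x) i) 0 := by
  simp only [Matrix.mulVec, dotProduct]
  exact HasDerivAt.fun_sum fun k _ => (hasDerivAt_flowMatrix g i k).mul_const _

theorem flowScale_zero : flowScale Z g x 0 = 1 := by
  simp [flowScale, flowMatrix_zero, lift_last]

theorem eventually_flowScale_pos : ∀ᶠ t in nhds 0, 0 < flowScale Z g x t := by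
  refine (hasDerivAt_flowMatrix_mulVec (Z := Z) g x (Fin.last n)).continuousAt.eventually
    (lt_mem_nhds ?_)
  simp [flowMatrix_zero, lift_last]

theorem flowMatrix_mulVec_lift {t : ℝ} (ht : flowScale Z g x t ≠ 0) :
    flowMatrix Z g t *ᵥ lift x = flowScale Z g x t • lift (flowPoint Z g x t) := by
  funext i
  refine Fin.lastCases ?_ (fun i => ?_) i
  · simp [lift_last, flowScale]
  · simp only [Pi.smul_apply, lift_castSucc, flowPoint, smul_eq_mul]
    field_simp

theorem flowMatrix_neg_mulVec_lift {t : ℝ} (ht : flowScale Z g x t ≠ 0) :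
    flowMatrix Z g (-t) *ᵥ lift (flowPoint Z g x t) = (flowScale Z g x t)⁻¹ • lift x := by
  have h := congrArg (fun v => flowMatrix Z g (-t) *ᵥ v) (flowMatrix_mulVec_lift g x ht)
  simp only [Matrix.mulVec_mulVec, flowMatrix_neg_mul, Matrix.one_mulVec, Matrix.mulVec_smul] at h
  rw [h, smul_smul, inv_mul_cancel₀ ht, one_smul]

theorem coe_inv_expSL_mul (t : ℝ) : ((expSL Z hZ t * g)⁻¹ * g).1 = flowMatrix Z g (-t) := by
  rw [mul_inv_rev, expSL_inv]
  rfl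

/-- This relates the moving chart at the fixed coordinates `x` to the fixed chart at the flowing
point, so that the transformation laws express the values in the chart `exp(tZ) g` by those in `g`.
-/
theorem param_flowPoint {t : ℝ} (ht : 0 < flowScale Z g x t) :
    param g (flowPoint Z g x t) = param (expSL Z hZ t * g) x := by
  refine param_eq_of_mulVec (c := (flowScale Z g x t)⁻¹) (inv_pos.2 ht) ?_
  rw [coe_inv_expSL_mul, flowMatrix_neg_mulVec_lift g x ht.ne']

/-- The change of coordinates from `g` to `exp(tZ) g` undoes the flow and returns to `x`. Its
denominator there is the inverse of `flowScale`, which explains the factor `flowScale` in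
`flowJacInv`. -/
theorem jac_flowPoint {t : ℝ} (ht : 0 < flowScale Z g x t) :
    jac g (expSL Z hZ t * g) (flowPoint Z g x t) = flowJacInv Z g x t := by
  have h1 := flowMatrix_neg_mulVec_lift g x ht.ne'
  ext i j
  have hs : ((((expSL Z hZ t * g)⁻¹ * g).1) *ᵥ lift (flowPoint Z g x t)) (Fin.last n)
      = (flowScale Z g x t)⁻¹ := by
    rw [coe_inv_expSL_mul, h1]; simp [lift_last]
  have htr : transition g (expSL Z hZ t * g) (flowPoint Z g x t) i = x i := by
    rw [transition, hs, coe_inv_expSL_mul, h1]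
    simp only [Pi.smul_apply, lift_castSucc, smul_eq_mul]
    field_simp
  rw [jac_apply (by rw [hs]; exact inv_ne_zero ht.ne'), hs, htr, coe_inv_expSL_mul, flowJacInv,
    Matrix.of_apply, div_inv_eq_mul, mul_comm]

theorem hasDerivAt_flowPoint : HasDerivAt (flowPoint Z g x) (actionField Z g x) 0 := by
  refine hasDerivAt_pi.2 fun i => ?_
  have h := (hasDerivAt_flowMatrix_mulVec (Z := Z) g x i.castSucc).fun_div
    (hasDerivAt_flowMatrix_mulVec (Z := Z) g x (Fin.last n))
    (by simp [flowMatrix_zero, lift_last])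
  simp only [flowMatrix_zero, Matrix.one_mulVec, lift_last, lift_castSucc] at h
  refine HasDerivAt.congr_deriv h ?_
  change _ = (((g⁻¹).1 * Z * g.1) *ᵥ lift x) i.castSucc
    - x i * (((g⁻¹).1 * Z * g.1) *ᵥ lift x) (Fin.last n)
  ring

theorem flowPoint_zero : flowPoint Z g x 0 = x := by
  funext i
  simp [flowPoint, flowScale_zero, flowMatrix_zero, lift_castSucc]

theorem flowJacInv_zero : flowJacInv Z g x 0 = 1 := by
  ext i j
  simp [flowJacInv, flowScale_zero, flowMatrix_zero, Matrix.one_apply, (Fin.castSucc_lt_last j).ne']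

theorem hasDerivAt_flowJacInv (i j : Fin n) :
    HasDerivAt (fun t => flowJacInv Z g x t i j) (-fieldJac ((g⁻¹).1 * Z * g.1) x i j) 0 := by
  have h : ∀ i j, HasDerivAt (fun t => flowMatrix Z g (-t) i j) (-((g⁻¹).1 * Z * g.1) i j) 0 := by
    intro i j
    have := (hasDerivAt_flowMatrix (Z := Z) g i j).scomp_of_eq (0 : ℝ) (hasDerivAt_neg (0 : ℝ))
      (by simp)
    rw [neg_one_smul] at this
    exact this
  have h1 := (hasDerivAt_flowMatrix_mulVec (Z := Z) g x (Fin.last n)).fun_mul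
    ((h i.castSucc j.castSucc).fun_sub ((h (Fin.last n) j.castSucc).const_mul (x i)))
  simp only [flowJacInv, Matrix.of_apply]
  refine HasDerivAt.congr_deriv h1 ?_
  simp only [neg_zero, flowMatrix_zero, Matrix.one_mulVec, lift_last, Matrix.one_apply,
    Fin.castSucc_inj, (Fin.castSucc_lt_last j).ne', if_false, fieldJac]
  split_ifs <;> ring

theorem hasDerivAt_det_flowJacInv :
    HasDerivAt (fun t => (flowJacInv Z g x t).det) (-divField (actionField Z g) x) 0 := by
  have h := hasDerivAt_det (hasDerivAt_flowJacInv (Z := Z) g x)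
  refine HasDerivAt.congr_deriv h ?_
  rw [actionField, divField_chartField, flowJacInv_zero, ← Finset.sum_neg_distrib]
  refine Finset.sum_congr rfl fun i _ => ?_
  have := Matrix.det_updateRow_sum (1 : Matrix (Fin n) (Fin n) ℝ) i
    (fun j => -fieldJac ((g⁻¹).1 * Z * g.1) x i j)
  rw [Matrix.det_one, smul_eq_mul, mul_one] at this
  rw [← this]
  congr 2
  funext j
  simp [Matrix.one_apply]

/-- The determinant is 1 at `t = 0`, hence positive nearby: the absolute value can be dropped and
the complex power stays away from its branch cut. The minus sign in the derivative of the
determinant is compensated by the inverse. -/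
theorem hasDerivAt_jacPow_inv (s : ℂ) :
    HasDerivAt (fun t => (((|(flowJacInv Z g x t).det| : ℝ) : ℂ) ^ s)⁻¹)
      (s * (divField (actionField Z g) x : ℂ)) 0 := by
  have h := hasDerivAt_det_flowJacInv (Z := Z) g x
  have h1 : (flowJacInv Z g x 0).det = 1 := by simp [flowJacInv_zero]
  have hpos : ∀ᶠ t in nhds 0, 0 < (flowJacInv Z g x t).det :=
    h.continuousAt.eventually (lt_mem_nhds (by simp [h1]))
  have h2 : HasDerivAt (fun t => (((flowJacInv Z g x t).det : ℝ) : ℂ) ^ (-s))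
      (s * (divField (actionField Z g) x : ℂ)) 0 := by
    have hc := (hasDerivAt_id ((flowJacInv Z g x 0).det : ℂ)).cpow_const (c := -s)
      (by rw [h1]; simp)
    have := HasDerivAt.comp (h := fun t : ℝ => ((flowJacInv Z g x t).det : ℂ)) (0 : ℝ) hc
      h.ofReal_comp
    simpa [h1, Function.comp_def] using this
  refine h2.congr_of_eventuallyEq ?_
  filter_upwards [hpos] with t ht
  rw [abs_of_pos ht, Complex.cpow_neg]

/-- The Lie derivative of a density is its derivative along the one-parameter group. -/
theorem hasDerivAt_density {lam : ℂ} (φ : densities n lam) :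
    HasDerivAt (fun t => φ.1 (expSL Z hZ t * g) x)
      (lieDensity lam (actionField Z g) (φ.1 g) x) 0 := by
  have hφ := ((φ.2.1 g).differentiableAt_of_smooth x).hasFDerivAt
  have h1 : HasDerivAt (fun t => φ.1 g (flowPoint Z g x t)) _ 0 :=
    hφ.comp_hasDerivAt_of_eq 0 (hasDerivAt_flowPoint (Z := Z) g x) (flowPoint_zero g x).symm
  have h2 := (hasDerivAt_jacPow_inv (Z := Z) g x lam).fun_mul h1
  have h3 : fderiv ℝ (φ.1 g) x (actionField Z g x)
      = ∑ i, (actionField Z g x i : ℂ) * pd i (φ.1 g) x := by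
    rw [fderiv_eq_sum]; simp
  rw [flowPoint_zero, flowJacInv_zero, h3] at h2
  have h4 := h2.congr_of_eventuallyEq (f₁ := fun t => φ.1 (expSL Z hZ t * g) x) ?_
  · refine HasDerivAt.congr_deriv h4 ?_
    simp [lieDensity]
    ring
  -- For small `t` the transformation law between `g` and `exp(tZ) g` is solved for the value in the
  -- moving chart.
  · filter_upwards [eventually_flowScale_pos (Z := Z) g x] with t ht
    have h5 := φ.2.2 _ _ _ _ (param_flowPoint hZ g x ht)
    have h6 : jacPow lam g (expSL Z hZ t * g) (flowPoint Z g x t)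
      = ((|(flowJacInv Z g x t).det| : ℝ) : ℂ) ^ lam := by rw [jacPow, jac_flowPoint hZ g x ht]
    have h7 : ((|(flowJacInv Z g x t).det| : ℝ) : ℂ) ^ lam ≠ 0 := by
      rw [← jac_flowPoint hZ g x ht]
      exact jacPow_ne_zero lam (param_flowPoint hZ g x ht)
    rw [h5, h6, inv_mul_cancel_left₀ h7]

/-- The Lie derivative of a symbol is its derivative along the one-parameter group. -/
theorem hasDerivAt_symbol {δ : ℂ} (P : symbols n δ) (ξ : Fin n → ℝ) :
    HasDerivAt (fun t => P.1 (expSL Z hZ t * g) x ξ)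
      (lieSymbol δ (actionField Z g) (P.1 g) x ξ) 0 := by
  have hP := ((P.2.1 g).differentiableAt_of_smooth (x, ξ)).hasFDerivAt
  set L := fderiv ℝ (fun z : (Fin n → ℝ) × (Fin n → ℝ) => P.1 g z.1 z.2) (x, ξ) with hL
  -- A covector with fixed coordinates `ξ` in the moving chart has coordinates `Jᵀ ξ` in `g`, where
  -- `J` is the inverse Jacobian matrix of the flow. This produces the fibre derivative term of
  -- `lieSymbol`.
  have hξ : HasDerivAt (fun t => (flowJacInv Z g x t)ᵀ *ᵥ ξ)
      (fun i => ∑ j, -fieldJac ((g⁻¹).1 * Z * g.1) x j i * ξ j) 0 := by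
    refine hasDerivAt_pi.2 fun i => ?_
    simp only [Matrix.mulVec, dotProduct, Matrix.transpose_apply]
    exact HasDerivAt.fun_sum fun j _ => (hasDerivAt_flowJacInv g x j i).mul_const _
  have h1 : HasDerivAt (fun t => P.1 g (flowPoint Z g x t) ((flowJacInv Z g x t)ᵀ *ᵥ ξ)) _ 0 :=
    hP.comp_hasDerivAt_of_eq 0 ((hasDerivAt_flowPoint (Z := Z) g x).prodMk hξ)
      (by simp [flowPoint_zero, flowJacInv_zero])
  have h2 := (hasDerivAt_jacPow_inv (Z := Z) g x δ).fun_mul h1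
  have hLx : ∀ i, L (Pi.single i 1, 0) = pd i (fun y => P.1 g y ξ) x := by
    intro i
    have := HasFDerivAt.comp (f := fun y : Fin n → ℝ => (y, ξ)) x hP
      ((hasFDerivAt_id x).prodMk (hasFDerivAt_const ξ x))
    rw [pd_eq_of_hasFDerivAt (f := fun y => P.1 g y ξ) this]
    simp
  have hLξ : ∀ i, L (0, Pi.single i 1) = pd i (P.1 g x) ξ := by
    intro i
    have := HasFDerivAt.comp (f := fun η : Fin n → ℝ => (x, η)) ξ hP
      ((hasFDerivAt_const x ξ).prodMk (hasFDerivAt_id ξ))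
    rw [pd_eq_of_hasFDerivAt (f := P.1 g x) this]
    simp
  have hLsum : ∀ u v : Fin n → ℝ, L (u, v) = ∑ i, (u i : ℂ) * pd i (fun y => P.1 g y ξ) x
      + ∑ i, (v i : ℂ) * pd i (P.1 g x) ξ := by
    intro u v
    have hu : u = ∑ i, u i • (Pi.single i 1 : Fin n → ℝ) := by
      funext j; simp [Finset.sum_apply, Pi.single_apply]
    have hv : v = ∑ i, v i • (Pi.single i 1 : Fin n → ℝ) := by
      funext j; simp [Finset.sum_apply, Pi.single_apply]
    have e1 : L (u, 0) = ∑ i, (u i : ℂ) * pd i (fun y => P.1 g y ξ) x := by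
      have : (u, (0 : Fin n → ℝ)) = ∑ i, u i • ((Pi.single i 1 : Fin n → ℝ), (0 : Fin n → ℝ)) := by
        ext1
        · simpa [Prod.fst_sum] using hu
        · simp [Prod.snd_sum]
      rw [this, map_sum]
      simp [hLx, -Prod.smul_mk]
    have e2 : L (0, v) = ∑ i, (v i : ℂ) * pd i (P.1 g x) ξ := by
      have : ((0 : Fin n → ℝ), v) = ∑ i, v i • ((0 : Fin n → ℝ), (Pi.single i 1 : Fin n → ℝ)) := by
        ext1
        · simp [Prod.fst_sum]
        · simpa [Prod.snd_sum] using hv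
      rw [this, map_sum]
      simp [hLξ, -Prod.smul_mk]
    rw [← e1, ← e2, ← map_add]
    simp
  rw [flowPoint_zero, flowJacInv_zero, hLsum] at h2
  have h4 := h2.congr_of_eventuallyEq (f₁ := fun t => P.1 (expSL Z hZ t * g) x ξ) ?_
  · refine HasDerivAt.congr_deriv h4 ?_
    have h5 : ∑ i, ((∑ j, -fieldJac ((g⁻¹).1 * Z * g.1) x j i * ξ j : ℝ) : ℂ) * pd i (P.1 g x) ξ
        = -∑ i, ∑ j, ((ξ j * pd i (fun y => actionField Z g y j) x : ℝ) : ℂ)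
            * pd i (P.1 g x) ξ := by
      rw [← Finset.sum_neg_distrib]
      refine Finset.sum_congr rfl fun i _ => ?_
      rw [← Finset.sum_mul, ← Complex.ofReal_sum, ← neg_mul, ← Complex.ofReal_neg,
        ← Finset.sum_neg_distrib]
      congr 2
      refine Finset.sum_congr rfl fun j _ => ?_
      rw [actionField, pd_chartField]
      ring
    rw [h5]
    simp [lieSymbol]
    ring
  · filter_upwards [eventually_flowScale_pos (Z := Z) g x] with t ht
    have h5 := P.2.2.2 _ _ _ _ (param_flowPoint hZ g x ht) ξ
    have h6 : jacPow δ g (expSL Z hZ t * g) (flowPoint Z g x t)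
      = ((|(flowJacInv Z g x t).det| : ℝ) : ℂ) ^ δ := by rw [jacPow, jac_flowPoint hZ g x ht]
    have h7 : ((|(flowJacInv Z g x t).det| : ℝ) : ℂ) ^ δ ≠ 0 := by
      rw [← jac_flowPoint hZ g x ht]
      exact jacPow_ne_zero δ (param_flowPoint hZ g x ht)
    rw [← jac_flowPoint hZ g x ht, h5, jac_flowPoint hZ g x ht, h6, inv_mul_cancel_left₀ h7]

end Curve

/-- A matrix acts on rays like its traceless part. -/
theorem exists_traceless (Z : Matrix (Fin (n + 1)) (Fin (n + 1)) ℝ) :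
    ∃ Z' : Matrix (Fin (n + 1)) (Fin (n + 1)) ℝ, Z'.trace = 0 ∧
      ∀ g : SL n, actionField Z' g = actionField Z g := by
  refine ⟨Z + (-(Z.trace / (n + 1))) • 1, ?_, fun g => ?_⟩
  · have : (n + 1 : ℝ) ≠ 0 := by positivity
    simp
    field_simp
    ring
  · have h2 : (g⁻¹).1 * g.1 = 1 := by rw [← Matrix.SpecialLinearGroup.coe_mul]; simp
    funext x
    simp only [actionField]
    rw [mul_add, add_mul, Matrix.mul_smul, Matrix.smul_mul, mul_one, h2, chartField_add,
      chartField_smul, chartField_one]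
    simp

/-- The point is the transformation law of the Lie derivative. In two overlapping charts it is the
derivative at `t = 0` of `φ` along `exp(tZ) g` and `exp(tZ) h`, and these curves differ by the
constant factor `jacPow lam g h x`. -/
theorem exists_isLieDensity {lam : ℂ} (Z : Matrix (Fin (n + 1)) (Fin (n + 1)) ℝ)
    (φ : densities n lam) : ∃ φ', IsLieDensity Z φ φ' := by
  obtain ⟨Z', hZ', hZZ'⟩ := exists_traceless Z
  refine ⟨⟨fun g => lieDensity lam (actionField Z' g) (φ.1 g), fun g =>
    contDiff_lieDensity lam _ (φ.2.1 g), fun g h x y e => ?_⟩, fun g x => by rw [← hZZ' g]⟩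
  have h1 := hasDerivAt_density hZ' g x φ
  have h2 := (hasDerivAt_density hZ' h y φ).const_mul (jacPow lam g h x)
  have h3 : (fun t => φ.1 (expSL Z' hZ' t * g) x)
      = fun t => jacPow lam g h x * φ.1 (expSL Z' hZ' t * h) y := by
    funext t
    rw [φ.2.2 _ _ _ _ (param_mul (k := expSL Z' hZ' t) e), jacPow_mul]
  rw [h3] at h1
  exact h1.unique h2

/-! ### Quadratic symbols -/

/-- The quadratic form `a^{ij}(x) ξ_i ξ_j`. -/
def quadForm (a : (Fin n → ℝ) → Fin n → Fin n → ℂ) (x ξ : Fin n → ℝ) : ℂ :=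
  ∑ i, ∑ j, a x i j * (ξ i * ξ j)

theorem pd_quadForm (a : (Fin n → ℝ) → Fin n → Fin n → ℂ) (x ξ : Fin n → ℝ) (k : Fin n) :
    pd k (quadForm a x) ξ = ∑ j, (a x k j + a x j k) * ξ j := by
  have hc : ∀ i, DifferentiableAt ℝ (fun ξ : Fin n → ℝ => (ξ i : ℂ)) ξ := fun i =>
    (contDiff_ofReal (contDiff_apply ℝ ℝ i)).differentiableAt_of_smooth ξ
  have hpc : ∀ i, pd k (fun ξ : Fin n → ℝ => (ξ i : ℂ)) ξ = if i = k then 1 else 0 := fun i => by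
    rw [pd_ofReal (by fun_prop), pd_coord, ofReal_ite_one_zero]
  have h1 := fun i j => (differentiableAt_const (a x i j)).fun_mul ((hc i).fun_mul (hc j))
  unfold quadForm
  rw [pd_sum _ fun i => DifferentiableAt.fun_sum fun j _ => h1 i j]
  simp only [pd_sum _ (h1 _), pd_const_mul _ ((hc _).fun_mul (hc _)), pd_mul (hc _) (hc _), hpc]
  simp only [mul_ite, ite_mul, mul_one, one_mul, mul_zero, zero_mul, mul_add, add_mul,
    Finset.sum_add_distrib, Finset.sum_ite_eq', Finset.mem_univ, if_true]
  rw [add_comm]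
  congr 1
  rw [Finset.sum_comm]
  simp

theorem contDiff_entry {a : (Fin n → ℝ) → Fin n → Fin n → ℂ} (ha : ContDiff ℝ ∞ a) (i j : Fin n) :
    ContDiff ℝ ∞ fun y => a y i j :=
  contDiff_pi.1 (contDiff_pi.1 ha i) j

theorem pd_entry {a : (Fin n → ℝ) → Fin n → Fin n → ℂ} (ha : ContDiff ℝ ∞ a) (k i j : Fin n)
    (x : Fin n → ℝ) : pd k a x i j = pd k (fun y => a y i j) x := by
  have h := ha.differentiableAt_of_smooth x
  rw [pd_pi h, pd_pi (differentiableAt_pi.1 h i)]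

/-- Only first derivatives of the field enter the Lie derivative of a symbol, hence `ν = 0`. This
places quadratic symbols within the general Casimir computation. -/
theorem lieSymbol_quadForm (δ : ℂ) (Y : Matrix (Fin (n + 1)) (Fin (n + 1)) ℝ)
    {a : (Fin n → ℝ) → Fin n → Fin n → ℂ} (ha : ContDiff ℝ ∞ a) (x ξ : Fin n → ℝ) :
    lieSymbol δ (chartField Y) (quadForm a) x ξ
      = quadForm (lieSection (rhoTwo δ) 0 Y a) x ξ := by
  have hdiv : (divField (chartField Y) x : ℂ) = ∑ p, (fieldJac Y x p p : ℂ) := by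
    rw [divField_chartField]; push_cast; rfl
  have hs2 : ∀ i j, lieSection (rhoTwo δ) 0 Y a x i j
      = ∑ k, (chartField Y x k : ℂ) * pd k (fun y => a y i j) x
        - (∑ k, (fieldJac Y x i k : ℂ) * a x k j + ∑ k, (fieldJac Y x j k : ℂ) * a x i k
          - δ * (divField (chartField Y) x : ℂ) * a x i j) := by
    intro i j
    rw [hdiv, lieSection]
    simp [Finset.sum_apply, rhoTwo_apply, pd_entry ha]
  have h1 : ∀ k, pd k (fun y => quadForm a y ξ) x
      = ∑ i, ∑ j, pd k (fun y => a y i j) x * (ξ i * ξ j) := by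
    intro k
    have hd := fun i j => ((contDiff_entry ha i j).differentiableAt_of_smooth x).fun_mul
      (differentiableAt_const ((ξ i : ℂ) * ξ j))
    unfold quadForm
    rw [pd_sum _ fun i => DifferentiableAt.fun_sum fun j _ => hd i j]
    refine Finset.sum_congr rfl fun i _ => ?_
    rw [pd_sum _ (hd i)]
    refine Finset.sum_congr rfl fun j _ => ?_
    rw [pd_mul ((contDiff_entry ha i j).differentiableAt_of_smooth x) (differentiableAt_const _)]
    simp
  unfold lieSymbol
  simp only [h1, pd_quadForm, pd_chartField]
  unfold quadForm
  simp only [hs2]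
  generalize (divField (chartField Y) x : ℂ) = d
  generalize chartField Y x = V
  generalize fieldJac Y x = J
  have e1 : ∑ k, (V k : ℂ) * ∑ i, ∑ j, pd k (fun y => a y i j) x * (ξ i * ξ j)
      = ∑ i, ∑ j, (∑ k, (V k : ℂ) * pd k (fun y => a y i j) x) * (ξ i * ξ j) := by
    simp only [Finset.mul_sum, Finset.sum_mul]
    rw [Finset.sum_comm]
    refine Finset.sum_congr rfl fun i _ => ?_
    rw [Finset.sum_comm]
    exact Finset.sum_congr rfl fun j _ => Finset.sum_congr rfl fun k _ => by ring
  have e2 : ∑ i, ∑ j, (∑ k, (J i k : ℂ) * a x k j) * (ξ i * ξ j)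
      = ∑ i, ∑ j, ((ξ j * J j i : ℝ) : ℂ) * ∑ l, a x i l * ξ l := by
    simp only [Finset.mul_sum, Finset.sum_mul]
    rw [Finset.sum_congr rfl fun i _ => Finset.sum_comm, Finset.sum_comm]
    refine Finset.sum_congr rfl fun i _ => Finset.sum_congr rfl fun j _ =>
      Finset.sum_congr rfl fun k _ => ?_
    push_cast; ring
  have e3 : ∑ i, ∑ j, (∑ k, (J j k : ℂ) * a x i k) * (ξ i * ξ j)
      = ∑ i, ∑ j, ((ξ j * J j i : ℝ) : ℂ) * ∑ l, a x l i * ξ l := by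
    simp only [Finset.mul_sum, Finset.sum_mul]
    rw [Finset.sum_congr rfl fun i _ => Finset.sum_comm, Finset.sum_comm]
    refine Finset.sum_congr rfl fun i _ => ?_
    rw [Finset.sum_comm]
    refine Finset.sum_congr rfl fun j _ => Finset.sum_congr rfl fun k _ => ?_
    push_cast; ring
  have e4 : ∑ i, ∑ j, δ * d * a x i j * (ξ i * ξ j)
      = δ * d * ∑ i, ∑ j, a x i j * (ξ i * ξ j) := by
    simp only [Finset.mul_sum, mul_assoc]
  simp only [add_mul, sub_mul, mul_add, Finset.sum_add_distrib, Finset.sum_sub_distrib]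
  linear_combination e1 + e2 + e3 - e4

/-- The transformation law is obtained by differentiating along the one-parameter group, as for
densities. The quadratic coefficients are recorded as well, so that the lemma can be applied to its
own result. -/
theorem exists_isLieSymbol_quadForm {δ : ℂ} (Z : Matrix (Fin (n + 1)) (Fin (n + 1)) ℝ)
    {P : symbols n δ} {a : SL n → (Fin n → ℝ) → Fin n → Fin n → ℂ}
    (ha : ∀ g, ContDiff ℝ ∞ (a g)) (hP : ∀ g, P.1 g = quadForm (a g)) :
    ∃ P' : symbols n δ, IsLieSymbol Z P P' ∧
      ∀ g, P'.1 g = quadForm (lieSection (rhoTwo δ) 0 ((g⁻¹).1 * Z * g.1) (a g)) := by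
  obtain ⟨Z', hZ', hZZ'⟩ := exists_traceless Z
  have key : ∀ g, lieSymbol δ (actionField Z g) (P.1 g)
      = quadForm (lieSection (rhoTwo δ) 0 ((g⁻¹).1 * Z * g.1) (a g)) := by
    intro g
    rw [hP g]
    funext x ξ
    exact lieSymbol_quadForm δ _ (ha g) x ξ
  have hsm : ∀ g, ContDiff ℝ ∞ (lieSection (rhoTwo δ) 0 ((g⁻¹).1 * Z * g.1) (a g)) := fun g =>
    contDiff_lieSection _ _ _ (ha g)
  refine ⟨⟨fun g => lieSymbol δ (actionField Z g) (P.1 g), fun g => ?_, ⟨2, fun g x => ?_⟩,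
    fun g h x y e η => ?_⟩, fun g x ξ => rfl, key⟩
  · change ContDiff ℝ ∞ fun z : (Fin n → ℝ) × (Fin n → ℝ) =>
      lieSymbol δ (actionField Z g) (P.1 g) z.1 z.2
    rw [key]
    unfold quadForm
    refine ContDiff.sum fun i _ => ContDiff.sum fun j _ => ?_
    exact ((contDiff_entry (hsm g) i j).comp contDiff_fst).mul
      (((contDiff_ofReal (contDiff_apply ℝ ℝ i)).comp contDiff_snd).mul
        ((contDiff_ofReal (contDiff_apply ℝ ℝ j)).comp contDiff_snd))
  · refine ⟨∑ i, ∑ j, MvPolynomial.C (lieSection (rhoTwo δ) 0 ((g⁻¹).1 * Z * g.1) (a g) x i j) *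
      MvPolynomial.X i * MvPolynomial.X j, ?_, fun ξ => ?_⟩
    · refine MvPolynomial.totalDegree_finsetSum_le fun i _ =>
        MvPolynomial.totalDegree_finsetSum_le fun j _ => ?_
      refine (MvPolynomial.totalDegree_mul _ _).trans ?_
      refine (Nat.add_le_add_right (MvPolynomial.totalDegree_mul _ _) _).trans ?_
      rw [MvPolynomial.totalDegree_C, MvPolynomial.totalDegree_X, MvPolynomial.totalDegree_X]
    · change lieSymbol δ (actionField Z g) (P.1 g) x ξ = _
      rw [key]
      simp only [quadForm, map_sum, map_mul, MvPolynomial.eval_C, MvPolynomial.eval_X, mul_assoc]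
  · change lieSymbol δ (actionField Z g) (P.1 g) x _
      = jacPow δ g h x * lieSymbol δ (actionField Z h) (P.1 h) y η
    rw [← hZZ', ← hZZ']
    have h1 := hasDerivAt_symbol hZ' g x P ((jac g h x)ᵀ *ᵥ η)
    have h2 := (hasDerivAt_symbol hZ' h y P η).const_mul (jacPow δ g h x)
    have h3 : (fun t => P.1 (expSL Z' hZ' t * g) x ((jac g h x)ᵀ *ᵥ η))
        = fun t => jacPow δ g h x * P.1 (expSL Z' hZ' t * h) y η := by
      funext t
      have := P.2.2.2 _ _ _ _ (param_mul (k := expSL Z' hZ' t) e) η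
      rw [jacPow_mul, jac_mul] at this
      exact this
    rw [h3] at h1
    exact h1.unique h2

end Flow

/-! ### The round metric in affine coordinates -/

section Geometry

variable {n : ℕ} (g : SL n) (x : Fin n → ℝ)

/-- The constant vector `∂_i (g (x,1))`. -/
def rayDir (i : Fin n) : EuclideanSpace ℝ (Fin (n + 1)) :=
  WithLp.toLp 2 (g.1 *ᵥ (Fin.snoc (α := fun _ => ℝ) (Pi.single i 1) 0 : Fin (n + 1) → ℝ))

theorem pd_ray (i : Fin n) : pd i (ray g) x = rayDir g i := by
  rw [pd, fderiv_ray, rayDir]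

/-- The squared norm of the vector `g (x,1)`. -/
def raySq : ℝ := inner ℝ (ray g x) (ray g x)

/-- The one-form `-d log ‖g (x,1)‖`, which describes the projectively flat connection. -/
def psi (i : Fin n) : ℝ := -(inner ℝ (ray g x) (rayDir g i)) / raySq g x

theorem raySq_pos : 0 < raySq g x := real_inner_self_pos.2 (ray_ne_zero g x)

theorem contDiff_raySq : ContDiff ℝ ∞ (raySq g) := (contDiff_ray g).inner ℝ (contDiff_ray g)

theorem pd_inner_ray (i k : Fin n) :
    pd k (fun y => inner ℝ (ray g y) (rayDir g i)) x = inner ℝ (rayDir g k) (rayDir g i) := by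
  have h := ((contDiff_ray g).differentiableAt_of_smooth x).hasFDerivAt
  rw [pd_eq_of_hasFDerivAt (h.inner ℝ (hasFDerivAt_const (rayDir g i) x)), ← pd_ray g x k]
  simp [pd]

theorem pd_raySq (k : Fin n) : pd k (raySq g) x = 2 * inner ℝ (ray g x) (rayDir g k) := by
  have h := ((contDiff_ray g).differentiableAt_of_smooth x).hasFDerivAt
  have h1 : pd k (raySq g) x = _ := pd_eq_of_hasFDerivAt (h.inner ℝ h) k
  rw [h1, ← pd_ray g x k]
  simp [pd, real_inner_comm]
  ring

theorem contDiff_psi (i : Fin n) : ContDiff ℝ ∞ fun y => psi g y i :=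
  ((contDiff_ray g).inner ℝ contDiff_const).neg.div (contDiff_raySq g) fun y => (raySq_pos g y).ne'

theorem inner_param_self : inner ℝ (param g x) (param g x) = (1 : ℝ) := by
  rw [real_inner_self_eq_norm_sq, param, norm_smul, norm_inv, norm_norm,
    inv_mul_cancel₀ (norm_ne_zero_iff.2 (ray_ne_zero g x)), one_pow]

theorem inner_param_pd (i : Fin n) : inner ℝ (param g x) (pd i (param g) x) = (0 : ℝ) := by
  have h := ((contDiff_param g).differentiableAt_of_smooth x).hasFDerivAt
  have h1 := pd_eq_of_hasFDerivAt (h.inner ℝ h) i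
  rw [funext (inner_param_self g)] at h1
  simp only [pd_const] at h1
  have h2 : (0 : ℝ) = inner ℝ (param g x) (pd i (param g) x)
      + inner ℝ (pd i (param g) x) (param g x) := by simpa [pd] using h1
  rw [real_inner_comm (param g x)] at h2
  linarith

/-- The vector `∂_i ray` splits orthogonally into its tangential part `‖ray‖ ∂_i param` and its
radial part `(∂_i ‖ray‖) param`, and `ψ_i = -∂_i ‖ray‖ / ‖ray‖`. Taking inner products of these
splittings isolates the metric. -/
theorem metric_eq (i j : Fin n) :
    metric g x i j = inner ℝ (rayDir g i) (rayDir g j) / raySq g x - psi g x i * psi g x j := by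
  have hN := raySq_pos g x
  have hne : ‖ray g x‖ ≠ 0 := norm_ne_zero_iff.2 (ray_ne_zero g x)
  have hρ : DifferentiableAt ℝ (fun y => ‖ray g y‖) x :=
    ((contDiff_ray g).norm ℝ (ray_ne_zero g)).differentiableAt_of_smooth x
  have hp := (contDiff_param g).differentiableAt_of_smooth x
  have e : ray g = fun y => ‖ray g y‖ • param g y := by
    funext y
    rw [param, smul_smul, mul_inv_cancel₀ (norm_ne_zero_iff.2 (ray_ne_zero g y)), one_smul]
  have hr : ∀ i, rayDir g i = ‖ray g x‖ • pd i (param g) x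
      + pd i (fun y => ‖ray g y‖) x • param g x := by
    intro i
    rw [← pd_ray g x i]
    conv_lhs => rw [e]
    exact pd_smul hρ hp i
  have hx : ray g x = ‖ray g x‖ • param g x := congrFun e x
  have hN2 : raySq g x = ‖ray g x‖ ^ 2 := real_inner_self_eq_norm_sq _
  have hcomm : ∀ i, inner ℝ (pd i (param g) x) (param g x) = (0 : ℝ) := fun i => by
    rw [real_inner_comm, inner_param_pd]
  have hs : ∀ i, inner ℝ (ray g x) (rayDir g i) = ‖ray g x‖ * pd i (fun y => ‖ray g y‖) x := by
    intro i
    conv_lhs => rw [hx, hr]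
    rw [real_inner_smul_left, inner_add_right, real_inner_smul_right, real_inner_smul_right,
      inner_param_pd, inner_param_self]
    ring
  have hG : inner ℝ (rayDir g i) (rayDir g j) = ‖ray g x‖ ^ 2 * metric g x i j
      + pd i (fun y => ‖ray g y‖) x * pd j (fun y => ‖ray g y‖) x := by
    rw [hr, hr]
    simp only [inner_add_left, inner_add_right, real_inner_smul_left, real_inner_smul_right,
      inner_param_pd, inner_param_self, hcomm, metric, Matrix.of_apply]
    ring
  rw [psi, psi, hs, hs, hG, hN2]
  field_simp
  ring

/-- The product `raySq * ψ_i` is minus the inner product of the affine function `ray` with a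
constant vector, so its derivatives are constants. With `pd_metric`, this closes the calculus:
derivatives of `ψ` and of the metric are polynomials in `ψ` and the metric. -/
theorem pd_psi (i k : Fin n) :
    pd k (fun y => psi g y i) x = psi g x i * psi g x k - metric g x i k := by
  have hN := (raySq_pos g x).ne'
  have hNd := (contDiff_raySq g).differentiableAt_of_smooth x
  have hs : DifferentiableAt ℝ (fun y => inner ℝ (ray g y) (rayDir g i)) x :=
    (((contDiff_ray g).inner ℝ contDiff_const).differentiableAt_of_smooth x)
  have h1 := ((contDiff_psi g i).differentiableAt_of_smooth x)
  have h2 : pd k (fun y => raySq g y * psi g y i) x = -inner ℝ (rayDir g k) (rayDir g i) := by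
    have : (fun y => raySq g y * psi g y i) = fun y => -inner ℝ (ray g y) (rayDir g i) := by
      funext y
      rw [psi, mul_div_cancel₀ _ (raySq_pos g y).ne']
    rw [this, pd_neg, pd_inner_ray]
  have h4 : inner ℝ (ray g x) (rayDir g k) = -(raySq g x * psi g x k) := by
    rw [psi]; field_simp
  rw [pd_mul hNd h1, pd_raySq, h4] at h2
  rw [metric_eq, real_inner_comm]
  field_simp
  linear_combination h2

theorem metric_symm (i j : Fin n) : metric g x i j = metric g x j i := by
  simp [metric, real_inner_comm]

theorem isUnit_det_metric : IsUnit (metric g x).det :=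
  isUnit_iff_ne_zero.2 (metric_posDef g x).det_pos.ne'

theorem metric_inv_symm (i j : Fin n) : (metric g x)⁻¹ i j = (metric g x)⁻¹ j i := by
  have h : (metric g x)ᵀ = metric g x := by
    ext i j; exact metric_symm g x j i
  conv_lhs => rw [← h, ← Matrix.transpose_nonsing_inv]
  rfl

theorem metric_inv_mul (i k : Fin n) :
    ∑ j, (metric g x)⁻¹ i j * metric g x j k = if i = k then 1 else 0 := by
  rw [← Matrix.mul_apply, Matrix.nonsing_inv_mul _ (isUnit_det_metric g x), Matrix.one_apply]

/-- By `metric_eq`, `raySq * (g_{ij} + ψ_i ψ_j)` is the constant Gram matrix of the vectors `∂_i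
ray`; differentiating it determines `∂_k g_{ij}`. -/
theorem pd_metric (i j k : Fin n) :
    pd k (fun y => metric g y i j) x = 2 * psi g x k * metric g x i j
      + psi g x i * metric g x j k + psi g x j * metric g x i k := by
  have hN := (raySq_pos g x).ne'
  have hNd := (contDiff_raySq g).differentiableAt_of_smooth x
  have h1 := fun i => ((contDiff_psi g i).differentiableAt_of_smooth x)
  have h2 := (contDiff_metric g i j).differentiableAt_of_smooth x
  have h3 : pd k (fun y => raySq g y * (metric g y i j + psi g y i * psi g y j)) x = 0 := by
    have : (fun y => raySq g y * (metric g y i j + psi g y i * psi g y j))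
        = fun y => inner ℝ (rayDir g i) (rayDir g j) := by
      funext y
      have := (raySq_pos g y).ne'
      rw [metric_eq]
      field_simp
      ring
    rw [this, pd_const]
  have h4 : inner ℝ (ray g x) (rayDir g k) = -(raySq g x * psi g x k) := by
    rw [psi]; field_simp
  rw [pd_mul hNd (h2.fun_add ((h1 i).fun_mul (h1 j))), pd_add h2 ((h1 i).fun_mul (h1 j)),
    pd_mul (h1 i) (h1 j), pd_psi, pd_psi, pd_raySq, h4] at h3
  have h5 : raySq g x * (pd k (fun y => metric g y i j) x - (2 * psi g x k * metric g x i j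
      + psi g x i * metric g x j k + psi g x j * metric g x i k)) = 0 := by
    linear_combination h3
  rcases mul_eq_zero.1 h5 with h | h
  · exact absurd h hN
  · linarith

/-- Affine charts are central projections, so geodesics are straight lines up to parametrization.
Accordingly the Christoffel symbols are of pure trace type, given by the one-form `ψ`. -/
theorem christoffel_eq (k i j : Fin n) :
    christoffel g k i j x = (if k = j then psi g x i else 0) + if k = i then psi g x j else 0 := by
  have h : ∀ l, (metric g x)⁻¹ k l *
      (pd i (fun y => metric g y j l) x + pd j (fun y => metric g y i l) x
        - pd l (fun y => metric g y i j) x)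
      = 2 * psi g x i * ((metric g x)⁻¹ k l * metric g x l j)
        + 2 * psi g x j * ((metric g x)⁻¹ k l * metric g x l i) := by
    intro l
    rw [pd_metric, pd_metric, pd_metric, metric_symm g x l j, metric_symm g x l i,
      metric_symm g x j i]
    ring
  rw [christoffel, Finset.sum_congr rfl fun l _ => h l, Finset.sum_add_distrib, ← Finset.mul_sum,
    ← Finset.mul_sum, metric_inv_mul, metric_inv_mul]
  split_ifs <;> ring

/-- The vector field metrically dual to `psi`. -/
def psiDual (i : Fin n) : ℝ := ∑ p, (metric g x)⁻¹ i p * psi g x p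

/-- Differentiate `g⁻¹ g = 1` and multiply by `g⁻¹` on the right. -/
theorem pd_metric_inv (i j k : Fin n) :
    pd k (fun y => (metric g y)⁻¹ i j) x = -2 * psi g x k * (metric g x)⁻¹ i j
      - (if j = k then psiDual g x i else 0) - if i = k then psiDual g x j else 0 := by
  have h1 : ∀ q, ∑ p, pd k (fun y => (metric g y)⁻¹ i p) x * metric g x p q
      = -∑ p, (metric g x)⁻¹ i p * pd k (fun y => metric g y p q) x := by
    intro q
    have hd := fun p => (contDiff_metric_inv g i p).differentiableAt_of_smooth x
    have hm := fun p => (contDiff_metric g p q).differentiableAt_of_smooth x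
    have h2 : pd k (fun y => ∑ p, (metric g y)⁻¹ i p * metric g y p q) x = 0 := by
      simp only [metric_inv_mul, pd_const]
    rw [pd_sum _ fun p => (hd p).fun_mul (hm p)] at h2
    simp only [pd_mul (hd _) (hm _), Finset.sum_add_distrib] at h2
    linarith
  have h3 : ∀ q, ∑ p, (metric g x)⁻¹ i p * pd k (fun y => metric g y p q) x
      = (2 * psi g x k * if i = q then 1 else 0) + psiDual g x i * metric g x q k
        + psi g x q * if i = k then 1 else 0 := by
    intro q
    simp only [pd_metric, mul_add, Finset.sum_add_distrib]
    rw [← metric_inv_mul g x i q, ← metric_inv_mul g x i k, psiDual, Finset.mul_sum,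
      Finset.sum_mul, Finset.mul_sum]
    congr 1
    · congr 1 <;> exact Finset.sum_congr rfl fun p _ => by ring
    · exact Finset.sum_congr rfl fun p _ => by ring
  have h4 : pd k (fun y => (metric g y)⁻¹ i j) x
      = ∑ q, (∑ p, pd k (fun y => (metric g y)⁻¹ i p) x * metric g x p q)
        * (metric g x)⁻¹ q j := by
    have : ∀ p, ∑ q, metric g x p q * (metric g x)⁻¹ q j = if p = j then 1 else 0 := by
      intro p
      rw [← Matrix.mul_apply, Matrix.mul_nonsing_inv _ (isUnit_det_metric g x), Matrix.one_apply]
    simp only [Finset.sum_mul, mul_assoc]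
    rw [Finset.sum_comm]
    simp only [← Finset.mul_sum, this]
    simp
  have h5 : ∑ q, metric g x q k * (metric g x)⁻¹ q j = if j = k then 1 else 0 := by
    rw [← metric_inv_mul]
    refine Finset.sum_congr rfl fun q _ => ?_
    rw [metric_inv_symm g x q j, mul_comm]
  have h6 : ∑ q, psi g x q * (metric g x)⁻¹ q j = psiDual g x j := by
    rw [psiDual]
    refine Finset.sum_congr rfl fun q _ => ?_
    rw [metric_inv_symm g x q j, mul_comm]
  rw [h4]
  simp only [h1, h3, neg_mul, add_mul, Finset.sum_neg_distrib, Finset.sum_add_distrib]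
  have h7 : ∑ q, psiDual g x i * metric g x q k * (metric g x)⁻¹ q j
      = psiDual g x i * if j = k then 1 else 0 := by
    rw [← h5, Finset.mul_sum]
    exact Finset.sum_congr rfl fun p _ => by ring
  have h8 : ∑ q, psi g x q * (if i = k then 1 else 0) * (metric g x)⁻¹ q j
      = psiDual g x j * if i = k then 1 else 0 := by
    rw [← h6, Finset.sum_mul]
    exact Finset.sum_congr rfl fun p _ => by ring
  have h9 : ∑ q, (2 * psi g x k * if i = q then 1 else 0) * (metric g x)⁻¹ q j
      = 2 * psi g x k * (metric g x)⁻¹ i j := by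
    simp
  rw [h7, h8, h9]
  split_ifs <;> ring

/-- By Jacobi's formula each row is replaced by three terms from `pd_metric`. The term `2ψ_k M_i`
contributes `2nψ_k det M`; the term `ψ_i M_k` repeats a row unless `i = k` and contributes `ψ_k det
M`; the term `M_{ik} ψ` contributes the same. -/
theorem pd_det_metric (k : Fin n) :
    pd k (fun y => (metric g y).det) x = 2 * (n + 1) * psi g x k * (metric g x).det := by
  rw [pd_det (contDiff_metric g)]
  set M := metric g x with hM
  have h1 : ∀ i, (fun j => pd k (fun y => metric g y i j) x)
      = (2 * psi g x k) • M i + (psi g x i • M k + M i k • psi g x) := by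
    intro i
    funext j
    simp only [pd_metric, Pi.add_apply, Pi.smul_apply, smul_eq_mul, hM]
    rw [metric_symm g x j k]
    ring
  have h2 : ∀ i, (M.updateRow i (M k)).det = if i = k then M.det else 0 := by
    intro i
    split_ifs with h
    · subst h; rw [Matrix.updateRow_eq_self]
    · exact Matrix.det_zero_of_row_eq h (by simp [Matrix.updateRow_ne (Ne.symm h)])
  -- This is Cramer's rule for `Mᵀ`.
  have h3 : ∑ i, M i k * (M.updateRow i (psi g x)).det = M.det * psi g x k := by
    have h4 := congrFun (Matrix.mulVec_cramer Mᵀ (psi g x)) k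
    simpa [Matrix.mulVec, dotProduct, Matrix.cramer_transpose_apply] using h4
  simp only [h1, Matrix.det_updateRow_add, Matrix.det_updateRow_smul, Matrix.updateRow_eq_self, h2,
    Finset.sum_add_distrib, h3]
  simp
  ring

theorem volPow_ne_zero (s : ℂ) : volPow s g x ≠ 0 := by
  rw [volPow, Complex.cpow_ne_zero_iff]
  left
  exact_mod_cast (metric_posDef g x).det_pos.ne'

theorem pd_volPow (s : ℂ) (k : Fin n) :
    pd k (volPow s g) x = s * (n + 1) * (psi g x k : ℂ) * volPow s g x := by
  have hp := (metric_posDef g x).det_pos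
  have hd := (contDiff_det (contDiff_metric g)).differentiableAt_of_smooth x
  have h0 := hasDerivAt_pd hd k
  have hc := (hasDerivAt_id ((metric g x).det : ℂ)).cpow_const (c := s / 2)
    (by left; simpa using hp)
  have h1 := HasDerivAt.comp_of_eq
    (h := fun t : ℝ => ((metric g (x + t • Pi.single k 1)).det : ℂ)) (0 : ℝ) hc h0.ofReal_comp
    (by simp)
  have h2 := h1.unique (hasDerivAt_pd ((contDiff_volPow s g).differentiableAt_of_smooth x) k)
  rw [← h2, pd_det_metric, volPow]
  have hne : ((metric g x).det : ℂ) ≠ 0 := by exact_mod_cast hp.ne'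
  simp only [id, Complex.cpow_sub _ _ hne, Complex.cpow_one]
  push_cast
  field_simp

/-- The Ricci tensor of the round sphere is `n - 1` times the metric. -/
theorem ricci_eq (i j : Fin n) : ricci g i j x = (n - 1) * metric g x i j := by
  have hd : ∀ a b i : Fin n, DifferentiableAt ℝ (fun y => if a = b then psi g y i else 0) x := by
    intro a b i
    split_ifs
    · exact (contDiff_psi g i).differentiableAt_of_smooth x
    · fun_prop
  have hpd' : ∀ l a b i : Fin n, pd l (fun y => if a = b then psi g y i else 0) x
      = if a = b then psi g x i * psi g x l - metric g x i l else 0 := by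
    intro l a b i
    split_ifs
    · exact pd_psi g x i l
    · simp
  have hpd : ∀ l k i j : Fin n, pd l (christoffel g k i j) x
      = (if k = j then psi g x i * psi g x l - metric g x i l else 0)
        + if k = i then psi g x j * psi g x l - metric g x j l else 0 := by
    intro l k i j
    rw [funext (christoffel_eq g · k i j), pd_add (hd _ _ _) (hd _ _ _), hpd', hpd']
  simp only [ricci, hpd, christoffel_eq]
  simp only [Finset.sum_add_distrib, Finset.sum_sub_distrib, mul_add, add_mul, mul_ite, ite_mul,
    mul_zero, zero_mul, Finset.sum_ite_eq', Finset.mem_univ, if_true,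
    Finset.sum_const, Finset.card_univ, Fintype.card_fin, nsmul_eq_mul]
  rw [metric_symm g x j i]
  ring

theorem scalarCurvature_eq : scalarCurvature g x = (n : ℝ) * ((n : ℝ) - 1) := by
  have h : ∀ i, ∑ j, (metric g x)⁻¹ i j * ricci g i j x = (n : ℝ) - 1 := by
    intro i
    have := metric_inv_mul g x i i
    simp only [if_true] at this
    calc _ = (n - 1 : ℝ) * ∑ j, (metric g x)⁻¹ i j * metric g x j i := by
          rw [Finset.mul_sum]
          exact Finset.sum_congr rfl fun j _ => by rw [ricci_eq, metric_symm g x i j]; ring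
      _ = _ := by rw [this, mul_one]
  simp only [scalarCurvature, h, Finset.sum_const, Finset.card_univ, Fintype.card_fin, nsmul_eq_mul]

end Geometry

/-! ### The explicit quantization of quadratic symbols -/

section Explicit

variable {n : ℕ}

theorem sum_fin_one_arrow {M : Type*} [AddCommMonoid M] (F : Fin n → M) :
    ∑ i : Fin 1 → Fin n, F (i 0) = ∑ i, F i :=
  Fintype.sum_equiv (Equiv.funUnique (Fin 1) (Fin n)) _ _ fun _ => rfl

theorem sum_fin_two_arrow {M : Type*} [AddCommMonoid M] (F : Fin n → Fin n → M) :
    ∑ i : Fin 2 → Fin n, F (i 0) (i 1) = ∑ i, ∑ j, F i j := by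
  rw [← Fintype.sum_prod_type']
  exact Fintype.sum_equiv (finTwoArrowEquiv (Fin n)) _ _ fun _ => rfl

/-- The linear form `b^j(x) ξ_j`. -/
def linForm (b : (Fin n → ℝ) → Fin n → ℂ) (x ξ : Fin n → ℝ) : ℂ := ∑ j, b x j * ξ j

theorem contDiff_linForm (b : (Fin n → ℝ) → Fin n → ℂ) (x : Fin n → ℝ) :
    ContDiff ℝ ∞ (linForm b x) :=
  ContDiff.sum fun j _ => contDiff_const.mul (contDiff_ofReal (contDiff_apply ℝ ℝ j))

theorem contDiff_quadForm (a : (Fin n → ℝ) → Fin n → Fin n → ℂ) (x : Fin n → ℝ) :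
    ContDiff ℝ ∞ (quadForm a x) :=
  ContDiff.sum fun i _ => ContDiff.sum fun j _ => contDiff_const.mul
    ((contDiff_ofReal (contDiff_apply ℝ ℝ i)).mul (contDiff_ofReal (contDiff_apply ℝ ℝ j)))

theorem pd_linForm (b : (Fin n → ℝ) → Fin n → ℂ) (x ξ : Fin n → ℝ) (k : Fin n) :
    pd k (linForm b x) ξ = b x k := by
  have hc : ∀ i, DifferentiableAt ℝ (fun ξ : Fin n → ℝ => (ξ i : ℂ)) ξ := fun i =>
    (contDiff_ofReal (contDiff_apply ℝ ℝ i)).differentiableAt_of_smooth ξ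
  unfold linForm
  rw [pd_sum _ fun i => (differentiableAt_const (b x i)).fun_mul (hc i)]
  simp only [pd_const_mul _ (hc _), pd_ofReal (differentiableAt_apply (𝕜 := ℝ) _ ξ), pd_coord,
    ofReal_ite_one_zero]
  simp

theorem divOp_quadForm {a : (Fin n → ℝ) → Fin n → Fin n → ℂ} (ha : ContDiff ℝ ∞ a)
    (hs : ∀ x i j, a x i j = a x j i) :
    divOp (quadForm a) = linForm fun x j => 2 * ∑ i, pd i (fun y => a y i j) x := by
  funext x ξ
  have hd := fun i j => ((contDiff_entry ha i j).differentiableAt_of_smooth x)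
  have h : ∀ i, pd i (fun y => pd i (quadForm a y) ξ) x
      = ∑ j, 2 * pd i (fun y => a y i j) x * ξ j := by
    intro i
    have h1 : (fun y => pd i (quadForm a y) ξ) = fun y => ∑ j, 2 * (ξ j : ℂ) * a y i j := by
      funext y
      rw [pd_quadForm]
      refine Finset.sum_congr rfl fun j _ => ?_
      rw [hs y j i]; ring
    rw [h1, pd_sum _ fun j => (differentiableAt_const _).fun_mul (hd i j)]
    refine Finset.sum_congr rfl fun j _ => ?_
    rw [pd_const_mul _ (hd i j)]
    ring
  simp only [divOp, h, linForm]
  rw [Finset.sum_comm]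
  simp only [Finset.mul_sum, Finset.sum_mul]

theorem divOp_linForm {b : (Fin n → ℝ) → Fin n → ℂ} :
    divOp (linForm b) = fun x _ => ∑ i, pd i (fun y => b y i) x := by
  funext x ξ
  simp only [divOp, pd_linForm]

theorem normalOrder_quadForm (hbar : ℝ) {a : (Fin n → ℝ) → Fin n → Fin n → ℂ}
    (hs : ∀ x i j, a x i j = a x j i) {f : (Fin n → ℝ) → ℂ} (hf : ContDiff ℝ ∞ f)
    (x : Fin n → ℝ) :
    normalOrder hbar 2 (quadForm a) f x
      = (-Complex.I * hbar) ^ 2 * ∑ i, ∑ j, a x i j * pd i (pd j f) x := by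
  have h : ∀ k l, pd k (pd l (quadForm a x)) 0 = 2 * a x k l := by
    intro k l
    have : pd l (quadForm a x) = linForm (fun x j => 2 * a x l j) x := by
      funext ξ
      rw [pd_quadForm]
      refine Finset.sum_congr rfl fun j _ => ?_
      rw [hs x j l]; ring
    rw [this, pd_linForm, hs]
  unfold normalOrder
  simp only [pdIter_two _ (contDiff_quadForm a x), pdIter_two _ hf, h]
  rw [sum_fin_two_arrow fun k l => 1 / (Nat.factorial 2 : ℂ) * (2 * a x k l) * pd k (pd l f) x]
  simp [Nat.factorial]

theorem normalOrder_linForm (hbar : ℝ) (κ : ℂ) (b : (Fin n → ℝ) → Fin n → ℂ)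
    (f : (Fin n → ℝ) → ℂ) (x : Fin n → ℝ) :
    normalOrder hbar 1 (fun y ξ => κ * linForm b y ξ) f x
      = (-Complex.I * hbar) * κ * ∑ j, b x j * pd j f x := by
  unfold normalOrder
  simp only [pdIter_one]
  rw [sum_fin_one_arrow fun k =>
    1 / (Nat.factorial 1 : ℂ) * pd k (fun ξ => κ * linForm b x ξ) 0 * pd k f x]
  simp only [pd_const_mul κ ((contDiff_linForm b x).differentiableAt_of_smooth _), pd_linForm,
    Finset.mul_sum]
  refine Finset.sum_congr rfl fun j _ => ?_
  simp
  ring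

theorem normalOrder_zero (hbar : ℝ) (P : (Fin n → ℝ) → (Fin n → ℝ) → ℂ)
    (f : (Fin n → ℝ) → ℂ) (x : Fin n → ℝ) :
    normalOrder hbar 0 P f x = P x 0 * f x := by
  simp [normalOrder, pdIter_zero]

theorem affineQuantization_quadForm (hbar : ℝ) (lam mu : ℂ)
    {a : (Fin n → ℝ) → Fin n → Fin n → ℂ} (ha : ContDiff ℝ ∞ a)
    (hs : ∀ x i j, a x i j = a x j i) {f : (Fin n → ℝ) → ℂ} (hf : ContDiff ℝ ∞ f)
    (x : Fin n → ℝ) :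
    affineQuantization hbar lam mu 2 (quadForm a) f x
      = -(hbar : ℂ) ^ 2 * (∑ i, ∑ j, a x i j * pd i (pd j f) x
        + quantCoeff n lam mu 2 1 * ∑ j, 2 * (∑ i, pd i (fun y => a y i j) x) * pd j f x
        + quantCoeff n lam mu 2 2
          * (∑ j, pd j (fun y => 2 * ∑ i, pd i (fun z => a z i j) y) x) * f x) := by
  have hI : (-Complex.I * (hbar : ℂ)) ^ 2 = -(hbar : ℂ) ^ 2 := by
    rw [mul_pow, neg_sq, Complex.I_sq]; ring
  have h0 : normalOrder hbar 2 (fun y ξ => (-Complex.I * (hbar : ℂ)) ^ 0 * quadForm a y ξ) f x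
      = normalOrder hbar 2 (quadForm a) f x := by simp only [pow_zero, one_mul]
  rw [affineQuantization, Finset.sum_range_succ, Finset.sum_range_succ, Finset.sum_range_one]
  simp only [Function.iterate_zero, id, Function.iterate_succ, Function.comp_apply,
    divOp_quadForm ha hs, divOp_linForm]
  rw [show 2 - 0 = 2 from rfl, show 2 - 1 = 1 from rfl, show 2 - 2 = 0 from rfl, h0,
    normalOrder_quadForm hbar hs hf, normalOrder_linForm, normalOrder_zero, ← hI]
  simp only [quantCoeff]
  ring

end Explicit

/-! ### The quantized Hamiltonian compared with the Laplacian. -/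

section HamiltonianOperator

variable {n : ℕ} (g : SL n) (x : Fin n → ℝ)

/-- The coefficients `g^{ij} √(g^δ)` of the Hamiltonian. -/
def hamCoeff (δ : ℂ) (y : Fin n → ℝ) (i j : Fin n) : ℂ :=
  (((metric g y)⁻¹ i j : ℝ) : ℂ) * volPow δ g y

theorem hamiltonianFun_eq (δ : ℂ) : hamiltonianFun n δ g = quadForm (hamCoeff g δ) := by
  funext x ξ
  simp only [hamiltonianFun, quadForm, hamCoeff, Complex.ofReal_sum, Complex.ofReal_mul,
    Finset.sum_mul]
  exact Finset.sum_congr rfl fun i _ => Finset.sum_congr rfl fun j _ => by ring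

theorem contDiff_hamCoeff (δ : ℂ) : ContDiff ℝ ∞ (hamCoeff g δ) :=
  contDiff_pi.2 fun i => contDiff_pi.2 fun j =>
    (contDiff_ofReal (contDiff_metric_inv g i j)).mul (contDiff_volPow δ g)

theorem hamCoeff_symm (δ : ℂ) (i j : Fin n) : hamCoeff g δ x i j = hamCoeff g δ x j i := by
  rw [hamCoeff, hamCoeff, metric_inv_symm]

theorem contDiff_psiDual (i : Fin n) : ContDiff ℝ ∞ fun y => psiDual g y i :=
  ContDiff.sum fun p _ => (contDiff_metric_inv g i p).mul (contDiff_psi g p)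

/-- The squared norm of `psi`. -/
def psiSq : ℝ := ∑ p, psiDual g x p * psi g x p

/-- Derivatives of the volume factor give `δ(n+1)`; those of the inverse metric give `-2`, `-1` and,
from the term summed freely over `i`, `-n`. -/
theorem sum_pd_hamCoeff (δ : ℂ) (j : Fin n) :
    ∑ i, pd i (fun y => hamCoeff g δ y i j) x
      = (δ * (n + 1) - (n + 3)) * (psiDual g x j : ℂ) * volPow δ g x := by
  have hi := fun i j => (contDiff_metric_inv g i j).differentiableAt_of_smooth x
  have hic := fun i j => (contDiff_ofReal (contDiff_metric_inv g i j)).differentiableAt_of_smooth x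
  have hv := (contDiff_volPow δ g).differentiableAt_of_smooth x
  have h : ∀ i, pd i (fun y => hamCoeff g δ y i j) x
      = volPow δ g x * ((δ * (n + 1) - 2) * (((metric g x)⁻¹ j i * psi g x i : ℝ) : ℂ)
        - (if j = i then (psiDual g x i : ℂ) else 0) - psiDual g x j) := by
    intro i
    unfold hamCoeff
    rw [pd_mul (hic i j) hv, pd_ofReal (hi i j), pd_metric_inv, pd_volPow, metric_inv_symm g x j i]
    simp only [if_true]
    split_ifs <;> push_cast <;> ring
  simp only [h, ← Finset.mul_sum, Finset.sum_sub_distrib, ← Complex.ofReal_sum]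
  rw [← psiDual]
  simp
  ring

theorem sum_metric_inv_metric : ∑ i, ∑ j, (metric g x)⁻¹ i j * metric g x i j = n := by
  have : ∀ i, ∑ j, (metric g x)⁻¹ i j * metric g x i j = 1 := by
    intro i
    have := metric_inv_mul g x i i
    simp only [metric_symm g x _ i, if_true] at this
    exact this
  simp [this]

theorem sum_pd_psiDual : ∑ j, pd j (fun y => psiDual g y j) x = -(n + 2) * psiSq g x - n := by
  have hi := fun i j => (contDiff_metric_inv g i j).differentiableAt_of_smooth x
  have hp := fun i => (contDiff_psi g i).differentiableAt_of_smooth x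
  have h : ∀ j, pd j (fun y => psiDual g y j) x
      = ∑ p, (-(((metric g x)⁻¹ j p * psi g x p) * psi g x j)
        - (if p = j then psiDual g x j * psi g x p else 0) - psiDual g x p * psi g x p
        - (metric g x)⁻¹ j p * metric g x j p) := by
    intro j
    unfold psiDual
    rw [pd_sum _ fun p => (hi j p).fun_mul (hp p)]
    refine Finset.sum_congr rfl fun p _ => ?_
    rw [pd_mul (hi j p) (hp p), pd_psi, pd_metric_inv, metric_symm g x p j]
    simp only [if_true, psiDual]
    split_ifs <;> ring
  simp only [h, Finset.sum_sub_distrib, Finset.sum_neg_distrib, ← Finset.sum_mul]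
  have e1 : ∀ j, ∑ p, (metric g x)⁻¹ j p * psi g x p = psiDual g x j := fun _ => rfl
  have e2 : ∑ p, psiDual g x p * psi g x p = psiSq g x := rfl
  rw [sum_metric_inv_metric]
  simp [e1, e2]
  ring

theorem sum_pd_pd_hamCoeff (δ : ℂ) :
    ∑ j, pd j (fun y => 2 * ∑ i, pd i (fun z => hamCoeff g δ z i j) y) x
      = 2 * (δ * (n + 1) - (n + 3)) * ((δ * (n + 1) - (n + 2)) * (psiSq g x : ℂ) - n)
        * volPow δ g x := by
  have hd := fun j => (contDiff_psiDual g j).differentiableAt_of_smooth x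
  have hdc := fun j => (contDiff_ofReal (contDiff_psiDual g j)).differentiableAt_of_smooth x
  have hv := (contDiff_volPow δ g).differentiableAt_of_smooth x
  have h : ∀ j, pd j (fun y => 2 * ∑ i, pd i (fun z => hamCoeff g δ z i j) y) x
      = 2 * (δ * (n + 1) - (n + 3)) * volPow δ g x
        * (δ * (n + 1) * ((psiDual g x j * psi g x j : ℝ) : ℂ)
          + ((pd j (fun y => psiDual g y j) x : ℝ) : ℂ)) := by
    intro j
    have : (fun y => 2 * ∑ i, pd i (fun z => hamCoeff g δ z i j) y)
        = fun y => 2 * (δ * (n + 1) - (n + 3)) * ((psiDual g y j : ℂ) * volPow δ g y) := by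
      funext y
      rw [sum_pd_hamCoeff]
      ring
    rw [this, pd_const_mul _ ((hdc j).fun_mul hv), pd_mul (hdc j) hv, pd_ofReal (hd j), pd_volPow]
    push_cast
    ring
  simp only [h, ← Finset.mul_sum, Finset.sum_add_distrib, ← Complex.ofReal_sum]
  rw [sum_pd_psiDual, ← psiSq]
  push_cast
  ring

theorem covDeriv_eq (lam : ℂ) (i : Fin n) (f : (Fin n → ℝ) → ℂ) :
    covDeriv lam g i f x = pd i f x - lam * (n + 1) * (psi g x i : ℂ) * f x := by
  have : ∑ j, (christoffel g j i j x : ℂ) = (n + 1) * (psi g x i : ℂ) := by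
    simp only [christoffel_eq, if_true, Complex.ofReal_add, Finset.sum_add_distrib]
    rw [← Complex.ofReal_sum]
    simp
    rw [← Complex.ofReal_sum]
    simp
    ring
  rw [covDeriv, this]
  ring

/-- The density connection is `∂_i - λ(n+1)ψ_i`, since the trace of `Γ` is `(n+1)ψ_i`, and the
Christoffel term on the covector index turns `λ(n+1)` into `λ(n+1) + 1`. The metric term in the
derivative of `ψ` contracts to `n` and leaves the constant `λ(n+1)n`. -/
theorem laplacian_eq (lam : ℂ) {f : (Fin n → ℝ) → ℂ} (hf : ContDiff ℝ ∞ f) :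
    laplacian lam g f x = ∑ i, ∑ j, (((metric g x)⁻¹ i j : ℝ) : ℂ) * pd i (pd j f) x
      - 2 * (lam * (n + 1) + 1) * ∑ j, (psiDual g x j : ℂ) * pd j f x
      + (lam * (n + 1) * (lam * (n + 1) + 1) * (psiSq g x : ℂ) + lam * (n + 1) * n) * f x := by
  have hf0 := hf.differentiableAt_of_smooth x
  have hf1 := fun k => (contDiff_pd hf k).differentiableAt_of_smooth x
  have hp := fun i => (contDiff_psi g i).differentiableAt_of_smooth x
  have hpc := fun i => (contDiff_ofReal (contDiff_psi g i)).differentiableAt_of_smooth x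
  have hc : ∀ i j, covDeriv lam g i (covDeriv lam g j f) x
      = pd i (pd j f) x - lam * (n + 1) * ((psi g x j * psi g x i - metric g x j i : ℝ) : ℂ) * f x
        - lam * (n + 1) * (psi g x j : ℂ) * pd i f x
        - lam * (n + 1) * (psi g x i : ℂ) * (pd j f x - lam * (n + 1) * (psi g x j : ℂ) * f x) := by
    intro i j
    rw [covDeriv_eq, covDeriv_eq, funext (covDeriv_eq g · lam j f),
      pd_sub (hf1 j) (((differentiableAt_const _).fun_mul (hpc j)).fun_mul hf0),
      pd_mul ((differentiableAt_const _).fun_mul (hpc j)) hf0, pd_const_mul _ (hpc j),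
      pd_ofReal (hp j), pd_psi]
    ring
  have hG : ∀ i j, ∑ k, (christoffel g k i j x : ℂ) * covDeriv lam g k f x
      = (psi g x i : ℂ) * (pd j f x - lam * (n + 1) * (psi g x j : ℂ) * f x)
        + (psi g x j : ℂ) * (pd i f x - lam * (n + 1) * (psi g x i : ℂ) * f x) := by
    intro i j
    have : ∀ k, (christoffel g k i j x : ℂ) * covDeriv lam g k f x
        = (if k = j then (psi g x i : ℂ) * (pd k f x - lam * (n + 1) * (psi g x k : ℂ) * f x)
          else 0)
        + if k = i then (psi g x j : ℂ) * (pd k f x - lam * (n + 1) * (psi g x k : ℂ) * f x)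
          else 0 := by
      intro k
      rw [christoffel_eq, covDeriv_eq]
      split_ifs <;> push_cast <;> ring
    simp [this, Finset.sum_add_distrib]
  have hterm : ∀ i j, (((metric g x)⁻¹ i j : ℝ) : ℂ) * (covDeriv lam g i (covDeriv lam g j f) x
        - ∑ k, (christoffel g k i j x : ℂ) * covDeriv lam g k f x)
      = (((metric g x)⁻¹ i j : ℝ) : ℂ) * pd i (pd j f) x
        - (lam * (n + 1) + 1) * ((((metric g x)⁻¹ i j * psi g x j : ℝ) : ℂ) * pd i f x)
        - (lam * (n + 1) + 1) * ((((metric g x)⁻¹ j i * psi g x i : ℝ) : ℂ) * pd j f x)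
        + lam * (n + 1) * (lam * (n + 1) + 1) * f x
          * ((((metric g x)⁻¹ i j * psi g x j) * psi g x i : ℝ) : ℂ)
        + lam * (n + 1) * f x * (((metric g x)⁻¹ i j * metric g x i j : ℝ) : ℂ) := by
    intro i j
    rw [hc, hG, metric_inv_symm g x j i, metric_symm g x j i]
    push_cast
    ring
  have e1 : ∑ i, ∑ j, (((metric g x)⁻¹ i j * psi g x j : ℝ) : ℂ) * pd i f x
      = ∑ i, (psiDual g x i : ℂ) * pd i f x := by
    simp only [← Finset.sum_mul, ← Complex.ofReal_sum, psiDual]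
  have e2 : ∑ i, ∑ j, (((metric g x)⁻¹ j i * psi g x i : ℝ) : ℂ) * pd j f x
      = ∑ i, (psiDual g x i : ℂ) * pd i f x := by
    rw [Finset.sum_comm, e1]
  have e3 : ∑ i, ∑ j, ((((metric g x)⁻¹ i j * psi g x j) * psi g x i : ℝ) : ℂ) = psiSq g x := by
    simp only [← Finset.sum_mul, ← Complex.ofReal_sum, psiDual, psiSq]
  have e4 : ∑ i, ∑ j, (((metric g x)⁻¹ i j * metric g x i j : ℝ) : ℂ) = n := by
    simp only [← Complex.ofReal_sum, sum_metric_inv_metric, Complex.ofReal_natCast]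
  rw [laplacian]
  simp only [hterm, Finset.sum_add_distrib, Finset.sum_sub_distrib, ← Finset.mul_sum, e1, e2, e3,
    e4]
  ring

/-- The excluded values of `δ` are the zeros of these factors. For symbols of degree two only `l =
1` and `l = 2` matter: they are the denominators of the coefficients and, up to constants, the
differences of Casimir eigenvalues. -/
theorem weight_ne_zero {lam mu : ℂ} (hδ : ∀ l : ℕ, mu - lam ≠ 1 + (l : ℂ) / ((n : ℂ) + 1)) (l : ℕ) :
    (1 - (mu - lam)) * ((n : ℂ) + 1) + l ≠ 0 := by
  have hn1 : (n : ℂ) + 1 ≠ 0 := by exact_mod_cast n.succ_ne_zero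
  intro h
  apply hδ l
  field_simp
  linear_combination -h

theorem quantCoeff_two_one {lam mu : ℂ} (h : (1 - (mu - lam)) * ((n : ℂ) + 1) + 2 ≠ 0) :
    quantCoeff n lam mu 2 1 * ((1 - (mu - lam)) * ((n : ℂ) + 1) + 2) = 1 + (n + 1) * lam := by
  rw [show quantCoeff n lam mu 2 1 = ((2 : ℕ) - (0 : ℕ) - 1 + (n + 1) * lam)
    / (((0 : ℕ) + 1) * (2 * ((2 : ℕ) : ℂ) - (0 : ℕ) - 2 + (n + 1) * (1 - (mu - lam)))) * 1 from rfl]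
  have e : ((0 : ℕ) + 1) * (2 * ((2 : ℕ) : ℂ) - (0 : ℕ) - 2 + (n + 1) * (1 - (mu - lam)))
      = (1 - (mu - lam)) * ((n : ℂ) + 1) + 2 := by
    push_cast
    ring
  rw [e, mul_one, div_mul_cancel₀ _ h]
  push_cast
  ring

theorem quantCoeff_two_two {lam mu : ℂ} (h : (1 - (mu - lam)) * ((n : ℂ) + 1) + 1 ≠ 0) :
    quantCoeff n lam mu 2 2 * (2 * ((1 - (mu - lam)) * ((n : ℂ) + 1) + 1))
      = (n + 1) * lam * quantCoeff n lam mu 2 1 := by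
  rw [show quantCoeff n lam mu 2 2 = ((2 : ℕ) - (1 : ℕ) - 1 + (n + 1) * lam)
    / (((1 : ℕ) + 1) * (2 * ((2 : ℕ) : ℂ) - (1 : ℕ) - 2 + (n + 1) * (1 - (mu - lam))))
      * quantCoeff n lam mu 2 1 from rfl]
  have e : ((1 : ℕ) + 1) * (2 * ((2 : ℕ) : ℂ) - (1 : ℕ) - 2 + (n + 1) * (1 - (mu - lam)))
      = 2 * ((1 - (mu - lam)) * ((n : ℂ) + 1) + 1) := by
    push_cast
    ring
  rw [e, mul_right_comm, div_mul_cancel₀ _ (mul_ne_zero two_ne_zero h)]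
  push_cast
  ring

/-- The recursion for `C^2_m` is exactly what makes the first-order terms and the `|ψ|²` terms of
both sides coincide. The remaining multiple of `f` is constant and is absorbed by the curvature. -/
theorem affineQuantization_hamiltonian (hn : 2 ≤ n) (hbar : ℝ) (lam mu : ℂ)
    (hδ : ∀ l : ℕ, mu - lam ≠ 1 + (l : ℂ) / ((n : ℂ) + 1)) {f : (Fin n → ℝ) → ℂ}
    (hf : ContDiff ℝ ∞ f) :
    affineQuantization hbar lam mu 2 (hamiltonianFun n (mu - lam) g) f x
      = -(hbar : ℂ) ^ 2 * volPow (mu - lam) g x * (laplacian lam g f x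
          + curvCoeff n lam mu * (scalarCurvature g x : ℂ) * f x) := by
  have hn1 : (n : ℂ) + 1 ≠ 0 := by exact_mod_cast n.succ_ne_zero
  have hn2 : (n : ℂ) - 1 ≠ 0 := by
    intro h
    have : (n : ℂ) = (1 : ℕ) := by linear_combination h
    have := Nat.cast_injective this
    omega
  have h1 := weight_ne_zero hδ 1
  have h2 := weight_ne_zero hδ 2
  push_cast at h1 h2
  have hC1 : quantCoeff n lam mu 2 1 * ((mu - lam) * (n + 1) - (n + 3))
      = -(1 + (n + 1) * lam) := by
    linear_combination -quantCoeff_two_one h2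
  have hC2 : quantCoeff n lam mu 2 2 * 2
      = (n + 1) * lam / ((1 - (mu - lam)) * ((n : ℂ) + 1) + 1) * quantCoeff n lam mu 2 1 := by
    rw [div_mul_eq_mul_div, eq_div_iff h1]
    linear_combination quantCoeff_two_two h1
  -- With `A = (1-δ)(n+1)+1`, the identity `1 + (n+1)λ = (n+1)(μ-1) + A` brings the curvature term
  -- into the form of a difference of constants: that of the quantized Hamiltonian minus that of the
  -- Laplacian.
  have hR : curvCoeff n lam mu * ((n : ℂ) * (n - 1))
      = (n + 1) * lam * n * ((1 + (n + 1) * lam) / ((1 - (mu - lam)) * ((n : ℂ) + 1) + 1) - 1) := by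
    have e : 1 + ((n : ℂ) + 1) * lam
        = (n + 1) * (mu - 1) + ((1 - (mu - lam)) * ((n : ℂ) + 1) + 1) := by ring
    rw [e, add_div, div_self h1, curvCoeff]
    field_simp
    ring
  -- The zeroth-order term, with `s` standing for `|ψ|²`. The factor `A` in the double divergence
  -- cancels the denominator of `C^2_2` in the coefficient of `s` but survives in the constant.
  have hz : ∀ s : ℂ, quantCoeff n lam mu 2 2 * (2 * ((mu - lam) * (n + 1) - (n + 3))
        * (((mu - lam) * (n + 1) - (n + 2)) * s - n))
      = lam * (n + 1) * (lam * (n + 1) + 1) * s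
        + (n + 1) * lam * n * ((1 + (n + 1) * lam) / ((1 - (mu - lam)) * ((n : ℂ) + 1) + 1)) := by
    intro s
    have e : (mu - lam) * (n + 1) - ((n : ℂ) + 2) = -((1 - (mu - lam)) * ((n : ℂ) + 1) + 1) := by
      ring
    rw [e]
    generalize (1 - (mu - lam)) * ((n : ℂ) + 1) + 1 = A at h1 hC2 ⊢
    calc _ = quantCoeff n lam mu 2 2 * 2 * ((mu - lam) * (n + 1) - (n + 3)) * (-A * s - n) := by
          ring
      _ = (n + 1) * lam / A * (quantCoeff n lam mu 2 1 * ((mu - lam) * (n + 1) - (n + 3)))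
          * (-A * s - n) := by rw [hC2]; ring
      _ = _ := by
        rw [hC1]
        field_simp
        ring
  have hsum : ∀ j, 2 * (∑ i, pd i (fun y => hamCoeff g (mu - lam) y i j) x) * pd j f x
      = 2 * ((mu - lam) * (n + 1) - (n + 3)) * volPow (mu - lam) g x
        * ((psiDual g x j : ℂ) * pd j f x) := by
    intro j; rw [sum_pd_hamCoeff]; ring
  have ha : ∑ i, ∑ j, hamCoeff g (mu - lam) x i j * pd i (pd j f) x
      = volPow (mu - lam) g x * ∑ i, ∑ j, (((metric g x)⁻¹ i j : ℝ) : ℂ) * pd i (pd j f) x := by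
    simp only [Finset.mul_sum, hamCoeff]
    exact Finset.sum_congr rfl fun i _ => Finset.sum_congr rfl fun j _ => by ring
  rw [hamiltonianFun_eq, affineQuantization_quadForm hbar lam mu (contDiff_hamCoeff g _)
    (fun x => hamCoeff_symm g x _) hf, sum_pd_pd_hamCoeff, laplacian_eq g x lam hf,
    scalarCurvature_eq, ha]
  simp only [hsum, ← Finset.mul_sum]
  generalize ∑ i, ∑ j, (((metric g x)⁻¹ i j : ℝ) : ℂ) * pd i (pd j f) x = S
  generalize ∑ j, (psiDual g x j : ℂ) * pd j f x = U
  have hz := hz (psiSq g x)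
  push_cast
  rw [hR]
  linear_combination -(hbar : ℂ) ^ 2 * (2 * volPow (mu - lam) g x * U * hC1
    + volPow (mu - lam) g x * f x * hz)

end HamiltonianOperator

/-! ### Uniqueness of the equivariant quantization -/

section CasimirOperator

variable {n : ℕ}

/-- The part `ρ` preserves the order of a coefficient and acts by the scalar of that degree, while
`ν` lowers the order by one. The Casimir operator on operators is therefore triangular. -/
theorem casimir_rhoOp_nuOp (δ lam : ℂ) {T : (Fin n → ℝ) → Coeffs n} (hT : ContDiff ℝ ∞ T)
    {x : Fin n → ℝ} (hs : ∀ i j, (T x).1 i j = (T x).1 j i) :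
    ∑ a, ∑ b, lieSection (rhoOp δ) (nuOp lam) (centredUnit x a b)
        (lieSection (rhoOp δ) (nuOp lam) (centredUnit x b a) T) x
      = (casimirEig n δ 2 • (T x).1,
        casimirEig n δ 1 • (T x).2.1 + (2 : ℝ) • ∑ k, (nuOp lam (Pi.single k 1) (pd k T x)).2.1,
        casimirEig n δ 0 * (T x).2.2
          + (2 : ℝ) • ∑ k, (nuOp lam (Pi.single k 1) (pd k T x)).2.2) := by
  rw [casimir_centred _ _ hT, ← casimir_rhoTwo δ hs, ← casimir_rhoOne, ← casimir_rhoZero]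
  refine Prod.ext ?_ (Prod.ext ?_ ?_)
  · simp only [rhoOp_apply, Prod.fst_add, Prod.smul_fst, Prod.fst_sum, nuOp_apply,
      Finset.sum_const_zero, smul_zero, add_zero]
  · simp only [rhoOp_apply, Prod.fst_add, Prod.snd_add, Prod.smul_fst, Prod.smul_snd, Prod.fst_sum,
      Prod.snd_sum]
  · simp only [rhoOp_apply, Prod.snd_add, Prod.smul_snd, Prod.snd_sum]

theorem opOfCoeffs_sum {ι : Type*} (s : Finset ι) (T : ι → (Fin n → ℝ) → Coeffs n)
    (f : (Fin n → ℝ) → ℂ) (x : Fin n → ℝ) :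
    ∑ k ∈ s, opOfCoeffs (T k) f x = opOfCoeffs (fun y => ∑ k ∈ s, T k y) f x := by
  classical
  induction s using Finset.induction_on with
  | empty => simp [opOfCoeffs]
  | insert k s hk ih =>
    rw [Finset.sum_insert hk, ih]
    simp only [Finset.sum_insert hk, opOfCoeffs, Prod.fst_add, Prod.snd_add, Pi.add_apply, add_mul,
      Finset.sum_add_distrib]
    ring

theorem quadForm_sum {ι : Type*} (s : Finset ι) (a : ι → (Fin n → ℝ) → Fin n → Fin n → ℂ)
    (x ξ : Fin n → ℝ) :
    ∑ k ∈ s, quadForm (a k) x ξ = quadForm (fun y => ∑ k ∈ s, a k y) x ξ := by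
  classical
  induction s using Finset.induction_on with
  | empty => simp [quadForm]
  | insert k s hk ih =>
    rw [Finset.sum_insert hk, ih]
    simp only [Finset.sum_insert hk, quadForm, Pi.add_apply, add_mul, Finset.sum_add_distrib]

/-- The Casimir operator acts by a scalar on quadratic symbols. -/
theorem exists_casimir_symbol {δ : ℂ} {P : symbols n δ} {a : SL n → (Fin n → ℝ) → Fin n → Fin n → ℂ}
    (ha : ∀ g, ContDiff ℝ ∞ (a g)) (hs : ∀ g x i j, a g x i j = a g x j i)
    (hP : ∀ g, P.1 g = quadForm (a g)) (g : SL n) (x : Fin n → ℝ) :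
    ∃ P' P'' : Fin (n + 1) → Fin (n + 1) → symbols n δ,
      (∀ p q, IsLieSymbol (g.1 * centredUnit x q p * (g⁻¹).1) P (P' p q)) ∧
      (∀ p q, IsLieSymbol (g.1 * centredUnit x p q * (g⁻¹).1) (P' p q) (P'' p q)) ∧
      ∑ p, ∑ q, P'' p q = casimirEig n δ 2 • P := by
  have h1 := fun p q =>
    exists_isLieSymbol_quadForm (g.1 * centredUnit x q p * (g⁻¹).1) ha hP
  choose P' hP' hP'2 using h1
  have h2 := fun p q => exists_isLieSymbol_quadForm (g.1 * centredUnit x p q * (g⁻¹).1)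
    (fun h => contDiff_lieSection _ _ _ (ha h)) (hP'2 p q)
  choose P'' hP'' hP''2 using h2
  refine ⟨P', P'', hP', hP'', Subtype.ext ?_⟩
  have hc : ∀ (h : SL n) y, ∑ p, ∑ q, lieSection (rhoTwo δ) 0
      ((h⁻¹).1 * (g.1 * centredUnit x p q * (g⁻¹).1) * h.1)
      (lieSection (rhoTwo δ) 0 ((h⁻¹).1 * (g.1 * centredUnit x q p * (g⁻¹).1) * h.1) (a h)) y
      = casimirEig n δ 2 • a h y := by
    intro h y
    -- Seen from another chart `h`, the units centred at `x` in `g` are conjugates of the standard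
    -- matrix units, so `casimir_conj` allows them to be recentred at `y`.
    have hm : ∀ p q, (h⁻¹).1 * (g.1 * centredUnit x p q * (g⁻¹).1) * h.1
        = ((h⁻¹ * g).1 * shift x) * Matrix.single p q 1 * (shift (-x) * (g⁻¹ * h).1) := by
      intro p q
      simp only [centredUnit, Matrix.SpecialLinearGroup.coe_mul, Matrix.mul_assoc]
    have hS : ((h⁻¹ * g).1 * shift x) * (shift (-x) * (g⁻¹ * h).1) = 1 := by
      rw [Matrix.mul_assoc, ← Matrix.mul_assoc (shift x), shift_mul_shift_neg, Matrix.one_mul,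
        ← Matrix.SpecialLinearGroup.coe_mul]
      simp
    simp only [hm]
    rw [casimir_conj _ _ hS (shift_mul_shift_neg y) (ha h) y]
    have := casimir_centred (rhoTwo δ) 0 (ha h) y
    simp only [centredUnit] at this
    rw [this, ← casimir_rhoTwo δ (hs h y)]
    simp
  funext h y ξ
  have e : (∑ p, ∑ q, P'' p q).1 h y ξ = ∑ p, ∑ q, (P'' p q).1 h y ξ := by
    simp [Finset.sum_apply]
  have e2 : (casimirEig n δ 2 • P).1 h y ξ = casimirEig n δ 2 * P.1 h y ξ := rfl
  rw [e, e2, hP]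
  simp only [hP''2, quadForm_sum]
  simp only [quadForm, hc]
  simp only [Pi.smul_apply, smul_eq_mul, Finset.mul_sum, mul_assoc]

end CasimirOperator

/-! ### Determination of the lower-order coefficients. -/

section Uniqueness

variable {n : ℕ} {hbar : ℝ} {lam mu : ℂ} {Q : symbols n (mu - lam) →ₗ[ℂ] diffOps n lam mu}

/-- Equivariance is assumed for traceless matrices only, whereas matrix units may have a trace.
Since scalar matrices act trivially on rays, `Z` can be replaced by its traceless part; the
commutator is then read on coefficients. -/
theorem IsProjectiveQuantization.opOfCoeffs_lie (hQ : IsProjectiveQuantization hbar lam mu Q)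
    {Z : Matrix (Fin (n + 1)) (Fin (n + 1)) ℝ} {P P' : symbols n (mu - lam)}
    (hP : IsLieSymbol Z P P') {g : SL n} {T : (Fin n → ℝ) → Coeffs n} (hT : ContDiff ℝ ∞ T)
    (h : ∀ φ x, ((Q P).1 φ).1 g x = opOfCoeffs T (φ.1 g) x) (φ : densities n lam) (x : Fin n → ℝ) :
    ((Q P').1 φ).1 g x
      = opOfCoeffs (lieSection (rhoOp (mu - lam)) (nuOp lam) ((g⁻¹).1 * Z * g.1) T) (φ.1 g) x := by
  obtain ⟨Z', hZ', hZ⟩ := exists_traceless (n := n) Z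
  obtain ⟨φ', hφ'⟩ := exists_isLieDensity Z φ
  have e := hQ.equivariant Z' hZ' P P' (fun g x ξ => by rw [hP g x ξ, hZ]) φ φ'
    (fun g x => by rw [hφ' g x, hZ]) g x
  rw [e, h, show ((Q P).1 φ).1 g = opOfCoeffs T (φ.1 g) from funext (h φ),
    show φ'.1 g = lieDensity lam (actionField Z g) (φ.1 g) from funext (hφ' g), hZ]
  exact commutator_opOfCoeffs lam mu _ hT (φ.2.1 g) x

theorem IsProjectiveQuantization.exists_opOfCoeffs (hQ : IsProjectiveQuantization hbar lam mu Q)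
    {P : symbols n (mu - lam)} {g : SL n} {a : (Fin n → ℝ) → Fin n → Fin n → ℂ}
    (hP : P.1 g = quadForm a) (h2 : IsHomogeneous 2 P) (ha : ContDiff ℝ ∞ a)
    (hs : ∀ x i j, a x i j = a x j i) :
    ∃ T : (Fin n → ℝ) → Coeffs n, ContDiff ℝ ∞ T ∧
      (∀ x, (T x).1 = fun i j => -(hbar : ℂ) ^ 2 * a x i j) ∧
      ∀ φ x, ((Q P).1 φ).1 g x = opOfCoeffs T (φ.1 g) x := by
  obtain ⟨c, hc, h⟩ := hQ.principal 2 P h2 g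
  refine ⟨fun x => (fun i j => -(hbar : ℂ) ^ 2 * a x i j, fun j => c 1 (fun _ => j) x,
    c 0 Fin.elim0 x), ?_, fun _ => rfl, fun φ x => ?_⟩
  · refine ContDiff.prodMk ?_ (ContDiff.prodMk ?_ (hc _ _))
    · exact contDiff_pi.2 fun i => contDiff_pi.2 fun j => contDiff_const.mul (contDiff_entry ha i j)
    · exact contDiff_pi.2 fun j => hc _ _
  · have hI : (-Complex.I * (hbar : ℂ)) ^ 2 = -(hbar : ℂ) ^ 2 := by
      rw [mul_pow, neg_sq, Complex.I_sq]; ring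
    rw [h, hP, normalOrder_quadForm hbar hs (φ.2.1 g), hI, localOp, Finset.sum_range_succ,
      Finset.sum_range_one, opOfCoeffs]
    simp only [pdIter_zero, pdIter_one]
    have e : ∀ i : Fin 1 → Fin n, c 1 i x * pd (i 0) (φ.1 g) x
        = c 1 (fun _ => i 0) x * pd (i 0) (φ.1 g) x := by
      intro i
      rw [show (fun _ => i 0) = i from funext fun k => by rw [Subsingleton.elim k 0]]
    simp only [e]
    rw [sum_fin_one_arrow fun j => c 1 (fun _ => j) x * pd j (φ.1 g) x]
    simp only [Finset.mul_sum, mul_assoc]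
    have e0 : ∑ i : Fin 0 → Fin n, c 0 i x * φ.1 g x = c 0 Fin.elim0 x * φ.1 g x :=
      Fintype.sum_eq_single _ fun i hi => (hi (Subsingleton.elim _ _)).elim
    rw [e0]
    ring

/-- The lower order coefficients of the operator attached to a quadratic symbol are constrained by
the Casimir operator. -/
theorem IsProjectiveQuantization.casimir_eq (hQ : IsProjectiveQuantization hbar lam mu Q)
    {P : symbols n (mu - lam)} {a : SL n → (Fin n → ℝ) → Fin n → Fin n → ℂ}
    (ha : ∀ g, ContDiff ℝ ∞ (a g)) (hs : ∀ g x i j, a g x i j = a g x j i)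
    (hP : ∀ g, P.1 g = quadForm (a g)) {g : SL n} {T : (Fin n → ℝ) → Coeffs n}
    (hT : ContDiff ℝ ∞ T) (hT1 : ∀ x, (T x).1 = fun i j => -(hbar : ℂ) ^ 2 * a g x i j)
    (h : ∀ φ x, ((Q P).1 φ).1 g x = opOfCoeffs T (φ.1 g) x) (φ : densities n lam)
    (x : Fin n → ℝ) :
    (∑ j, ((casimirEig n (mu - lam) 2 - casimirEig n (mu - lam) 1) * (T x).2.1 j
        - 4 * (1 + (n + 1) * lam) * ∑ k, pd k (fun y => (T y).1 k j) x) * pd j (φ.1 g) x)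
      + ((casimirEig n (mu - lam) 2 - casimirEig n (mu - lam) 0) * (T x).2.2
        - 2 * (lam * (n + 1)) * ∑ k, pd k (fun y => (T y).2.1 k) x) * φ.1 g x = 0 := by
  obtain ⟨P', P'', hP', hP'', hsum⟩ := exists_casimir_symbol ha hs hP g x
  have hg : (g⁻¹).1 * g.1 = 1 := by
    rw [← Matrix.SpecialLinearGroup.coe_mul]; simp
  have hc : ∀ p q, (g⁻¹).1 * (g.1 * centredUnit x p q * (g⁻¹).1) * g.1 = centredUnit x p q := by
    intro p q
    rw [← Matrix.mul_assoc, ← Matrix.mul_assoc, hg, Matrix.one_mul, Matrix.mul_assoc, hg,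
      Matrix.mul_one]
  have hs1 : ∀ y i j, (T y).1 i j = (T y).1 j i := by
    intro y i j
    simp only [hT1, hs g y i j]
  have e1 : ∀ p q, ((Q (P'' p q)).1 φ).1 g x
      = opOfCoeffs (lieSection (rhoOp (mu - lam)) (nuOp lam) (centredUnit x p q)
        (lieSection (rhoOp (mu - lam)) (nuOp lam) (centredUnit x q p) T)) (φ.1 g) x := by
    intro p q
    have h1 := hQ.opOfCoeffs_lie (hP' p q) hT h
    have h2 := hQ.opOfCoeffs_lie (hP'' p q) (contDiff_lieSection _ _ _ hT) h1 φ x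
    simpa only [hc] using h2
  -- Linearity of `Q` carries the scalar action on the symbol over to the operator `Q P`.
  have e2 : ∑ p, ∑ q, ((Q (P'' p q)).1 φ).1 g x
      = casimirEig n (mu - lam) 2 * ((Q P).1 φ).1 g x := by
    have : ((Q (∑ p, ∑ q, P'' p q)).1 φ).1 g x = ∑ p, ∑ q, ((Q (P'' p q)).1 φ).1 g x := by
      simp [map_sum, Finset.sum_apply, LinearMap.sum_apply]
    rw [← this, hsum, map_smul]
    rfl
  simp only [e1, opOfCoeffs_sum, h] at e2
  -- The factor 4 comes from the 2 of `casimir_centred` and the two equal terms `a^{jk}`, `a^{kj}`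
  -- in `nuOp`.
  have e3 : ∀ j, ((2 : ℝ) • ∑ k, (nuOp lam (Pi.single k 1) (pd k T x)).2.1) j
      = 4 * (1 + (n + 1) * lam) * ∑ k, pd k (fun y => (T y).1 k j) x := by
    intro j
    have hk : ∀ k, (nuOp lam (Pi.single k 1) (pd k T x)).2.1 j
        = 2 * (1 + (n + 1) * lam) * pd k (fun y => (T y).1 k j) x := by
      intro k
      rw [nuOp_apply]
      simp only [pd_coeffs_two hT, hs1 _ j]
      rw [Finset.sum_eq_single k (by intro l _ hl; simp [hl]) (by simp)]
      simp
      ring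
    simp only [Pi.smul_apply, Finset.sum_apply, hk, Complex.real_smul, ← Finset.mul_sum]
    push_cast
    ring
  have e4 : (2 : ℝ) • ∑ k, (nuOp lam (Pi.single k 1) (pd k T x)).2.2
      = 2 * (lam * (n + 1)) * ∑ k, pd k (fun y => (T y).2.1 k) x := by
    have hk : ∀ k, (nuOp lam (Pi.single k 1) (pd k T x)).2.2
        = lam * (n + 1) * pd k (fun y => (T y).2.1 k) x := by
      intro k
      rw [nuOp_apply]
      simp only [pd_coeffs_one hT]
      rw [Finset.sum_eq_single k (by intro l _ hl; simp [hl]) (by simp)]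
      simp
    simp only [hk, Complex.real_smul, ← Finset.mul_sum]
    push_cast
    ring
  have e5 := casimir_rhoOp_nuOp (mu - lam) lam hT (hs1 x)
  simp only [opOfCoeffs, e5, e4, Pi.add_apply, e3, Pi.smul_apply, smul_eq_mul, add_mul,
    Finset.sum_add_distrib] at e2
  simp only [sub_mul, Finset.sum_sub_distrib]
  simp only [mul_assoc, ← Finset.mul_sum] at e2 ⊢
  linear_combination -e2

theorem volPow_transition (s : ℂ) {g h : SL n} {x y : Fin n → ℝ} (e : param g x = param h y) :
    volPow s g x = jacPow s g h x * volPow s h y := by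
  have hdet : (metric g x).det = |(jac g h x).det| ^ 2 * (metric h y).det := by
    rw [metric_transition e, Matrix.det_mul, Matrix.det_mul, Matrix.det_transpose, sq_abs]
    ring
  have ha : 0 < |(jac g h x).det| := abs_pos.2 (det_jac_ne_zero e)
  rw [volPow, volPow, jacPow, hdet, Complex.ofReal_mul,
    Complex.mul_cpow_ofReal_nonneg (by positivity) (metric_posDef h y).det_pos.le]
  congr 1
  rw [Complex.ofReal_pow, ← Complex.cpow_nat_mul']
  · congr 1
    push_cast
    ring
  · rw [Complex.arg_ofReal_of_nonneg ha.le]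
    simp [Real.pi_pos]
  · rw [Complex.arg_ofReal_of_nonneg ha.le]
    simp [Real.pi_pos.le]

/-- The density attached to a function on the sphere by means of the round metric. -/
def densityOfFun (lam : ℂ) (F : EuclideanSpace ℝ (Fin (n + 1)) → ℝ) (hF : ContDiff ℝ ∞ F) :
    densities n lam :=
  ⟨fun h y => volPow lam h y * (F (param h y) : ℂ),
    fun h => (contDiff_volPow lam h).mul (contDiff_ofReal (hF.comp (contDiff_param h))),
    fun g h x y e => by
      simp only [volPow_transition lam e, e, mul_assoc]⟩

theorem exists_density_ne_zero (lam : ℂ) (g : SL n) (x : Fin n → ℝ) :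
    ∃ φ : densities n lam, φ.1 g x ≠ 0 :=
  ⟨densityOfFun lam (fun _ => 1) contDiff_const, by
    simpa [densityOfFun] using volPow_ne_zero g x lam⟩

/-- The density comes from a linear function on `ℝ^{n+1}`, so it is globally defined. Its defining
vector `w = g^{kl} ∂_l param` is tangent to the sphere, which makes the function vanish at the
point, and is dual to the coordinate frame, which prescribes its gradient. -/
theorem exists_density_pd (lam : ℂ) (g : SL n) (x : Fin n → ℝ) (k : Fin n) :
    ∃ φ : densities n lam, φ.1 g x = 0 ∧
      ∀ j, pd j (φ.1 g) x = if j = k then volPow lam g x else 0 := by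
  set w : EuclideanSpace ℝ (Fin (n + 1)) := ∑ l, (metric g x)⁻¹ k l • pd l (param g) x with hw
  have h0 : inner ℝ w (param g x) = (0 : ℝ) := by
    rw [hw, real_inner_comm]
    simp only [inner_sum, real_inner_smul_right, inner_param_pd, mul_zero, Finset.sum_const_zero]
  have hd : DifferentiableAt ℝ (param g) x := (contDiff_param g).differentiableAt_of_smooth x
  have hi : ContDiff ℝ ∞ fun y => inner ℝ w (param g y) := contDiff_const.inner ℝ (contDiff_param g)
  have h1 : ∀ j, pd j (fun y => (inner ℝ w (param g y) : ℝ)) x = if k = j then 1 else 0 := by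
    intro j
    have : pd j (fun y => (inner ℝ w (param g y) : ℝ)) x = inner ℝ w (pd j (param g) x) :=
      pd_clm (innerSL ℝ w) hd j
    rw [this, ← metric_inv_mul g x k j]
    simp only [hw, sum_inner, real_inner_smul_left]
    rfl
  refine ⟨densityOfFun lam (fun v => inner ℝ w v) (contDiff_const.inner ℝ contDiff_id), ?_,
    fun j => ?_⟩
  · simp [densityOfFun, h0]
  · simp only [densityOfFun]
    rw [pd_mul ((contDiff_volPow lam g).differentiableAt_of_smooth x)
      ((contDiff_ofReal hi).differentiableAt_of_smooth x),
      pd_ofReal (hi.differentiableAt_of_smooth x), h1, h0]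
    by_cases hjk : j = k
    · simp [hjk]
    · simp [hjk, Ne.symm hjk]

/-- On quadratic symbols, a projectively equivariant quantization map is given by the explicit
formula. -/
theorem IsProjectiveQuantization.eq_affineQuantization
    (hQ : IsProjectiveQuantization hbar lam mu Q)
    (hδ : ∀ l : ℕ, mu - lam ≠ 1 + (l : ℂ) / ((n : ℂ) + 1))
    {P : symbols n (mu - lam)} {a : SL n → (Fin n → ℝ) → Fin n → Fin n → ℂ}
    (h2 : IsHomogeneous 2 P)
    (ha : ∀ g, ContDiff ℝ ∞ (a g)) (hs : ∀ g x i j, a g x i j = a g x j i)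
    (hP : ∀ g, P.1 g = quadForm (a g)) (φ : densities n lam) (g : SL n) (x : Fin n → ℝ) :
    ((Q P).1 φ).1 g x = affineQuantization hbar lam mu 2 (P.1 g) (φ.1 g) x := by
  obtain ⟨T, hT, hT1, h⟩ := hQ.exists_opOfCoeffs (hP g) h2 (ha g) (hs g)
  have hc := hQ.casimir_eq ha hs hP hT hT1 h
  have hA := weight_ne_zero hδ 1
  have hB := weight_ne_zero hδ 2
  push_cast at hA hB
  have hdd := fun y i j => (contDiff_entry (ha g) i j).differentiableAt_of_smooth y
  -- A density vanishing at `y` with gradient along `e_j` isolates `b^j` in the Casimir equation,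
  -- where the difference of eigenvalues is `2((1-δ)(n+1)+2)`. The formula is needed at every `y`
  -- because the equation for `c` differentiates `b`.
  have hb : ∀ y j, (T y).2.1 j = -(hbar : ℂ) ^ 2 * quantCoeff n lam mu 2 1
      * (2 * ∑ i, pd i (fun z => a g z i j) y) := by
    intro y j
    obtain ⟨φ, hφ0, hφ⟩ := exists_density_pd lam g y j
    have e := hc φ y
    simp only [hφ0, hφ, mul_zero, add_zero, mul_ite, Finset.sum_ite_eq', Finset.mem_univ, if_true]
      at e
    have e := (mul_eq_zero.1 e).resolve_right (volPow_ne_zero g y lam)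
    simp only [hT1, pd_const_mul _ (hdd _ _ _), ← Finset.mul_sum] at e
    refine mul_left_cancel₀ (mul_ne_zero two_ne_zero hB) ?_
    simp only [casimirEig] at e
    linear_combination e + 4 * (hbar : ℂ) ^ 2 * (∑ i, pd i (fun z => a g z i j) y)
      * quantCoeff_two_one hB
  have hpd := fun i j => contDiff_pd (contDiff_entry (ha g) i j) i
  have hdiv : ∀ j, ContDiff ℝ ∞ fun y => 2 * ∑ i, pd i (fun z => a g z i j) y := fun j =>
    contDiff_const.mul (ContDiff.sum fun i _ => hpd i j)
  have hc0 : (T x).2.2 = -(hbar : ℂ) ^ 2 * quantCoeff n lam mu 2 2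
      * ∑ j, pd j (fun y => 2 * ∑ i, pd i (fun z => a g z i j) y) x := by
    obtain ⟨φ, hφ0⟩ := exists_density_ne_zero lam g x
    have e := hc φ x
    -- With `b` known, the first-order part vanishes identically, so a density that is merely
    -- nonzero at `x` determines `c`. The difference of eigenvalues is here `4((1-δ)(n+1)+1)`.
    have ej : ∀ j, (casimirEig n (mu - lam) 2 - casimirEig n (mu - lam) 1) * (T x).2.1 j
        - 4 * (1 + (n + 1) * lam) * ∑ k, pd k (fun y => (T y).1 k j) x = 0 := by
      intro j
      simp only [hT1, pd_const_mul _ (hdd _ _ _), ← Finset.mul_sum, hb, casimirEig]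
      linear_combination -4 * (hbar : ℂ) ^ 2 * (∑ i, pd i (fun z => a g z i j) x)
        * quantCoeff_two_one hB
    simp only [ej, zero_mul, Finset.sum_const_zero, zero_add] at e
    have e := (mul_eq_zero.1 e).resolve_right hφ0
    simp only [hb, pd_const_mul _ ((hdiv _).differentiableAt_of_smooth x), ← Finset.mul_sum] at e
    refine mul_left_cancel₀ (mul_ne_zero (by norm_num : (4 : ℂ) ≠ 0) hA) ?_
    simp only [casimirEig] at e
    linear_combination e + 2 * (hbar : ℂ) ^ 2
      * (∑ j, pd j (fun y => 2 * ∑ i, pd i (fun z => a g z i j) y) x) * quantCoeff_two_two hA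
  rw [h, hP, affineQuantization_quadForm hbar lam mu (ha g) (hs g) (φ.2.1 g), opOfCoeffs, hc0]
  simp only [hT1, hb, mul_assoc, ← Finset.mul_sum]
  ring

theorem isHomogeneous_hamiltonian (n : ℕ) (δ : ℂ) : IsHomogeneous 2 (hamiltonian n δ) := by
  intro g x t ξ
  simp only [hamiltonian, hamiltonianFun_eq, quadForm, Pi.smul_apply, smul_eq_mul, Finset.mul_sum]
  refine Finset.sum_congr rfl fun i _ => Finset.sum_congr rfl fun j _ => ?_
  push_cast
  ring

end Uniqueness

end ProjQuant

end


/-! ### Quantization of the geodesic Hamiltonian of the round sphere. -/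

theorem proposition4p1 (n : ℕ) (hn : 2 ≤ n) (hbar : ℝ) (hhbar : hbar ≠ 0) (lam mu : ℂ)
    (hδ : ∀ l : ℕ, mu - lam ≠ 1 + (l : ℂ) / ((n : ℂ) + 1)) :
    -- every projectively equivariant quantization map sends the Hamiltonian to the operator
    (∀ Q : ProjQuant.symbols n (mu - lam) →ₗ[ℂ] ProjQuant.diffOps n lam mu,
      ProjQuant.IsProjectiveQuantization hbar lam mu Q →
      ∀ (φ : ProjQuant.densities n lam) (g : ProjQuant.SL n) (x : Fin n → ℝ),
        ((Q (ProjQuant.hamiltonian n (mu - lam))).1 φ).1 g x =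
          -(hbar : ℂ) ^ 2 * ProjQuant.volPow (mu - lam) g x *
            (ProjQuant.laplacian lam g (φ.1 g) x
              + ProjQuant.curvCoeff n lam mu * (ProjQuant.scalarCurvature g x : ℂ) * φ.1 g x)) ∧
    -- the explicit quantization map does so in every affine chart
    (∀ (g : ProjQuant.SL n) (f : (Fin n → ℝ) → ℂ), ContDiff ℝ ∞ f → ∀ x : Fin n → ℝ,
        ProjQuant.affineQuantization hbar lam mu 2
            ((ProjQuant.hamiltonian n (mu - lam)).1 g) f x =
          -(hbar : ℂ) ^ 2 * ProjQuant.volPow (mu - lam) g x *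
            (ProjQuant.laplacian lam g f x
              + ProjQuant.curvCoeff n lam mu * (ProjQuant.scalarCurvature g x : ℂ) * f x)) ∧
    -- the scalar curvature of the sphere
    (∀ (g : ProjQuant.SL n) (x : Fin n → ℝ),
        ProjQuant.scalarCurvature g x = (n : ℝ) * ((n : ℝ) - 1)) := by
  refine ⟨fun Q hQ φ g x => ?_, fun g f hf x => ?_, fun g x => ?_⟩
  · rw [← ProjQuant.affineQuantization_hamiltonian g x hn hbar lam mu hδ (φ.2.1 g)]
    exact hQ.eq_affineQuantization hδ (ProjQuant.isHomogeneous_hamiltonian n (mu - lam))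
      (fun g => ProjQuant.contDiff_hamCoeff g (mu - lam))
      (fun g x => ProjQuant.hamCoeff_symm g x (mu - lam))
      (fun g => ProjQuant.hamiltonianFun_eq g (mu - lam)) φ g x
  · exact ProjQuant.affineQuantization_hamiltonian g x hn hbar lam mu hδ hf
  · exact ProjQuant.scalarCurvature_eq g x
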